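/- **Setting.** Let $n\ge 2$ be a power of $2$, $\omega=e^{-2\pi \mathbf i/n}$, and for $x\in\mathbb C^n$ (indices modulo $n$) let $\widehat x_i=\frac1{\sqrt n}\sum_{j}\omega^{ij}x_j$. Running time is counted on a randomized real RAM: one step for every arithmetic operation or comparison on integers, reals and complex numbers, for rounding, for $\sqrt{\cdot}$, $\exp$, $\log$, $\sin$, $e^{\mathbf i\theta}$, modulus and phase, for every memory access (all memory cells other than the input are initially $0$), and for drawing a uniformly random integer from a given range. **The algorithm** \textsc{NoiselessSparseFFT} gets $n,k,L$ and random access to the entries of $x$. It has tuning constants $m,d,a\in\mathbb N$; put $\beta=2^{-m}$. Let $\delta=1/(4n^2L)$, $T=\log(64n/\delta)$, and let $K$ be the least power of $2$ with $K\ge k$. *Window.* For $B\ge 2$ bins and $\alpha\in(0,1)$ let $\tau=\frac{4B}{\alpha}\sqrt{2T}$, $C=\frac{1-\alpha/2}{2B}$, $R=\mathrm{round}(8BT/\alpha)+1$. In the time domain $G_i=\sqrt n\,e^{-2\pi^2i^2/\tau^2}\frac{\sin(2\pi Ci)}{\pi i}$ for $0<|i|\le R$ and $G_0=2C\sqrt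 n$ (values at positions congruent modulo $n$ are added up). In the frequency domain $\widehat{G'}_i=1$ for $|i|\le(1-\alpha)\frac n{2B}$, $\widehat{G'}_i=0$ for $|i|\ge\frac n{2B}$, and in between $\widehat{G'}_i=\frac12+\frac{e^{-y^2/2}}{\sqrt{2\pi}}\sum_{r=0}^{N}\frac{y^{2r+1}}{1\cdot3\cdots(2r+1)}$ with $y=\tau(C-|i|/n)$, $N=8\,\mathrm{round}(T)+8$ (the Gaussian distribution function at $y$, up to truncation). *\textsc{HashToBins}*$(\widehat z,\sigma,a',b,B,\alpha)$, for $\sigma$ odd and $B$ dividing $n$: with $(P_{\sigma,a',b}x)_i=x_{\sigma(i-a')}\omega^{\sigma bi}$, compute $v_j=\sum_{i\equiv j\ (B)}G_i(P_{\sigma,a',b}x)_i$ for $0\le j<B$ and replace $v$ by its unnormalized DFT of length $B$, by a fast Fourier transform. Then for each stored index $i$ of $\widehat z$ let $\pi=\sigma(i-b)\bmod n$, $h=\mathrm{round}(\pi B/n)$, $o=\pi-hn/B$, and subtract $\widehat{G'}_{o}\,\widehat z_i\,\omega^{a'\sigma i}$ from bin $h\bmod B$. Return the bins. *\textsc{NoiselessSparseFFTInner}*$(k',\widehat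 z,\alpha)$: let $B=n$ if $2^{m+d}k'\ge n$, and $B=k'/\beta$ otherwise. Choose $\sigma$ uniformly among the odd residues and $b$ uniformly among all residues modulo $n$. Let $\widehat u,\widehat u'$ be the results of \textsc{HashToBins} with $a'=0$ and $a'=1$. Start with $\widehat w=0$; for each $j$ with $|\widehat u_j|>\frac12$ set $\widehat w_i\gets\mathrm{round}(\operatorname{Re}\widehat u_j)$, where $i=\sigma^{-1}\,\mathrm{round}\big(\phi(\widehat u_j/\widehat u'_j)\frac n{2\pi}\big)\bmod n$ and $\phi$ is the phase in $[0,2\pi)$. Return $\widehat w$. *\textsc{NoiselessSparseFFT}*: start with $\widehat z=0$ (stored sparsely). For $t=0,1,\dots,\log_2K$ let $k_t=K/2^t$, $\alpha_t=2^{-a}2^{-t/2}$ and replace $\widehat z$ by $\widehat z+\textsc{NoiselessSparseFFTInner}(k_t,\widehat z,\alpha_t)$. Return $\widehat z$. **Theorem.** For all sufficiently large constants $m,d,a$ (that is, for all sufficiently small constants $\beta$ and $\alpha_0$, and all sufficiently large $d$) and every constant $c$ there is a constant $C$, depending only on $m,d,a,c$, such that the following holds for every power of two $n\ge2$, all integers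 $1\le k\le n$ and $1\le L\le n^c$, and every $x\in\mathbb C^n$ such that $\widehat x$ has at most $k$ non-zero entries and all entries of $\widehat x$ are in $\{-L,\dots,L\}$. The algorithm \textsc{NoiselessSparseFFT}, given $n,k,L$ and access to $x$, returns exactly the vector $\widehat x$ with probability at least $2/3$, and its expected running time is at most $C\,k\log n$. -/

import Mathlib

/-!
# A randomized real RAM with step counts, and the sparse FFT as a program for it

The machine works on integers, reals and complex numbers with unit cost per operation (arithmetic,
comparison, rounding, elementary functions, phase), has registers and random access arrays (all
zero at the start, except for the input) and can draw uniformly random integers.  Programs are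
finite syntax trees; their running time is computed from the syntax by the semantics.
-/

namespace SparseFFT

/-! ## The machine -/

/-- The sorts of values. -/
inductive Ty : Type
  | int
  | real
  | cpx
  deriving DecidableEq

/-- The values of each sort. -/
@[reducible] def Ty.Val : Ty → Type
  | .int => ℤ
  | .real => ℝ
  | .cpx => ℂ

/-- Unary machine operations (source sort, target sort). -/
inductive UnOp : Ty → Ty → Type
  | intToReal : UnOp .int .real
  | realToCpx : UnOp .real .cpx
  | absInt : UnOp .int .int
  | round : UnOp .real .int
  | sqrt : UnOp .real .real
  | exp : UnOp .real .real
  | log : UnOp .real .real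
  | sin : UnOp .real .real
  /-- `θ ↦ exp (iθ)` -/
  | cis : UnOp .real .cpx
  | re : UnOp .cpx .real
  | absCpx : UnOp .cpx .real
  | phase : UnOp .cpx .real

/-- Binary machine operations.  On integers `div` and `mod` are quotient and remainder. -/
inductive BinOp : Ty → Type
  | add (τ : Ty) : BinOp τ
  | sub (τ : Ty) : BinOp τ
  | mul (τ : Ty) : BinOp τ
  | div (τ : Ty) : BinOp τ
  | mod : BinOp .int

/-- The phase of a complex number, in `[0, 2π)`. -/
noncomputable def phase (z : ℂ) : ℝ :=
  if z.arg < 0 then z.arg + 2 * Real.pi else z.arg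

noncomputable def UnOp.eval : {τ υ : Ty} → UnOp τ υ → τ.Val → υ.Val
  | _, _, .intToReal, a => ((a : ℤ) : ℝ)
  | _, _, .realToCpx, a => ((a : ℝ) : ℂ)
  | _, _, .absInt, a => |(a : ℤ)|
  | _, _, .round, a => _root_.round (a : ℝ)
  | _, _, .sqrt, a => Real.sqrt a
  | _, _, .exp, a => Real.exp a
  | _, _, .log, a => Real.log a
  | _, _, .sin, a => Real.sin a
  | _, _, .cis, a => Complex.exp (((a : ℝ) : ℂ) * Complex.I)
  | _, _, .re, a => Complex.re a
  | _, _, .absCpx, a => ‖(a : ℂ)‖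
  | _, _, .phase, a => SparseFFT.phase a

noncomputable def BinOp.eval : {τ : Ty} → BinOp τ → τ.Val → τ.Val → τ.Val
  | _, .add .int, a, b => (a + b : ℤ)
  | _, .add .real, a, b => (a + b : ℝ)
  | _, .add .cpx, a, b => (a + b : ℂ)
  | _, .sub .int, a, b => (a - b : ℤ)
  | _, .sub .real, a, b => (a - b : ℝ)
  | _, .sub .cpx, a, b => (a - b : ℂ)
  | _, .mul .int, a, b => (a * b : ℤ)
  | _, .mul .real, a, b => (a * b : ℝ)
  | _, .mul .cpx, a, b => (a * b : ℂ)
  | _, .div .int, a, b => (a / b : ℤ)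
  | _, .div .real, a, b => (a / b : ℝ)
  | _, .div .cpx, a, b => (a / b : ℂ)
  | _, .mod, a, b => (a % b : ℤ)

/-- Expressions of each sort over a set `V` of names: integer constants, `π`, registers, array
cells, operations. -/
inductive Expr (V : Type) : Ty → Type
  | lit (z : ℤ) : Expr V .int
  | pi : Expr V .real
  | reg (τ : Ty) (x : V) : Expr V τ
  | arr (τ : Ty) (x : V) (i : Expr V .int) : Expr V τ
  | un {τ υ : Ty} (f : UnOp τ υ) (e : Expr V τ) : Expr V υ
  | bin {τ : Ty} (f : BinOp τ) (e₁ e₂ : Expr V τ) : Expr V τ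

/-- Comparisons. -/
inductive Cond (V : Type) : Type
  | eqInt (e₁ e₂ : Expr V .int)
  | ltInt (e₁ e₂ : Expr V .int)
  | leInt (e₁ e₂ : Expr V .int)
  | ltReal (e₁ e₂ : Expr V .real)
  | leReal (e₁ e₂ : Expr V .real)

/-- Statements.  `set` writes a register, `store` an array cell, `rand x e` puts a uniformly random
element of `{0, …, e - 1}` into the integer register `x`, and `loop x e body` runs `body` with
`x = 0, 1, …, e - 1` (`e` is evaluated once, at entry). -/
inductive Stmt (V : Type) : Type
  | set {τ : Ty} (x : V) (e : Expr V τ)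
  | store {τ : Ty} (x : V) (i : Expr V .int) (e : Expr V τ)
  | rand (x : V) (e : Expr V .int)
  | seq (s₁ s₂ : Stmt V)
  | ifThen (c : Cond V) (s : Stmt V)
  | ifElse (c : Cond V) (s₁ s₂ : Stmt V)
  | loop (x : V) (e : Expr V .int) (body : Stmt V)

/-- Memory: for every sort and name one register and one array. -/
structure State (V : Type) where
  reg : (τ : Ty) → V → τ.Val
  arr : (τ : Ty) → V → ℤ → τ.Val

section Semantics

variable {V : Type} [DecidableEq V]

def State.setReg (s : State V) {τ : Ty} (x : V) (v : τ.Val) : State V :=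
  { s with reg := Function.update s.reg τ (Function.update (s.reg τ) x v) }

def State.setArr (s : State V) {τ : Ty} (x : V) (i : ℤ) (v : τ.Val) : State V :=
  { s with
    arr := Function.update s.arr τ
      (Function.update (s.arr τ) x (Function.update (s.arr τ x) i v)) }

noncomputable def Expr.eval (s : State V) : {τ : Ty} → Expr V τ → τ.Val
  | _, .lit z => z
  | _, .pi => Real.pi
  | _, .reg τ x => s.reg τ x
  | _, .arr τ x i => s.arr τ x (i.eval s)
  | _, .un f e => f.eval (e.eval s)
  | _, .bin f e₁ e₂ => f.eval (e₁.eval s) (e₂.eval s)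

/-- The cost of evaluating an expression: one step per node. -/
def Expr.cost : {τ : Ty} → Expr V τ → ℕ
  | _, .lit _ => 1
  | _, .pi => 1
  | _, .reg _ _ => 1
  | _, .arr _ _ i => i.cost + 1
  | _, .un _ e => e.cost + 1
  | _, .bin _ e₁ e₂ => e₁.cost + e₂.cost + 1

def Cond.holds (s : State V) : Cond V → Prop
  | .eqInt e₁ e₂ => (e₁.eval s : ℤ) = e₂.eval s
  | .ltInt e₁ e₂ => (e₁.eval s : ℤ) < e₂.eval s
  | .leInt e₁ e₂ => (e₁.eval s : ℤ) ≤ e₂.eval s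
  | .ltReal e₁ e₂ => (e₁.eval s : ℝ) < e₂.eval s
  | .leReal e₁ e₂ => (e₁.eval s : ℝ) ≤ e₂.eval s

def Cond.cost : Cond V → ℕ
  | .eqInt e₁ e₂ => e₁.cost + e₂.cost + 1
  | .ltInt e₁ e₂ => e₁.cost + e₂.cost + 1
  | .leInt e₁ e₂ => e₁.cost + e₂.cost + 1
  | .ltReal e₁ e₂ => e₁.cost + e₂.cost + 1
  | .leReal e₁ e₂ => e₁.cost + e₂.cost + 1

/-- `RunM V` is the law of a final memory together with the number of steps made. -/
abbrev RunM (V : Type) : Type := PMF (State V × ℕ)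

/-- Continue a run with `f`, adding up the steps. -/
noncomputable def RunM.andThen (p : RunM V) (f : State V → RunM V) : RunM V :=
  p.bind fun r => (f r.1).map fun r' => (r'.1, r.2 + r'.2)

/-- Charge `c` steps. -/
noncomputable def RunM.charge (c : ℕ) (p : RunM V) : RunM V :=
  p.map fun r => (r.1, c + r.2)

/-- `f 0`, then `f 1`, …, then `f (m - 1)`. -/
noncomputable def RunM.iterate (f : ℕ → State V → RunM V) : ℕ → State V → RunM V
  | 0, s => PMF.pure (s, 0)
  | m + 1, s => RunM.andThen (RunM.iterate f m s) (f m)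

open scoped Classical in
/-- The joint law of the final memory and of the number of steps of a statement. -/
noncomputable def Stmt.run : Stmt V → State V → RunM V
  | .set x e, s => PMF.pure (s.setReg x (e.eval s), e.cost + 1)
  | .store x i e, s => PMF.pure (s.setArr x (i.eval s) (e.eval s), i.cost + e.cost + 1)
  | .rand x e, s =>
      (PMF.uniformOfFinset (Finset.range ((e.eval s).toNat - 1 + 1))
        Finset.nonempty_range_add_one).map
          fun j => (s.setReg (τ := .int) x (j : ℤ), e.cost + 1)
  | .seq s₁ s₂, s => RunM.andThen (s₁.run s) s₂.run
  | .ifThen c s₁, s => RunM.charge (c.cost + 1) (if c.holds s then s₁.run s else PMF.pure (s, 0))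
  | .ifElse c s₁ s₂, s => RunM.charge (c.cost + 1) (if c.holds s then s₁.run s else s₂.run s)
  | .loop x e body, s => RunM.charge (e.cost + 1)
      (RunM.iterate
        (fun j s' => RunM.charge 1 (body.run (s'.setReg (τ := .int) x (j : ℤ))))
        (e.eval s).toNat s)

end Semantics

/-- The expected number of steps of a run. -/
noncomputable def expectedSteps {V : Type} (p : RunM V) : ENNReal :=
  ∑' r : State V × ℕ, p r * (r.2 : ENNReal)

/-- The probability that the final memory of a run satisfies `Q`. -/
noncomputable def probability {V : Type} (p : RunM V) (Q : State V → Prop) : ENNReal :=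
  p.toOuterMeasure {r | Q r.1}

/-! ## The sparse FFT program -/

/-- The names used by the program. -/
inductive Name : Type
  /- input: the registers `n`, `k`, `L` and the array `x` -/
  | n | k | L | x
  /- output: the sparse vector `zhat`, the list `zlist` of the `zcnt` indices where it is stored -/
  | zhat | zlist | zcnt | seen
  /- outer loop -/
  | K | logK | kt | pw | t | delta | T | alpha
  /- inner procedure -/
  | B | logB | Q | M | sigma | b | sigmaInv | tau | C | R | N | u | u' | what | wlist | wcnt
  /- hashing, and loop counters -/
  | i | j | l | r | s | q | h | o | g | y | term | ser | tmp | row | col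
  deriving DecidableEq

section Program

abbrev IExpr : Type := Expr Name .int
abbrev RExpr : Type := Expr Name .real
abbrev CExpr : Type := Expr Name .cpx

instance {τ : Ty} : Add (Expr Name τ) := ⟨.bin (.add τ)⟩
instance {τ : Ty} : Sub (Expr Name τ) := ⟨.bin (.sub τ)⟩
instance {τ : Ty} : Mul (Expr Name τ) := ⟨.bin (.mul τ)⟩
instance {τ : Ty} : Div (Expr Name τ) := ⟨.bin (.div τ)⟩
instance : Mod (Expr Name .int) := ⟨.bin .mod⟩
instance (m : ℕ) : OfNat (Expr Name .int) m := ⟨.lit m⟩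
instance (m : ℕ) : OfNat (Expr Name .real) m := ⟨.un .intToReal (.lit m)⟩
instance (m : ℕ) : OfNat (Expr Name .cpx) m := ⟨.un .realToCpx (.un .intToReal (.lit m))⟩

/-- integer register -/
abbrev int (v : Name) : IExpr := .reg .int v
/-- real register -/
abbrev real (v : Name) : RExpr := .reg .real v
/-- complex register -/
abbrev cpx (v : Name) : CExpr := .reg .cpx v
/-- cell of an integer array -/
abbrev intAt (v : Name) (i : IExpr) : IExpr := .arr .int v i
/-- cell of a complex array -/
abbrev cpxAt (v : Name) (i : IExpr) : CExpr := .arr .cpx v i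
abbrev toR (e : IExpr) : RExpr := .un .intToReal e
abbrev toC (e : RExpr) : CExpr := .un .realToCpx e
abbrev sqrtE (e : RExpr) : RExpr := .un .sqrt e
abbrev expE (e : RExpr) : RExpr := .un .exp e
abbrev sinE (e : RExpr) : RExpr := .un .sin e
abbrev roundE (e : RExpr) : IExpr := .un .round e
abbrev absE (e : IExpr) : IExpr := .un .absInt e
/-- `exp (-2πi · num / den)` -/
abbrev rootE (num den : IExpr) : CExpr := .un .cis (0 - 2 * .pi * toR num / toR den)

infixr:40 " ;; " => Stmt.seq
infix:45 " ≔ " => Stmt.set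

/-- `lg := ⌈log₂ e⌉` and `pow := 2 ^ lg`, in `O(e)` steps. -/
def powerOfTwoAbove (pow lg : Name) (e : IExpr) : Stmt Name :=
  pow ≔ (1 : IExpr) ;;
  lg ≔ (0 : IExpr) ;;
  .loop .i e (.ifThen (.ltInt (int pow) e) (pow ≔ 2 * int pow ;; lg ≔ int lg + 1))

/-- Replaces the array `v` of length `B = 2 ^ logB` by its unnormalized discrete Fourier transform.
At the start of stage `s` (where `Q = 2 ^ s`) the cell `row * Q + col` with `col < Q` holds the
coefficient `col` of the transform of length `Q` of the old entries whose positions are congruent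
to `row` modulo `B / Q`. -/
def fft (v : Name) : Stmt Name :=
  .Q ≔ (1 : IExpr) ;;
  .loop .s (int .logB) (
    .loop .l (int .B) (
      .col ≔ int .l % (2 * int .Q) ;;
      .row ≔ int .l / (2 * int .Q) ;;
      .store .tmp (int .l)
        (cpxAt v (int .row * int .Q + int .col % int .Q)
          + rootE (int .col) (2 * int .Q)
            * cpxAt v ((int .row + int .B / (2 * int .Q)) * int .Q + int .col % int .Q))) ;;
    .loop .l (int .B) (.store v (int .l) (cpxAt .tmp (int .l))) ;;
    .Q ≔ 2 * int .Q)

/-- The parameters of the flat window with `B` bins, transition width `alpha` and accuracy `delta`: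
the precision `tau` of the Gaussian in the frequency domain, the half-width `C` of the box, the
radius `R` of the support in the time domain, and the number `N` of terms of the series. -/
def windowParameters : Stmt Name :=
  .tau ≔ 4 * toR (int .B) / real .alpha * sqrtE (2 * real .T) ;;
  .C ≔ (1 - real .alpha / 2) / (2 * toR (int .B)) ;;
  .R ≔ roundE (8 * toR (int .B) / real .alpha * real .T) + 1 ;;
  .N ≔ 8 * roundE (real .T) + 8

/-- The flat window in the time domain: `g := √n · exp (-2π²i²/tau²) · sin (2πCi) / (πi)`, for
`|i| ≤ R`.  (Positions are taken modulo `n`, values at congruent positions add up.) -/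
def windowTime : Stmt Name :=
  .ifElse (.eqInt (int .i) 0)
    (.g ≔ sqrtE (toR (int .n)) * (2 * real .C))
    (.g ≔ sqrtE (toR (int .n))
        * expE (0 - 2 * (.pi * .pi) * toR (int .i * int .i) / (real .tau * real .tau))
        * sinE (2 * .pi * real .C * toR (int .i)) / (.pi * toR (int .i)))

/-- The flat window in the frequency domain at offset `o`: it is `1` for
`|o| ≤ (1 - alpha) n / (2B)` and `0` for `|o| ≥ n / (2B)`; in between it is the distribution function
of the standard Gaussian at `tau (C - |o|/n)`, to within the truncation of the series
`1/2 + exp (-y²/2) / √(2π) · (y + y³/3 + y⁵/(3·5) + ⋯)`. -/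
def windowFrequency : Stmt Name :=
  .ifElse (.leReal (toR (2 * int .B * absE (int .o))) ((1 - real .alpha) * toR (int .n)))
    (.g ≔ (1 : RExpr))
    (.ifElse (.leInt (int .n) (2 * int .B * absE (int .o)))
      (.g ≔ (0 : RExpr))
      (.y ≔ real .tau * (real .C - toR (absE (int .o)) / toR (int .n)) ;;
       .term ≔ real .y ;;
       .ser ≔ real .y ;;
       .loop .r (int .N) (
         .term ≔ real .term * (real .y * real .y) / toR (2 * int .r + 3) ;;
         .ser ≔ real .ser + real .term) ;;
       .g ≔ 1 / 2 + expE (0 - real .y * real .y / 2) / sqrtE (2 * .pi) * real .ser))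

/-- HashToBins for the spectrum permutation with parameters `sigma`, `a`, `b`; the `B` bins are put
into the array `out`. -/
def hashToBins (a : IExpr) (out : Name) : Stmt Name :=
  .loop .j (int .B) (.store out (int .j) (0 : CExpr)) ;;
  .loop .l (2 * int .R + 1) (
    .i ≔ int .l - int .R ;;
    windowTime ;;
    .q ≔ int .i % int .B ;;
    .store out (int .q)
      (cpxAt out (int .q)
        + toC (real .g) * cpxAt .x ((int .sigma * (int .i - a)) % int .n)
          * rootE (int .sigma * int .b * int .i) (int .n))) ;;
  fft out ;;
  .loop .l (int .zcnt) (
    .i ≔ intAt .zlist (int .l) ;;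
    .q ≔ (int .sigma * (int .i - int .b)) % int .n ;;
    .h ≔ (2 * int .q + int .M) / (2 * int .M) ;;
    .o ≔ int .q - int .h * int .M ;;
    windowFrequency ;;
    .q ≔ int .h % int .B ;;
    .store out (int .q)
      (cpxAt out (int .q)
        - toC (real .g) * toC (toR (intAt .zhat (int .i)))
          * rootE (a * int .sigma * int .i) (int .n)))

/-- NoiselessSparseFFTInner, followed by the update `zhat := zhat + what`.  The number `B` of bins
is `2 ^ m * kt`, except that it is `n` as soon as `2 ^ (m + d) * kt ≥ n`. -/
def noiselessSparseFFTInner (m d : ℕ) : Stmt Name :=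
  .ifElse (.leInt (int .n) (.lit (2 ^ (m + d)) * int .kt))
    (.B ≔ int .n)
    (.B ≔ .lit (2 ^ m) * int .kt) ;;
  .M ≔ int .n / int .B ;;
  powerOfTwoAbove .Q .logB (int .B) ;;
  .rand .sigma (int .n / 2) ;;
  .sigma ≔ 2 * int .sigma + 1 ;;
  .rand .b (int .n) ;;
  -- the inverse of `sigma` modulo the power of two `n`, by Newton iteration
  .sigmaInv ≔ (1 : IExpr) ;;
  .loop .i (roundE (real .T)) (
    .sigmaInv ≔ (int .sigmaInv * (2 - int .sigma * int .sigmaInv)) % int .n) ;;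
  windowParameters ;;
  hashToBins 0 .u ;;
  hashToBins 1 .u' ;;
  .wcnt ≔ (0 : IExpr) ;;
  .loop .j (int .B) (
    .ifThen (.ltReal (1 / 2) (.un .absCpx (cpxAt .u (int .j)))) (
      .i ≔ (int .sigmaInv
          * roundE (.un .phase (cpxAt .u (int .j) / cpxAt .u' (int .j))
              * toR (int .n) / (2 * .pi))) % int .n ;;
      .store .what (int .i) (roundE (.un .re (cpxAt .u (int .j)))) ;;
      .store .wlist (int .wcnt) (int .i) ;;
      .wcnt ≔ int .wcnt + 1)) ;;
  .loop .l (int .wcnt) (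
    .i ≔ intAt .wlist (int .l) ;;
    .ifThen (.eqInt (intAt .seen (int .i)) 0) (
      .store .seen (int .i) (1 : IExpr) ;;
      .store .zlist (int .zcnt) (int .i) ;;
      .zcnt ≔ int .zcnt + 1) ;;
    .store .zhat (int .i) (intAt .zhat (int .i) + intAt .what (int .i)) ;;
    .store .what (int .i) (0 : IExpr))

/-- NoiselessSparseFFT, with constants `β = 2 ^ (-m)` and `alpha_t = 2 ^ (-a) · 2 ^ (-t/2)`, for
`k` rounded up to a power of two. -/
def noiselessSparseFFT (m d a : ℕ) : Stmt Name :=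
  powerOfTwoAbove .K .logK (int .k) ;;
  .delta ≔ 1 / toR (4 * (int .n * int .n) * int .L) ;;
  .T ≔ .un .log (64 * toR (int .n) / real .delta) ;;
  .kt ≔ int .K ;;
  .pw ≔ (1 : IExpr) ;;
  .loop .t (int .logK + 1) (
    .alpha ≔ 1 / (toR (.lit (2 ^ a)) * sqrtE (toR (int .pw))) ;;
    noiselessSparseFFTInner m d ;;
    .kt ≔ int .kt / 2 ;;
    .pw ≔ 2 * int .pw)

end Program

/-! ## Input and output -/

/-- The Fourier spectrum `(1/√n) ∑ j, exp (-2πi·ij/n) x_j`. -/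
noncomputable def spectrum {n : ℕ} [NeZero n] (x : ZMod n → ℂ) (i : ZMod n) : ℂ :=
  1 / (Real.sqrt n : ℂ) * ZMod.dft x i

/-- The initial memory: `n`, `k`, `L` in registers, the signal `x` in an array with indices
`0, …, n - 1`, and zeros everywhere else. -/
noncomputable def initialState (n k L : ℕ) (x : ZMod n → ℂ) : State Name where
  reg τ v := match τ, v with
    | .int, .n => (n : ℤ)
    | .int, .k => (k : ℤ)
    | .int, .L => (L : ℤ)
    | .int, _ => (0 : ℤ)
    | .real, _ => (0 : ℝ)
    | .cpx, _ => (0 : ℂ)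
  arr τ v j := match τ, v with
    | .int, _ => (0 : ℤ)
    | .real, _ => (0 : ℝ)
    | .cpx, .x => if 0 ≤ j ∧ j < n then x (j : ZMod n) else (0 : ℂ)
    | .cpx, _ => (0 : ℂ)

open scoped Classical in
/-- The vector returned: it is given by the list `zlist[0], …, zlist[zcnt - 1]` of indices, with
value `zhat[i]` at a listed index `i`, and is zero elsewhere. -/
noncomputable def returned {n : ℕ} (s : State Name) (i : ZMod n) : ℂ :=
  if ∃ l : ℤ, 0 ≤ l ∧ l < s.reg .int .zcnt ∧ s.arr .int .zlist l = (i.val : ℤ)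
  then ((s.arr .int .zhat (i.val : ℤ) : ℤ) : ℂ) else 0

end SparseFFT

/-!
The only random choices of the program are the two draws in each round, of the odd residue `σ` and
of the shift `b`. Everything else is a deterministic computation, so that a run of a round is the
run of a deterministic program averaged over `σ` and `b` (`Stmt.run_eq_pure`, `expect_roundBody`).

*The bins.* The full series with the coefficients `G_i` is, by Poisson summation, the probability
that a centred Gaussian variable of standard deviation `1 / τ` lies within distance `C` of `φ + ℤ`
(`hasSum_smoothedBox`). With the accuracy `exp (-T)` this probability is `1` in the inner part of a
bin, `0` outside of the bin, and the value of a Gaussian distribution function in between; the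
latter is what the truncated odd series computes. Hence the truncated window in time is the
transform of the computed window in frequency up to `4 exp (-T)`
(`norm_windowSum_sub_windowFreq_le`), and every bin is, up to `1 / (64 n²)`, the sum of the residual
coefficients hashed to it, weighted by the window and by the phases `exp (-2πi a' σ f / n)`
(`norm_bin_sub_le`).

*One round.* A residual coefficient that is alone in its bin and away from the border of the bin is
read off exactly: its integer value is the rounded bin, and its position is the phase of the
quotient of the bins with `a' = 0` and `a' = 1` (`decode_bin`). An entry that is wrong after the
round is therefore bad, or was written because of a bin that holds only bad coefficients, so that
the residual after a round has at most twice as many elements as there are bad coefficients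
(`card_residual_round_le`). For a residual with `S` elements and `B` bins, the average share of bad
coefficients is at most `4 S / B + α + 2 B / n` (`sum_card_badSet_le`).

*Success.* A round is considered good if it shrinks the bound on the residual by the factor `8`. By
Markov's inequality, round `t` fails with probability at most `failureBound m d a t`
(`LoopInv.failure_le`), which decays geometrically because the number of bins is only halved in each
round and `α_t` is a multiple of `2 ^ (-t / 2)`. The sum is at most `1 / 3` (`sum_failureBound_le`),
and after `log₂ K + 1` good rounds the residual has fewer than one element. When `2 ^ (m + d) * K ≥
n`, the first round has one bin for each residue, hence neither collisions nor borders, and recovers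
the whole spectrum.

*Cost.* Filling and transforming the bins of round `t` takes `O((3 / 4) ^ t k log n)` steps. The
stored coefficients, at most `O(k)` at any time, cost `O(1)` each, except for those in the
transition region of the window, which cost `O(log n)`; their average share is `O((3 / 4) ^ t)` as
well (`sum_inTransition_le`). With `O(log n)` steps for the parameters, the expected cost of round
`t` is bounded by `costBound` (`LoopInv.cost_le`). There are at most `1 + log₂ n` rounds and `log₂ K
≤ K`, so that the sum is `O(k log n)` (`sum_costBound_le`).
-/


namespace SparseFFT

/-! ### Deterministic execution -/

section Deterministic

variable {V : Type}

theorem RunM.andThen_pure (s : State V) (c : ℕ) (f : State V → RunM V) :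
    RunM.andThen (PMF.pure (s, c)) f = RunM.charge c (f s) := by
  simp [RunM.andThen, RunM.charge, PMF.pure_bind]

theorem RunM.charge_pure (s : State V) (c c' : ℕ) :
    RunM.charge c (PMF.pure (s, c')) = PMF.pure (s, c + c') := by
  simp [RunM.charge, PMF.pure_map]

variable [DecidableEq V]

/-- `f 0`, then `f 1`, …, then `f (m - 1)`, applied to `s`. -/
def iter {α : Type*} (f : ℕ → α → α) : ℕ → α → α
  | 0, s => s
  | m + 1, s => f m (iter f m s)

theorem iter_induct {α : Type*} {f : ℕ → α → α} {m : ℕ} {s : α} (P : ℕ → α → Prop) (h0 : P 0 s)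
    (hs : ∀ j < m, ∀ s', P j s' → P (j + 1) (f j s')) : P m (iter f m s) := by
  induction m with
  | zero => exact h0
  | succ m ih => exact hs m (by omega) _ (ih fun j hj => hs j (by omega))

open scoped Classical in
/-- The final memory of a statement that draws no random numbers (`rand` is read as a no-op). -/
noncomputable def Stmt.exec : Stmt V → State V → State V
  | .set x e, s => s.setReg x (e.eval s)
  | .store x i e, s => s.setArr x (i.eval s) (e.eval s)
  | .rand _ _, s => s
  | .seq s₁ s₂, s => s₂.exec (s₁.exec s)
  | .ifThen c s₁, s => if c.holds s then s₁.exec s else s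
  | .ifElse c s₁ s₂, s => if c.holds s then s₁.exec s else s₂.exec s
  | .loop x e body, s =>
      iter (fun j s' => body.exec (s'.setReg (τ := .int) x (j : ℤ))) (e.eval s).toNat s

open scoped Classical in
/-- The number of steps of a statement that draws no random numbers. -/
noncomputable def Stmt.steps : Stmt V → State V → ℕ
  | .set _ e, _ => e.cost + 1
  | .store _ i e, _ => i.cost + e.cost + 1
  | .rand _ _, _ => 0
  | .seq s₁ s₂, s => s₁.steps s + s₂.steps (s₁.exec s)
  | .ifThen c s₁, s => c.cost + 1 + if c.holds s then s₁.steps s else 0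
  | .ifElse c s₁ s₂, s => c.cost + 1 + if c.holds s then s₁.steps s else s₂.steps s
  | .loop x e body, s => e.cost + 1 + ∑ j ∈ Finset.range (e.eval s).toNat,
      (1 + body.steps ((iter (fun j s' => body.exec (s'.setReg (τ := .int) x (j : ℤ))) j s).setReg
        (τ := .int) x (j : ℤ)))

/-- Whether a statement draws no random numbers. -/
def Stmt.randFree : Stmt V → Bool
  | .set _ _ => true
  | .store _ _ _ => true
  | .rand _ _ => false
  | .seq s₁ s₂ => s₁.randFree && s₂.randFree
  | .ifThen _ s₁ => s₁.randFree
  | .ifElse _ s₁ s₂ => s₁.randFree && s₂.randFree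
  | .loop _ _ body => body.randFree

theorem Stmt.run_eq_pure (st : Stmt V) (h : st.randFree = true) (s : State V) :
    st.run s = PMF.pure (st.exec s, st.steps s) := by
  induction st generalizing s with
  | set x e => rfl
  | store x i e => rfl
  | rand x e => simp [Stmt.randFree] at h
  | seq s₁ s₂ ih₁ ih₂ =>
    simp only [Stmt.randFree, Bool.and_eq_true] at h
    simp only [Stmt.run, Stmt.exec, Stmt.steps]
    rw [ih₁ h.1, RunM.andThen_pure, ih₂ h.2, RunM.charge_pure]
  | ifThen c s₁ ih =>
    simp only [Stmt.run, Stmt.exec, Stmt.steps]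
    split_ifs
    · rw [ih h, RunM.charge_pure]
    · rw [RunM.charge_pure]
  | ifElse c s₁ s₂ ih₁ ih₂ =>
    simp only [Stmt.randFree, Bool.and_eq_true] at h
    simp only [Stmt.run, Stmt.exec, Stmt.steps]
    split_ifs
    · rw [ih₁ h.1, RunM.charge_pure]
    · rw [ih₂ h.2, RunM.charge_pure]
  | loop x e body ih =>
    simp only [Stmt.run, Stmt.exec, Stmt.steps]
    generalize (e.eval s).toNat = m
    have key : RunM.iterate
        (fun j s' => RunM.charge 1 (body.run (s'.setReg (τ := .int) x (j : ℤ)))) m s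
        = PMF.pure (iter (fun j s' => body.exec (s'.setReg (τ := .int) x (j : ℤ))) m s,
          ∑ j ∈ Finset.range m, (1 + body.steps ((iter (fun j s' =>
            body.exec (s'.setReg (τ := .int) x (j : ℤ))) j s).setReg (τ := .int) x (j : ℤ)))) := by
      induction m with
      | zero => simp [RunM.iterate, iter]
      | succ m ihm =>
        simp only [RunM.iterate, iter]
        rw [ihm, RunM.andThen_pure, ih h, RunM.charge_pure, RunM.charge_pure,
          Finset.sum_range_succ]
    rw [key, RunM.charge_pure]

/-! ### Frame conditions -/

/-- Whether the register `x` of sort `τ` occurs as a target in a statement. -/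
def Stmt.writesReg (τ : Ty) (x : V) : Stmt V → Bool
  | .set (τ := υ) y _ => decide (υ = τ) && decide (y = x)
  | .store _ _ _ => false
  | .rand y _ => decide (Ty.int = τ) && decide (y = x)
  | .seq s₁ s₂ => s₁.writesReg τ x || s₂.writesReg τ x
  | .ifThen _ s₁ => s₁.writesReg τ x
  | .ifElse _ s₁ s₂ => s₁.writesReg τ x || s₂.writesReg τ x
  | .loop y _ body => (decide (Ty.int = τ) && decide (y = x)) || body.writesReg τ x

/-- Whether the array `x` of sort `τ` occurs as a target in a statement. -/
def Stmt.writesArr (τ : Ty) (x : V) : Stmt V → Bool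
  | .set _ _ => false
  | .store (τ := υ) y _ _ => decide (υ = τ) && decide (y = x)
  | .rand _ _ => false
  | .seq s₁ s₂ => s₁.writesArr τ x || s₂.writesArr τ x
  | .ifThen _ s₁ => s₁.writesArr τ x
  | .ifElse _ s₁ s₂ => s₁.writesArr τ x || s₂.writesArr τ x
  | .loop _ _ body => body.writesArr τ x

theorem State.setReg_reg_of_ne (s : State V) {υ τ : Ty} {y x : V} (v : υ.Val)
    (h : (decide (υ = τ) && decide (y = x)) = false) : (s.setReg y v).reg τ x = s.reg τ x := by
  by_cases hτ : υ = τ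
  · subst hτ
    have hx : y ≠ x := by simpa using h
    simp [State.setReg, Function.update_of_ne hx.symm]
  · simp [State.setReg, Function.update_of_ne (Ne.symm hτ)]

theorem State.setArr_arr_of_ne (s : State V) {υ τ : Ty} {y x : V} (i : ℤ) (v : υ.Val)
    (h : (decide (υ = τ) && decide (y = x)) = false) :
    (s.setArr y i v).arr τ x = s.arr τ x := by
  by_cases hτ : υ = τ
  · subst hτ
    have hx : y ≠ x := by simpa using h
    simp [State.setArr, Function.update_of_ne hx.symm]
  · simp [State.setArr, Function.update_of_ne (Ne.symm hτ)]

theorem Stmt.exec_reg (st : Stmt V) {τ : Ty} {x : V} (h : st.writesReg τ x = false)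
    (s : State V) : (st.exec s).reg τ x = s.reg τ x := by
  induction st generalizing s with
  | set y e => exact State.setReg_reg_of_ne s _ h
  | store y i e => rfl
  | rand y e => rfl
  | seq s₁ s₂ ih₁ ih₂ =>
    simp only [Stmt.writesReg, Bool.or_eq_false_iff] at h
    simp only [Stmt.exec]
    rw [ih₂ h.2, ih₁ h.1]
  | ifThen c s₁ ih =>
    simp only [Stmt.exec]
    split_ifs
    · exact ih h s
    · rfl
  | ifElse c s₁ s₂ ih₁ ih₂ =>
    simp only [Stmt.writesReg, Bool.or_eq_false_iff] at h
    simp only [Stmt.exec]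
    split_ifs
    · exact ih₁ h.1 s
    · exact ih₂ h.2 s
  | loop y e body ih =>
    simp only [Stmt.writesReg, Bool.or_eq_false_iff] at h
    simp only [Stmt.exec]
    refine iter_induct (fun _ (s' : State V) => s'.reg τ x = s.reg τ x) rfl fun j _ s' hs' => ?_
    rw [ih h.2, State.setReg_reg_of_ne s' _ h.1, hs']

theorem Stmt.exec_arr (st : Stmt V) {τ : Ty} {x : V} (h : st.writesArr τ x = false)
    (s : State V) : (st.exec s).arr τ x = s.arr τ x := by
  induction st generalizing s with
  | set y e => rfl
  | store y i e => exact State.setArr_arr_of_ne s _ _ h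
  | rand y e => rfl
  | seq s₁ s₂ ih₁ ih₂ =>
    simp only [Stmt.writesArr, Bool.or_eq_false_iff] at h
    simp only [Stmt.exec]
    rw [ih₂ h.2, ih₁ h.1]
  | ifThen c s₁ ih =>
    simp only [Stmt.exec]
    split_ifs
    · exact ih h s
    · rfl
  | ifElse c s₁ s₂ ih₁ ih₂ =>
    simp only [Stmt.writesArr, Bool.or_eq_false_iff] at h
    simp only [Stmt.exec]
    split_ifs
    · exact ih₁ h.1 s
    · exact ih₂ h.2 s
  | loop y e body ih =>
    simp only [Stmt.exec]
    refine iter_induct (fun _ (s' : State V) => s'.arr τ x = s.arr τ x) rfl fun j _ s' hs' => ?_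
    rw [ih h]
    exact hs'

/-! ### Bounds on the number of steps -/

/-- Whether a statement contains no loop. -/
def Stmt.loopFree : Stmt V → Bool
  | .set _ _ => true
  | .store _ _ _ => true
  | .rand _ _ => true
  | .seq s₁ s₂ => s₁.loopFree && s₂.loopFree
  | .ifThen _ s₁ => s₁.loopFree
  | .ifElse _ s₁ s₂ => s₁.loopFree && s₂.loopFree
  | .loop _ _ _ => false

/-- The sum of the costs of all atomic statements and tests of a statement.  It bounds the number
of steps if there is no loop. -/
def Stmt.size : Stmt V → ℕ
  | .set _ e => e.cost + 1
  | .store _ i e => i.cost + e.cost + 1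
  | .rand _ _ => 0
  | .seq s₁ s₂ => s₁.size + s₂.size
  | .ifThen c s₁ => c.cost + 1 + s₁.size
  | .ifElse c s₁ s₂ => c.cost + 1 + (s₁.size + s₂.size)
  | .loop _ e body => e.cost + 2 + body.size

theorem Stmt.steps_le_size (st : Stmt V) (h : st.loopFree = true) (s : State V) :
    st.steps s ≤ st.size := by
  induction st generalizing s with
  | set y e => exact le_rfl
  | store y i e => exact le_rfl
  | rand y e => exact le_rfl
  | seq s₁ s₂ ih₁ ih₂ =>
    simp only [Stmt.loopFree, Bool.and_eq_true] at h
    exact Nat.add_le_add (ih₁ h.1 s) (ih₂ h.2 _)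
  | ifThen c s₁ ih =>
    simp only [Stmt.steps, Stmt.size]
    have := ih h s
    split_ifs <;> omega
  | ifElse c s₁ s₂ ih₁ ih₂ =>
    simp only [Stmt.loopFree, Bool.and_eq_true] at h
    simp only [Stmt.steps, Stmt.size]
    have := ih₁ h.1 s
    have := ih₂ h.2 s
    split_ifs <;> omega
  | loop y e body ih => simp [Stmt.loopFree] at h

theorem Stmt.steps_loop_le {x : V} {e : Expr V .int} {body : Stmt V} {s : State V} (c : ℕ)
    (h : ∀ s', body.steps s' ≤ c) :
    (Stmt.loop x e body).steps s ≤ e.cost + 1 + (e.eval s : ℤ).toNat * (c + 1) := by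
  simp only [Stmt.steps]
  refine Nat.add_le_add_left ((Finset.sum_le_card_nsmul _ _ (c + 1) fun j _ => ?_).trans ?_) _
  · have := h ((iter (fun j s' => body.exec (s'.setReg (τ := .int) x (j : ℤ))) j s).setReg
      (τ := .int) x (j : ℤ))
    omega
  · simp

theorem Stmt.steps_le {st : Stmt V} {s : State V} (c : ℕ) (h : st.loopFree = true)
    (hc : st.size ≤ c) : st.steps s ≤ c :=
  (st.steps_le_size h s).trans hc

theorem Stmt.steps_simpleLoop_le {x : V} {e : Expr V .int} {body : Stmt V} {s : State V} (c m : ℕ)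
    (h : body.loopFree = true) (he : (e.eval s : ℤ) = m) (hc : body.size + 1 ≤ c) :
    (Stmt.loop x e body).steps s ≤ e.cost + 1 + m * c := by
  have h1 := Stmt.steps_loop_le (x := x) (e := e) (s := s) body.size fun s' =>
    Stmt.steps_le_size body h s'
  rw [he, Int.toNat_natCast] at h1
  exact h1.trans (Nat.add_le_add_left (Nat.mul_le_mul_left _ hc) _)

end Deterministic

/-! ### Registers and arrays of the program, by sort -/

section Access

/-- The content of an integer register. -/
def State.intReg (s : State Name) (v : Name) : ℤ := s.reg .int v
/-- The content of a real register. -/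
def State.realReg (s : State Name) (v : Name) : ℝ := s.reg .real v
/-- The content of a cell of an integer array. -/
def State.intArr (s : State Name) (v : Name) (j : ℤ) : ℤ := s.arr .int v j
/-- The content of a cell of a complex array. -/
def State.cpxArr (s : State Name) (v : Name) (j : ℤ) : ℂ := s.arr .cpx v j

/-- Write an integer register. -/
def State.setInt (s : State Name) (v : Name) (z : ℤ) : State Name := s.setReg (τ := .int) v z
/-- Write a real register. -/
def State.setReal (s : State Name) (v : Name) (z : ℝ) : State Name := s.setReg (τ := .real) v z
/-- Write a cell of an integer array. -/
def State.storeInt (s : State Name) (v : Name) (j z : ℤ) : State Name :=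
  s.setArr (τ := .int) v j z
/-- Write a cell of a complex array. -/
def State.storeCpx (s : State Name) (v : Name) (j : ℤ) (z : ℂ) : State Name :=
  s.setArr (τ := .cpx) v j z

variable (s : State Name) (v w : Name)

@[simp] theorem intReg_setInt (z : ℤ) :
    (s.setInt v z).intReg w = if w = v then z else s.intReg w := by
  simp [State.setInt, State.intReg, State.setReg, Function.update_apply]
@[simp] theorem realReg_setInt (z : ℤ) : (s.setInt v z).realReg w = s.realReg w := by
  simp [State.setInt, State.realReg, State.setReg]
@[simp] theorem intArr_setInt (z : ℤ) : (s.setInt v z).intArr w = s.intArr w := rfl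
@[simp] theorem cpxArr_setInt (z : ℤ) : (s.setInt v z).cpxArr w = s.cpxArr w := rfl
@[simp] theorem realReg_setReal (z : ℝ) :
    (s.setReal v z).realReg w = if w = v then z else s.realReg w := by
  simp [State.setReal, State.realReg, State.setReg, Function.update_apply]
@[simp] theorem intReg_setReal (z : ℝ) : (s.setReal v z).intReg w = s.intReg w := by
  simp [State.setReal, State.intReg, State.setReg]
@[simp] theorem intArr_setReal (z : ℝ) : (s.setReal v z).intArr w = s.intArr w := rfl
@[simp] theorem cpxArr_setReal (z : ℝ) : (s.setReal v z).cpxArr w = s.cpxArr w := rfl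
@[simp] theorem intReg_storeInt (j z : ℤ) : (s.storeInt v j z).intReg w = s.intReg w := rfl
@[simp] theorem realReg_storeInt (j z : ℤ) : (s.storeInt v j z).realReg w = s.realReg w := rfl
@[simp] theorem intArr_storeInt (j z : ℤ) : (s.storeInt v j z).intArr w =
    if w = v then Function.update (s.intArr w) j z else s.intArr w := by
  by_cases h : w = v
  · subst h
    funext l
    simp [State.storeInt, State.intArr, State.setArr, Function.update_apply]
  · funext l
    simp [State.storeInt, State.intArr, State.setArr, h]
@[simp] theorem cpxArr_storeInt (j z : ℤ) : (s.storeInt v j z).cpxArr w = s.cpxArr w := by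
  funext l
  simp [State.storeInt, State.cpxArr, State.setArr]
@[simp] theorem intReg_storeCpx (j : ℤ) (z : ℂ) : (s.storeCpx v j z).intReg w = s.intReg w := rfl
@[simp] theorem realReg_storeCpx (j : ℤ) (z : ℂ) :
    (s.storeCpx v j z).realReg w = s.realReg w := rfl
@[simp] theorem cpxArr_storeCpx (j : ℤ) (z : ℂ) : (s.storeCpx v j z).cpxArr w =
    if w = v then Function.update (s.cpxArr w) j z else s.cpxArr w := by
  by_cases h : w = v
  · subst h
    funext l
    simp [State.storeCpx, State.cpxArr, State.setArr, Function.update_apply]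
  · funext l
    simp [State.storeCpx, State.cpxArr, State.setArr, h]
@[simp] theorem intArr_storeCpx (j : ℤ) (z : ℂ) : (s.storeCpx v j z).intArr w = s.intArr w := by
  funext l
  simp [State.storeCpx, State.intArr, State.setArr]

/-- The value of an integer expression. -/
noncomputable def intVal (s : State Name) (e : IExpr) : ℤ := e.eval s
/-- The value of a real expression. -/
noncomputable def realVal (s : State Name) (e : RExpr) : ℝ := e.eval s
/-- The value of a complex expression. -/
noncomputable def cpxVal (s : State Name) (e : CExpr) : ℂ := e.eval s

@[simp] theorem intVal_lit (z : ℤ) : intVal s (.lit z) = z := rfl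
@[simp] theorem intVal_two : intVal s 2 = 2 := rfl
@[simp] theorem intVal_three : intVal s 3 = 3 := rfl
@[simp] theorem intVal_four : intVal s 4 = 4 := rfl
@[simp] theorem intVal_eight : intVal s 8 = 8 := rfl
@[simp] theorem intVal_zero : intVal s 0 = 0 := rfl
@[simp] theorem intVal_one : intVal s 1 = 1 := rfl
@[simp] theorem intVal_reg : intVal s (.reg .int v) = s.intReg v := rfl
@[simp] theorem intVal_arr (i : IExpr) :
    intVal s (.arr .int v i) = s.intArr v (intVal s i) := rfl
@[simp] theorem intVal_abs (e : IExpr) : intVal s (.un .absInt e) = |intVal s e| := rfl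
@[simp] theorem intVal_round (e : RExpr) : intVal s (.un .round e) = round (realVal s e) := rfl
@[simp] theorem intVal_add (e f : IExpr) : intVal s (e + f) = intVal s e + intVal s f := rfl
@[simp] theorem intVal_sub (e f : IExpr) : intVal s (e - f) = intVal s e - intVal s f := rfl
@[simp] theorem intVal_mul (e f : IExpr) : intVal s (e * f) = intVal s e * intVal s f := rfl
@[simp] theorem intVal_div (e f : IExpr) : intVal s (e / f) = intVal s e / intVal s f := rfl
@[simp] theorem intVal_mod (e f : IExpr) : intVal s (e % f) = intVal s e % intVal s f := rfl
@[simp] theorem realVal_pi : realVal s .pi = Real.pi := rfl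
@[simp] theorem realVal_reg : realVal s (.reg .real v) = s.realReg v := rfl
theorem realVal_ofNat (m : ℕ) : realVal s (OfNat.ofNat m) = m := by
  change (((m : ℤ)) : ℝ) = m
  simp
@[simp] theorem realVal_zero : realVal s 0 = 0 := by simpa using realVal_ofNat s 0
@[simp] theorem realVal_one : realVal s 1 = 1 := by simpa using realVal_ofNat s 1
@[simp] theorem realVal_two : realVal s 2 = 2 := by simpa using realVal_ofNat s 2
@[simp] theorem realVal_four : realVal s 4 = 4 := by simpa using realVal_ofNat s 4
@[simp] theorem realVal_eight : realVal s 8 = 8 := by simpa using realVal_ofNat s 8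
@[simp] theorem realVal_sixtyFour : realVal s 64 = 64 := by simpa using realVal_ofNat s 64
@[simp] theorem realVal_toR (e : IExpr) : realVal s (.un .intToReal e) = (intVal s e : ℝ) := rfl
@[simp] theorem realVal_sqrt (e : RExpr) : realVal s (.un .sqrt e) = √(realVal s e) := rfl
@[simp] theorem realVal_exp (e : RExpr) : realVal s (.un .exp e) = Real.exp (realVal s e) := rfl
@[simp] theorem realVal_log (e : RExpr) : realVal s (.un .log e) = Real.log (realVal s e) := rfl
@[simp] theorem realVal_sin (e : RExpr) : realVal s (.un .sin e) = Real.sin (realVal s e) := rfl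
@[simp] theorem realVal_re (e : CExpr) : realVal s (.un .re e) = (cpxVal s e).re := rfl
@[simp] theorem realVal_norm (e : CExpr) : realVal s (.un .absCpx e) = ‖cpxVal s e‖ := rfl
@[simp] theorem realVal_phase (e : CExpr) : realVal s (.un .phase e) = phase (cpxVal s e) := rfl
@[simp] theorem realVal_add (e f : RExpr) : realVal s (e + f) = realVal s e + realVal s f := rfl
@[simp] theorem realVal_sub (e f : RExpr) : realVal s (e - f) = realVal s e - realVal s f := rfl
@[simp] theorem realVal_mul (e f : RExpr) : realVal s (e * f) = realVal s e * realVal s f := rfl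
@[simp] theorem realVal_div (e f : RExpr) : realVal s (e / f) = realVal s e / realVal s f := rfl
@[simp] theorem cpxVal_arr (i : IExpr) :
    cpxVal s (.arr .cpx v i) = s.cpxArr v (intVal s i) := rfl
@[simp] theorem cpxVal_zero : cpxVal s 0 = 0 := by
  change ((((0 : ℕ) : ℤ) : ℝ) : ℂ) = 0
  simp
@[simp] theorem cpxVal_toC (e : RExpr) : cpxVal s (.un .realToCpx e) = (realVal s e : ℂ) := rfl
theorem cpxVal_cis (e : RExpr) :
    cpxVal s (.un .cis e) = Complex.exp ((realVal s e : ℂ) * Complex.I) := rfl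
@[simp] theorem cpxVal_add (e f : CExpr) : cpxVal s (e + f) = cpxVal s e + cpxVal s f := rfl
@[simp] theorem cpxVal_sub (e f : CExpr) : cpxVal s (e - f) = cpxVal s e - cpxVal s f := rfl
@[simp] theorem cpxVal_mul (e f : CExpr) : cpxVal s (e * f) = cpxVal s e * cpxVal s f := rfl
@[simp] theorem cpxVal_div (e f : CExpr) : cpxVal s (e / f) = cpxVal s e / cpxVal s f := rfl

theorem holds_eqInt (e f : IExpr) : (Cond.eqInt e f).holds s ↔ intVal s e = intVal s f := Iff.rfl
theorem holds_ltInt (e f : IExpr) : (Cond.ltInt e f).holds s ↔ intVal s e < intVal s f := Iff.rfl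
theorem holds_leInt (e f : IExpr) : (Cond.leInt e f).holds s ↔ intVal s e ≤ intVal s f := Iff.rfl
theorem holds_ltReal (e f : RExpr) :
    (Cond.ltReal e f).holds s ↔ realVal s e < realVal s f := Iff.rfl
theorem holds_leReal (e f : RExpr) :
    (Cond.leReal e f).holds s ↔ realVal s e ≤ realVal s f := Iff.rfl

attribute [simp] holds_eqInt holds_ltInt holds_leInt holds_ltReal holds_leReal

@[simp] theorem exec_setInt (e : IExpr) :
    (Stmt.set v e).exec s = s.setInt v (intVal s e) := rfl
@[simp] theorem exec_setReal (e : RExpr) :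
    (Stmt.set v e).exec s = s.setReal v (realVal s e) := rfl
@[simp] theorem exec_storeInt (i e : IExpr) :
    (Stmt.store v i e).exec s = s.storeInt v (intVal s i) (intVal s e) := rfl
@[simp] theorem exec_storeCpx (i : IExpr) (e : CExpr) :
    (Stmt.store v i e).exec s = s.storeCpx v (intVal s i) (cpxVal s e) := rfl
@[simp] theorem exec_seq (s₁ s₂ : Stmt Name) :
    (Stmt.seq s₁ s₂).exec s = s₂.exec (s₁.exec s) := rfl
open scoped Classical in
@[simp] theorem exec_ifThen (c : Cond Name) (s₁ : Stmt Name) :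
    (Stmt.ifThen c s₁).exec s = if c.holds s then s₁.exec s else s := rfl
open scoped Classical in
@[simp] theorem exec_ifElse (c : Cond Name) (s₁ s₂ : Stmt Name) :
    (Stmt.ifElse c s₁ s₂).exec s = if c.holds s then s₁.exec s else s₂.exec s := rfl
theorem steps_seq (s₁ s₂ : Stmt Name) :
    (Stmt.seq s₁ s₂).steps s = s₁.steps s + s₂.steps (s₁.exec s) := rfl
theorem steps_loop (e : IExpr) (body : Stmt Name) :
    (Stmt.loop v e body).steps s = e.cost + 1 + ∑ j ∈ Finset.range (intVal s e).toNat,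
      (1 + body.steps ((iter (fun j s' => body.exec (s'.setInt v (j : ℤ))) j s).setInt v j)) := rfl

theorem exec_intReg (st : Stmt Name) (h : st.writesReg .int v = false) :
    (st.exec s).intReg v = s.intReg v := st.exec_reg h s
theorem exec_realReg (st : Stmt Name) (h : st.writesReg .real v = false) :
    (st.exec s).realReg v = s.realReg v := st.exec_reg h s
theorem exec_intArr (st : Stmt Name) (h : st.writesArr .int v = false) :
    (st.exec s).intArr v = s.intArr v := st.exec_arr h s
theorem exec_cpxArr (st : Stmt Name) (h : st.writesArr .cpx v = false) :
    (st.exec s).cpxArr v = s.cpxArr v := st.exec_arr h s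

theorem exec_loop_induct {v : Name} {e : IExpr} {body : Stmt Name} {s : State Name}
    (P : ℕ → State Name → Prop) (h0 : P 0 s)
    (hs : ∀ j : ℕ, (j : ℤ) < intVal s e → ∀ s', P j s' → P (j + 1) (body.exec (s'.setInt v j))) :
    P (intVal s e).toNat ((Stmt.loop v e body).exec s) :=
  iter_induct P h0 fun j hj s' hs' => hs j (by omega) s' hs'

/-- An invariant of a loop yields a bound on its steps that depends on the iteration. -/
theorem steps_loop_le_sum {v : Name} {e : IExpr} {body : Stmt Name} {s : State Name}
    (P : ℕ → State Name → Prop) (h0 : P 0 s)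
    (hs : ∀ j : ℕ, (j : ℤ) < intVal s e → ∀ s', P j s' → P (j + 1) (body.exec (s'.setInt v j)))
    (c : ℕ → ℕ)
    (hc : ∀ j : ℕ, (j : ℤ) < intVal s e → ∀ s', P j s' → body.steps (s'.setInt v j) ≤ c j) :
    (Stmt.loop v e body).steps s
      ≤ e.cost + 1 + ∑ j ∈ Finset.range (intVal s e).toNat, (1 + c j) := by
  rw [steps_loop]
  refine Nat.add_le_add_left (Finset.sum_le_sum fun j hj => Nat.add_le_add_left ?_ _) _
  rw [Finset.mem_range] at hj
  exact hc j (by omega) _ (iter_induct P h0 fun i hi s' hs' => hs i (by omega) s' hs')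

end Access


/-! ### The periodized Gaussian -/

section Window

open MeasureTheory ProbabilityTheory
open scoped NNReal

theorem summable_cexp_quadratic {v : ℝ} (hv : 0 < v) (ψ : ℝ) :
    Summable fun i : ℤ =>
      Complex.exp (-2 * Real.pi ^ 2 * v * i ^ 2 + 2 * Real.pi * Complex.I * i * ψ) := by
  have h := (hasSum_jacobiTheta₂_term (ψ : ℂ) (τ := 2 * Real.pi * v * Complex.I)
    (by have := Real.pi_pos; simp; positivity)).summable
  refine h.congr fun i => ?_
  unfold jacobiTheta₂_term
  congr 1
  linear_combination (2 * Real.pi ^ 2 * v * i ^ 2 : ℂ) * Complex.I_sq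

theorem summable_gaussianPDFReal {v : ℝ≥0} (hv : v ≠ 0) (ψ : ℝ) :
    Summable fun n : ℤ => gaussianPDFReal 0 v (ψ - n) := by
  have hv' : (0 : ℝ) < v := by positivity
  have hπ := Real.pi_pos
  have h := (hasSum_jacobiTheta₂_term (-Complex.I * ψ / (2 * Real.pi * v))
    (τ := Complex.I / (2 * Real.pi * v))
    (by
      have : Complex.I / (2 * Real.pi * v) = ((1 / (2 * Real.pi * v) : ℝ) : ℂ) * Complex.I := by
        push_cast; ring
      rw [this]; simp; positivity)).summable
  have h2 := (h.mul_left (((√(2 * Real.pi * v))⁻¹ * Real.exp (-ψ ^ 2 / (2 * v)) : ℝ) : ℂ))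
  rw [← Complex.summable_ofReal]
  refine h2.congr fun n => ?_
  unfold jacobiTheta₂_term
  rw [gaussianPDFReal]
  push_cast
  rw [mul_assoc, ← Complex.exp_add]
  congr 2
  have h3 : (v : ℂ) ≠ 0 := by exact_mod_cast hv'.ne'
  have h4 : (Real.pi : ℂ) ≠ 0 := by exact_mod_cast hπ.ne'
  field_simp
  ring_nf
  simp only [Complex.I_sq]
  ring

/-- Poisson summation for the Gaussian. -/
theorem tsum_cexp_quadratic {v : ℝ≥0} (hv : v ≠ 0) (ψ : ℝ) :
    ∑' i : ℤ, Complex.exp (-2 * Real.pi ^ 2 * v * i ^ 2 + 2 * Real.pi * Complex.I * i * ψ)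
      = ((∑' n : ℤ, gaussianPDFReal 0 v (ψ - n) : ℝ) : ℂ) := by
  have hv' : (0 : ℝ) < v := by positivity
  have hπ := Real.pi_pos
  have h3 : (v : ℂ) ≠ 0 := by exact_mod_cast hv'.ne'
  have h4 : (Real.pi : ℂ) ≠ 0 := by exact_mod_cast hπ.ne'
  have h := Complex.tsum_exp_neg_quadratic (a := ((2 * Real.pi * v : ℝ) : ℂ))
    (by rw [Complex.ofReal_re]; positivity) (Complex.I * ψ)
  have h1 : ∀ i : ℤ, -2 * (Real.pi : ℂ) ^ 2 * v * i ^ 2 + 2 * Real.pi * Complex.I * i * ψ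
      = -Real.pi * ((2 * Real.pi * v : ℝ) : ℂ) * i ^ 2 + 2 * Real.pi * (Complex.I * ψ) * i := by
    intro i; push_cast; ring
  simp_rw [h1]
  rw [h, Complex.ofReal_tsum, ← tsum_mul_left]
  congr 1
  ext n
  rw [gaussianPDFReal]
  push_cast
  congr 1
  · rw [one_div, Real.sqrt_eq_rpow, Complex.ofReal_cpow (by positivity)]
    push_cast
    rfl
  · congr 1
    field_simp
    ring_nf
    simp only [Complex.I_sq, Complex.I_pow_four]
    ring

/-- The inverse Fourier transform of the indicator function of `[-C, C]`, convolved with a centred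
Gaussian of variance `v`, at an integer point. -/
noncomputable def smoothedBox (v C : ℝ) (i : ℤ) : ℝ :=
  if i = 0 then 2 * C
  else Real.exp (-2 * Real.pi ^ 2 * v * i ^ 2) * Real.sin (2 * Real.pi * C * i) / (Real.pi * i)

/-- Averaging the Fourier series of the periodized Gaussian over `[-C, C]` multiplies its `i`-th
coefficient by `sin (2πCi) / (πi)`. -/
theorem integral_cexp_box (v C φ : ℝ) (i : ℤ) :
    ∫ s in (-C)..C, Complex.exp (-2 * Real.pi ^ 2 * v * i ^ 2
        + 2 * Real.pi * Complex.I * i * (s + φ : ℝ))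
      = smoothedBox v C i * Complex.exp (2 * Real.pi * Complex.I * i * φ) := by
  unfold smoothedBox
  split_ifs with hi
  · subst hi
    simp
    ring
  have hπ : (Real.pi : ℂ) ≠ 0 := by exact_mod_cast Real.pi_ne_zero
  have hi' : (i : ℂ) ≠ 0 := by exact_mod_cast hi
  have hc : 2 * Real.pi * Complex.I * i ≠ 0 := by simp [hi, Real.pi_ne_zero]
  have h1 : ∀ s : ℝ, Complex.exp (-2 * Real.pi ^ 2 * v * i ^ 2
        + 2 * Real.pi * Complex.I * i * (s + φ : ℝ))
      = Complex.exp (-2 * Real.pi ^ 2 * v * i ^ 2) * Complex.exp (2 * Real.pi * Complex.I * i * φ)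
        * Complex.exp (2 * Real.pi * Complex.I * i * s) := by
    intro s
    rw [← Complex.exp_add, ← Complex.exp_add]
    push_cast
    ring_nf
  simp_rw [h1]
  rw [intervalIntegral.integral_const_mul, integral_exp_mul_complex hc]
  push_cast
  rw [Complex.sin]
  have h2 : (2 * Real.pi * C * i : ℂ) * Complex.I = 2 * Real.pi * Complex.I * i * C := by ring
  have h3 : -(2 * Real.pi * C * i : ℂ) * Complex.I = 2 * Real.pi * Complex.I * i * -C := by ring
  rw [h2, h3]
  generalize Complex.exp (2 * Real.pi * Complex.I * i * C) = E₁
  generalize Complex.exp (2 * Real.pi * Complex.I * i * -C) = E₂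
  field_simp
  linear_combination (E₁ - E₂) * Complex.I_sq

/-- The points within distance `C` of `φ + ℤ`. -/
def periodicBox (C φ : ℝ) : Set ℝ := ⋃ n : ℤ, Set.Ioc (φ - n - C) (φ - n + C)

/-- The intervals that make up the periodic box are disjoint since `2 C ≤ 1 / 2`, so its measure is
a sum over `ℤ`, which can be moved inside the integral. -/
theorem gaussianReal_periodicBox {v : ℝ≥0} (hv : v ≠ 0) {C : ℝ} (hC0 : 0 ≤ C) (hC : C ≤ 1 / 4)
    (φ : ℝ) : (gaussianReal 0 v).real (periodicBox C φ)
      = ∫ s in (-C)..C, ∑' n : ℤ, gaussianPDFReal 0 v (s + φ - n) := by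
  have hm : ∀ n : ℤ, Measurable fun s : ℝ => gaussianPDFReal 0 v (s + φ - n) := fun n =>
    (measurable_gaussianPDFReal 0 v).comp (by fun_prop)
  rw [intervalIntegral.integral_of_le (by linarith), integral_eq_lintegral_of_nonneg_ae
    (Filter.Eventually.of_forall fun s => tsum_nonneg fun n => gaussianPDFReal_nonneg _ _ _)
    (by
      refine Measurable.aestronglyMeasurable ?_
      refine Measurable.tsum hm), measureReal_def]
  congr 1
  have h1 : ∀ s : ℝ, ENNReal.ofReal (∑' n : ℤ, gaussianPDFReal 0 v (s + φ - n))
      = ∑' n : ℤ, gaussianPDF 0 v (s + φ - n) := fun s =>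
    ENNReal.ofReal_tsum_of_nonneg (fun n => gaussianPDFReal_nonneg _ _ _)
      (summable_gaussianPDFReal hv _)
  simp_rw [h1]
  have h0 : ∀ n : ℤ, Measurable fun s : ℝ => gaussianPDF 0 v (s + φ - n) := fun n =>
    (measurable_gaussianPDF 0 v).comp (by fun_prop)
  rw [lintegral_tsum fun n => (h0 n).aemeasurable, periodicBox, measure_iUnion _ fun n => measurableSet_Ioc]
  · congr 1
    ext n
    rw [gaussianReal_apply 0 hv]
    have h2 := (measurePreserving_add_right volume (φ - n)).setLIntegral_comp_preimage
      (s := Set.Ioc (φ - n - C) (φ - n + C)) measurableSet_Ioc (measurable_gaussianPDF 0 v)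
    rw [← h2]
    have h3 : (fun x => x + (φ - n)) ⁻¹' Set.Ioc (φ - n - C) (φ - n + C) = Set.Ioc (-C) C := by
      ext x
      simp only [Set.mem_preimage, Set.mem_Ioc]
      constructor <;> rintro ⟨h, h'⟩ <;> constructor <;> linarith
    rw [h3]
    simp_rw [add_sub_assoc]
  · intro a b hab
    refine Set.disjoint_left.2 fun x hx hx' => hab ?_
    simp only [Set.mem_Ioc] at hx hx'
    have h4 : (a : ℝ) < b + 1 := by linarith
    have h5 : (b : ℝ) < a + 1 := by linarith
    have h6 : a < b + 1 := by exact_mod_cast h4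
    have h7 : b < a + 1 := by exact_mod_cast h5
    omega

/-- The Fourier series with the coefficients `smoothedBox` is the probability that a Gaussian
variable lies within distance `C` of `φ + ℤ`. -/
theorem hasSum_smoothedBox {v : ℝ≥0} (hv : v ≠ 0) {C : ℝ} (hC0 : 0 ≤ C) (hC : C ≤ 1 / 4) (φ : ℝ) :
    HasSum (fun i : ℤ => smoothedBox v C i * Complex.exp (2 * Real.pi * Complex.I * i * φ))
      ((gaussianReal 0 v).real (periodicBox C φ) : ℂ) := by
  have hv' : (0 : ℝ) < v := by positivity
  rw [gaussianReal_periodicBox hv hC0 hC, ← intervalIntegral.integral_ofReal]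
  simp_rw [← tsum_cexp_quadratic hv, ← integral_cexp_box]
  have hn : ∀ (i : ℤ) (s : ℝ), ‖Complex.exp (-2 * Real.pi ^ 2 * v * i ^ 2
      + 2 * Real.pi * Complex.I * i * (s : ℝ))‖ = ‖Complex.exp (-2 * Real.pi ^ 2 * v * i ^ 2
      + 2 * Real.pi * Complex.I * i * (0 : ℝ))‖ := by
    intro i s
    rw [Complex.norm_exp, Complex.norm_exp]
    congr 1
    simp
  refine intervalIntegral.hasSum_integral_of_dominated_convergence
    (fun i _ => ‖Complex.exp (-2 * Real.pi ^ 2 * v * i ^ 2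
      + 2 * Real.pi * Complex.I * i * (0 : ℝ))‖) ?_ ?_ ?_ ?_ ?_
  · intro i
    exact Continuous.aestronglyMeasurable (by fun_prop)
  · intro i
    exact Filter.Eventually.of_forall fun s _ => (hn i _).le
  · exact Filter.Eventually.of_forall fun s _ => (summable_cexp_quadratic hv' 0).norm
  · exact intervalIntegrable_const
  · exact Filter.Eventually.of_forall fun s _ => (summable_cexp_quadratic hv' _).hasSum

end Window

/-! ### Gaussian tails and the Gaussian distribution function -/

section Window

open MeasureTheory ProbabilityTheory
open scoped NNReal Nat

/-- Chernoff's bound, applied to both tails. -/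
theorem gaussianReal_tail {v : ℝ≥0} (hv : v ≠ 0) {g T : ℝ} (hg : 0 ≤ g) (hT : 2 * v * T ≤ g ^ 2) :
    (gaussianReal 0 v).real {z | g ≤ |z|} ≤ 2 * Real.exp (-T) := by
  have hv' : (0 : ℝ) < v := by positivity
  have h1 := measure_ge_le_exp_mul_mgf (μ := gaussianReal 0 v) (X := id) g
    (t := g / v) (by positivity) (by simpa using integrable_exp_mul_gaussianReal (g / v))
  have h2 := measure_le_le_exp_mul_mgf (μ := gaussianReal 0 v) (X := id) (-g)
    (t := -(g / v)) (by simp; positivity) (by simpa using integrable_exp_mul_gaussianReal (-(g / v)))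
  rw [mgf_id_gaussianReal, ← Real.exp_add] at h1 h2
  have h3 : g ^ 2 / (2 * v) ≥ T := by
    rw [ge_iff_le, le_div_iff₀ (by positivity)]; linarith
  have h4 : -(g / v) * g + (0 * (g / v) + v * (g / v) ^ 2 / 2) = -(g ^ 2 / (2 * v)) := by
    field_simp; ring
  have h5 : -(-(g / v)) * -g + (0 * (-(g / v)) + v * (-(g / v)) ^ 2 / 2)
      = -(g ^ 2 / (2 * v)) := by
    field_simp; ring
  rw [h4] at h1
  rw [h5] at h2
  have h6 : Real.exp (-(g ^ 2 / (2 * v))) ≤ Real.exp (-T) := Real.exp_le_exp.2 (by linarith)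
  have h7 : {z : ℝ | g ≤ |z|} ⊆ {z | g ≤ id z} ∪ {z | id z ≤ -g} := by
    intro z hz
    rcases le_abs'.1 (show g ≤ |z| from hz) with h | h
    · exact Or.inr h
    · exact Or.inl h
  calc (gaussianReal 0 v).real {z | g ≤ |z|} ≤ _ := measureReal_mono h7
    _ ≤ _ := measureReal_union_le _ _
    _ ≤ 2 * Real.exp (-T) := by linarith

theorem measurableSet_periodicBox (C q : ℝ) : MeasurableSet (periodicBox C q) :=
  MeasurableSet.iUnion fun _ => measurableSet_Ioc

/-- Deep inside the box, the box contains everything but a Gaussian tail. -/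
theorem periodicBox_inner (μ : Measure ℝ) [IsProbabilityMeasure μ] {C q g : ℝ}
    (h : |q| ≤ C - g) : |μ.real (periodicBox C q) - 1| ≤ μ.real {z | g ≤ |z|} := by
  have h1 : (periodicBox C q)ᶜ ⊆ {z | g ≤ |z|} := by
    intro z hz
    by_contra hz'
    refine hz (Set.mem_iUnion.2 ⟨0, ?_⟩)
    simp only [Set.mem_ofPred_eq, not_le] at hz'
    have := abs_lt.1 hz'
    have := abs_le.1 h
    simp only [Int.cast_zero, Set.mem_Ioc]
    constructor <;> linarith
  have h2 := measureReal_mono (μ := μ) h1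
  rw [probReal_compl_eq_one_sub (measurableSet_periodicBox C q)] at h2
  have h3 : μ.real (periodicBox C q) ≤ 1 := measureReal_le_one
  rw [abs_sub_comm, abs_of_nonneg (by linarith)]
  exact h2

/-- Far from the box, the box is contained in a Gaussian tail. -/
theorem periodicBox_outer (μ : Measure ℝ) [IsProbabilityMeasure μ] {C q g : ℝ}
    (h : ∀ n : ℤ, C + g ≤ |q - n|) : μ.real (periodicBox C q) ≤ μ.real {z | g ≤ |z|} := by
  refine measureReal_mono fun z hz => ?_
  obtain ⟨n, hn⟩ := Set.mem_iUnion.1 hz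
  have h1 := h n
  simp only [Set.mem_Ioc] at hn
  simp only [Set.mem_ofPred_eq]
  rcases le_abs'.1 h1 with h2 | h2
  · exact le_abs.2 (Or.inr (by linarith))
  · exact le_abs.2 (Or.inl (by linarith))

/-- Near the right end of the box, the left end and all translates matter only through a Gaussian
tail, so that the box may be replaced by a half-line. -/
theorem periodicBox_transition (μ : Measure ℝ) [IsProbabilityMeasure μ] {C q g : ℝ}
    (hgC : g ≤ C) (hCg : C + g ≤ 1 / 4) (h0 : 0 ≤ q) (h : q ≤ C + g) :
    |μ.real (periodicBox C q) - μ.real (Set.Ioi (q - C))| ≤ μ.real {z | g ≤ |z|} := by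
  have h1 : periodicBox C q ⊆ Set.Ioi (q - C) ∪ {z | g ≤ |z|} := by
    intro z hz
    obtain ⟨n, hn⟩ := Set.mem_iUnion.1 hz
    simp only [Set.mem_Ioc] at hn
    by_contra hz'
    simp only [Set.mem_union, Set.mem_Ioi, Set.mem_ofPred_eq, not_or, not_le, not_lt] at hz'
    have h2 := abs_lt.1 hz'.2
    have h3 : (0 : ℝ) < n := by linarith
    have h4 : (1 : ℝ) ≤ n := by exact_mod_cast (by exact_mod_cast h3 : (0 : ℤ) < n)
    linarith
  have h2 : Set.Ioi (q - C) ⊆ periodicBox C q ∪ {z | g ≤ |z|} := by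
    intro z hz
    by_cases hz' : g ≤ |z|
    · exact Or.inr hz'
    · refine Or.inl (Set.mem_iUnion.2 ⟨0, ?_⟩)
      have h2 := abs_lt.1 (not_le.1 hz')
      simp only [Set.mem_Ioi] at hz
      simp only [Int.cast_zero, Set.mem_Ioc]
      constructor <;> linarith
  have h3 := (measureReal_mono (μ := μ) h1).trans (measureReal_union_le _ _)
  have h4 := (measureReal_mono (μ := μ) h2).trans (measureReal_union_le _ _)
  rw [abs_le]
  constructor <;> linarith

/-- The Gaussian distribution function, scaled to a standard Gaussian variable. -/
theorem gaussianReal_Ioi {v : ℝ≥0} {τ : ℝ} (hτ : 0 < τ) (hv : (v : ℝ) = 1 / τ ^ 2) (a : ℝ) :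
    (gaussianReal 0 v).real (Set.Ioi (-a))
      = 1 / 2 + 1 / √(2 * Real.pi) * ∫ s in (0 : ℝ)..(τ * a), Real.exp (-s ^ 2 / 2) := by
  have h1 := gaussianReal_map_div_const (μ := 0) (v := 1) τ
  have h2 : (1 : ℝ≥0) / NNReal.mk (τ ^ 2) (sq_nonneg τ) = v := by
    apply NNReal.coe_injective
    rw [hv, NNReal.coe_div]
    rfl
  have h2' : (gaussianReal 0 1).map (· / τ) = gaussianReal 0 v := by
    rw [h1, zero_div]
    congr 1
  rw [← h2', map_measureReal_apply (by fun_prop) measurableSet_Ioi]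
  have h3 : (fun x => x / τ) ⁻¹' Set.Ioi (-a) = Set.Ioi (-(τ * a)) := by
    ext x
    simp only [Set.mem_preimage, Set.mem_Ioi]
    rw [lt_div_iff₀ hτ]
    constructor <;> intro h <;> linarith
  rw [h3, measureReal_def, gaussianReal_apply_eq_integral 0 one_ne_zero,
    ENNReal.toReal_ofReal (setIntegral_nonneg measurableSet_Ioi fun _ _ =>
      gaussianPDFReal_nonneg _ _ _)]
  generalize τ * a = y
  have h4 : ∀ x : ℝ, gaussianPDFReal 0 1 x = 1 / √(2 * Real.pi) * Real.exp (-x ^ 2 / 2) := by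
    intro x; simp [gaussianPDFReal]
  simp_rw [h4]
  rw [integral_const_mul]
  have hint : Integrable (fun x : ℝ => Real.exp (-x ^ 2 / 2)) := by
    have := integrable_exp_neg_mul_sq (b := 1 / 2) (by norm_num)
    refine this.congr (Filter.Eventually.of_forall fun x => ?_)
    simp only
    congr 1; ring
  have h5 : ∫ x in Set.Ioi (-y), Real.exp (-x ^ 2 / 2)
      = ∫ x in Set.Iic y, Real.exp (-x ^ 2 / 2) := by
    have := integral_comp_neg_Iic y fun x => Real.exp (-x ^ 2 / 2)
    simpa using this.symm
  have h6 := intervalIntegral.integral_Iic_sub_Iic (a := 0) (b := y) (μ := volume)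
    (f := fun x : ℝ => Real.exp (-x ^ 2 / 2)) hint.integrableOn hint.integrableOn
  have h7 : ∫ x in Set.Iic (0 : ℝ), Real.exp (-x ^ 2 / 2) = √(2 * Real.pi) / 2 := by
    have := integral_comp_neg_Iic (0 : ℝ) fun x => Real.exp (-x ^ 2 / 2)
    simp only [neg_sq, neg_zero] at this
    rw [this]
    have h8 := integral_gaussian_Ioi (1 / 2)
    rw [show Real.pi / (1 / 2) = 2 * Real.pi by ring] at h8
    rw [← h8]
    congr 1
    ext x
    congr 1; ring
  have h9 : √(2 * Real.pi) ≠ 0 := by have := Real.pi_pos; positivity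
  rw [h5, ← sub_add_cancel (∫ x in Set.Iic y, Real.exp (-x ^ 2 / 2))
    (∫ x in Set.Iic (0 : ℝ), Real.exp (-x ^ 2 / 2)), h6, h7]
  field_simp
  ring

/-- The partial sums of the series `y + y³/3 + y⁵/(3·5) + ⋯`. -/
noncomputable def oddSeries (N : ℕ) (y : ℝ) : ℝ :=
  ∑ r ∈ Finset.range (N + 1), y ^ (2 * r + 1) / ((2 * r + 1)‼ : ℝ)

/-- The derivative telescopes: the summand with index `r` contributes
`y ^ (2r) / (2r - 1)‼ - y ^ (2r + 2) / (2r + 1)‼`, so only the first and the last term remain. -/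
theorem hasDerivAt_oddSeries (N : ℕ) (y : ℝ) :
    HasDerivAt (fun y => Real.exp (-y ^ 2 / 2) * oddSeries N y)
      (Real.exp (-y ^ 2 / 2) * (1 - y ^ (2 * N + 2) / ((2 * N + 1)‼ : ℝ))) y := by
  have he : HasDerivAt (fun y : ℝ => Real.exp (-y ^ 2 / 2)) (Real.exp (-y ^ 2 / 2) * (-y)) y := by
    have h := ((hasDerivAt_pow 2 y).neg.div_const 2).exp
    refine h.congr_deriv ?_
    simp only [Pi.neg_apply]
    push_cast
    ring
  induction N with
  | zero =>
    have h := he.mul (hasDerivAt_id y)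
    have h' : (fun y => Real.exp (-y ^ 2 / 2) * oddSeries 0 y)
        = (fun y : ℝ => Real.exp (-y ^ 2 / 2)) * id := by
      ext z; simp [oddSeries]
    rw [h']
    refine h.congr_deriv ?_
    simp
    ring
  | succ N ih =>
    have h' : (fun y => Real.exp (-y ^ 2 / 2) * oddSeries (N + 1) y)
        = (fun y => Real.exp (-y ^ 2 / 2) * oddSeries N y) + (fun y => Real.exp (-y ^ 2 / 2)
          * (y ^ (2 * (N + 1) + 1) / ((2 * (N + 1) + 1)‼ : ℝ))) := by
      ext z
      simp only [oddSeries, Pi.add_apply]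
      rw [Finset.sum_range_succ _ (N + 1)]
      ring
    rw [h']
    have h := ih.add (he.mul ((hasDerivAt_pow (2 * (N + 1) + 1) y).div_const
      ((2 * (N + 1) + 1)‼ : ℝ)))
    refine h.congr_deriv ?_
    have h2 : ((2 * (N + 1) + 1)‼ : ℝ) = (2 * N + 3) * ((2 * N + 1)‼ : ℝ) := by
      rw [show 2 * (N + 1) + 1 = 2 * N + 1 + 2 by ring, Nat.doubleFactorial_add_two]
      push_cast; ring
    have h3 : ((2 * N + 1)‼ : ℝ) ≠ 0 := by exact_mod_cast (Nat.doubleFactorial_pos _).ne'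
    have h4 : (2 * N + 3 : ℝ) ≠ 0 := by positivity
    rw [h2]
    push_cast
    field_simp
    ring

/-- The error of the truncated series, from the derivative of the partial sum. -/
theorem abs_integral_sub_oddSeries (N : ℕ) (y : ℝ) :
    |(∫ s in (0 : ℝ)..y, Real.exp (-s ^ 2 / 2)) - Real.exp (-y ^ 2 / 2) * oddSeries N y|
      ≤ |y| ^ (2 * N + 3) / ((2 * N + 1)‼ : ℝ) := by
  have hpos : (0 : ℝ) < ((2 * N + 1)‼ : ℝ) := by exact_mod_cast Nat.doubleFactorial_pos _
  have h1 := intervalIntegral.integral_eq_sub_of_hasDerivAt (a := 0) (b := y)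
    (fun x _ => hasDerivAt_oddSeries N x) (by apply Continuous.intervalIntegrable; fun_prop)
  have h0 : oddSeries N 0 = 0 := by simp [oddSeries]
  rw [h0, mul_zero, sub_zero] at h1
  rw [← h1, ← intervalIntegral.integral_sub (by apply Continuous.intervalIntegrable; fun_prop)
    (by apply Continuous.intervalIntegrable; fun_prop)]
  have h2 := intervalIntegral.norm_integral_le_of_norm_le_const (a := 0) (b := y)
    (f := fun s => Real.exp (-s ^ 2 / 2) - Real.exp (-s ^ 2 / 2)
      * (1 - s ^ (2 * N + 2) / ((2 * N + 1)‼ : ℝ)))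
    (C := |y| ^ (2 * N + 2) / ((2 * N + 1)‼ : ℝ)) (by
      intro s hs
      have hs' : |s| ≤ |y| := by
        rcases Set.mem_uIoc.1 hs with h | h
        · rw [abs_of_pos h.1, abs_of_pos (h.1.trans_le h.2)]; exact h.2
        · rw [abs_of_nonpos h.2, abs_of_nonpos (h.1.le.trans h.2)]; linarith
      have h3 : Real.exp (-s ^ 2 / 2) - Real.exp (-s ^ 2 / 2)
          * (1 - s ^ (2 * N + 2) / ((2 * N + 1)‼ : ℝ))
          = Real.exp (-s ^ 2 / 2) * (s ^ (2 * N + 2) / ((2 * N + 1)‼ : ℝ)) := by ring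
      have h4 : Real.exp (-s ^ 2 / 2) ≤ 1 := Real.exp_le_one_iff.2 (by nlinarith [sq_nonneg s])
      rw [h3, Real.norm_eq_abs, abs_mul, abs_div, abs_pow, abs_of_pos (Real.exp_pos _),
        abs_of_pos hpos]
      calc _ ≤ 1 * (|s| ^ (2 * N + 2) / ((2 * N + 1)‼ : ℝ)) := by gcongr
        _ ≤ _ := by rw [one_mul]; gcongr)
  refine h2.trans (le_of_eq ?_)
  rw [sub_zero]
  ring

/-- In the transition region `y² ≤ 2 T`, so `8 T` terms of the series give the accuracy `exp (-T)`,
by `(2N+1)‼ ≥ 2 ^ N N!`. -/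
theorem oddSeries_error {N : ℕ} {T y : ℝ} (hT : 1 ≤ T) (hN : 8 * T ≤ N) (hy : y ^ 2 ≤ 2 * T) :
    |y| ^ (2 * N + 3) / ((2 * N + 1)‼ : ℝ) ≤ Real.exp (-T) := by
  have h1 : (2 ^ N * N ! : ℝ) ≤ ((2 * N + 1)‼ : ℝ) := by
    have : 2 ^ N * N ! ≤ (2 * N + 1)‼ := by
      rw [← Nat.doubleFactorial_two_mul]
      induction N with
      | zero => simp
      | succ N ih =>
        clear ih hN
        induction N + 1 with
        | zero => simp
        | succ M ih =>
          rw [show 2 * (M + 1) = 2 * M + 2 by ring, show 2 * M + 2 + 1 = 2 * M + 1 + 2 by ring,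
            Nat.doubleFactorial_add_two, Nat.doubleFactorial_add_two]
          exact Nat.mul_le_mul (by omega) ih
    exact_mod_cast this
  have h2 : |y| ^ (2 * N + 3) ≤ (2 * T) ^ (N + 2) := by
    have h3 : (|y| ^ (2 * N + 3)) ^ 2 ≤ ((2 * T) ^ (N + 2)) ^ 2 := by
      calc (|y| ^ (2 * N + 3)) ^ 2 = (y ^ 2) ^ (2 * N + 3) := by
            rw [← sq_abs y, ← pow_mul, ← pow_mul, mul_comm]
        _ ≤ (2 * T) ^ (2 * N + 3) := by gcongr
        _ ≤ (2 * T) ^ ((N + 2) * 2) := pow_le_pow_right₀ (by linarith) (by omega)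
        _ = _ := by rw [pow_mul]
    exact le_of_sq_le_sq h3 (by positivity)
  have hN0 : (0 : ℝ) < N := by linarith
  have h4 : (N : ℝ) ^ N / N ! ≤ Real.exp N := Real.pow_div_factorial_le_exp N hN0.le N
  have h5 : T ^ N / N ! ≤ Real.exp (-N) := by
    have h6 : T / N ≤ 1 / 8 := by
      rw [div_le_div_iff₀ hN0 (by norm_num)]; linarith
    have h7 : (1 / 8 : ℝ) ≤ Real.exp (-2) := by
      have : Real.exp 2 ≤ 8 := by
        have := Real.exp_one_lt_d9
        have h : Real.exp 2 = Real.exp 1 * Real.exp 1 := by rw [← Real.exp_add]; norm_num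
        rw [h]
        have := Real.exp_pos 1
        nlinarith
      rw [Real.exp_neg, one_div]
      exact inv_anti₀ (Real.exp_pos _) this
    calc T ^ N / N ! = (T / N) ^ N * ((N : ℝ) ^ N / N !) := by
          rw [div_pow]; field_simp
      _ ≤ (Real.exp (-2)) ^ N * Real.exp N := by
          gcongr
          exact h6.trans h7
      _ = Real.exp (-N) := by
          rw [← Real.exp_nat_mul, ← Real.exp_add]; congr 1; ring
  have h8 : T ≤ Real.exp T := by linarith [Real.add_one_le_exp T]
  have h9 : (2 : ℝ) ≤ Real.exp T := by linarith [Real.add_one_le_exp T]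
  calc |y| ^ (2 * N + 3) / ((2 * N + 1)‼ : ℝ) ≤ (2 * T) ^ (N + 2) / (2 ^ N * N !) := by gcongr
    _ = (2 * T) ^ 2 * (T ^ N / N !) := by rw [mul_pow 2 T (N + 2)]; field_simp; ring
    _ ≤ (Real.exp T * Real.exp T) ^ 2 * Real.exp (-(8 * T)) := by
        gcongr
        exact h5.trans (Real.exp_le_exp.2 (by linarith))
    _ = Real.exp (-(4 * T)) := by
        rw [← Real.exp_add, ← Real.exp_nat_mul, ← Real.exp_add]; congr 1; push_cast; ring
    _ ≤ Real.exp (-T) := Real.exp_le_exp.2 (by linarith)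

end Window

/-! ### The flat window -/

section Window

open MeasureTheory ProbabilityTheory
open scoped NNReal Nat

theorem hasSum_pow_natAbs {r : ℝ} (h0 : 0 ≤ r) (h1 : r < 1) :
    HasSum (fun i : ℤ => r ^ i.natAbs) ((1 - r)⁻¹ + (1 - r)⁻¹ * r) := by
  have h := hasSum_geometric_of_lt_one h0 h1
  refine HasSum.of_nat_of_neg_add_one (by simpa using h) ?_
  refine (h.mul_right r).congr_fun fun n => ?_
  rw [← pow_succ]
  congr 1

/-- The error of truncating a series over `ℤ` whose terms decay geometrically. -/
theorem norm_sum_Icc_sub_le {f : ℤ → ℂ} {S : ℂ} (hf : HasSum f S) {K r : ℝ} {R : ℤ} (hK : 0 ≤ K)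
    (h0 : 0 ≤ r) (h1 : r < 1) (hb : ∀ i : ℤ, R < |i| → ‖f i‖ ≤ K * r ^ i.natAbs) :
    ‖(∑ i ∈ Finset.Icc (-R) R, f i) - S‖ ≤ 2 * K / (1 - r) := by
  set g : ℤ → ℂ := fun i => f i - if i ∈ Finset.Icc (-R) R then f i else 0 with hg
  have h2 : HasSum (fun i => if i ∈ Finset.Icc (-R) R then f i else 0)
      (∑ i ∈ Finset.Icc (-R) R, f i) := by
    have := hasSum_sum_of_ne_finset_zero (f := fun i => if i ∈ Finset.Icc (-R) R then f i else 0)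
      (s := Finset.Icc (-R) R) (L := .unconditional ℤ) (fun i hi => if_neg hi)
    rwa [Finset.sum_congr rfl fun i hi => if_pos hi] at this
  have h3 : HasSum g (S - ∑ i ∈ Finset.Icc (-R) R, f i) := hf.sub h2
  have h4 := (hasSum_pow_natAbs h0 h1).mul_left K
  have h5 : ‖∑' i, g i‖ ≤ K * ((1 - r)⁻¹ + (1 - r)⁻¹ * r) := by
    refine tsum_of_norm_bounded h4 fun i => ?_
    simp only [hg]
    split_ifs with hi
    · simp; positivity
    · rw [sub_zero]
      refine hb i ?_
      rw [Finset.mem_Icc] at hi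
      by_contra h
      exact hi (abs_le.1 (not_lt.1 h))
  rw [h3.tsum_eq] at h5
  rw [norm_sub_rev]
  refine h5.trans ?_
  have h6 : 0 < 1 - r := by linarith
  rw [div_eq_mul_inv]
  have h7 : 0 ≤ K * (1 - r)⁻¹ := by positivity
  nlinarith

/-- The parameters of the flat window for `B` bins with transition width `α` and accuracy
`exp (-T)`. -/
structure WindowParams (B : ℕ) (α T τ C : ℝ) (R : ℤ) (N : ℕ) : Prop where
  two_le : 2 ≤ B
  α_pos : 0 < α
  α_lt : α < 1
  one_le_T : 1 ≤ T
  τ_eq : τ = 4 * B / α * √(2 * T)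
  C_eq : C = (1 - α / 2) / (2 * B)
  le_R : 8 * B * T / α ≤ R
  le_N : 8 * T ≤ N

/-- The truncated Fourier series of the window, at the frequency `q`. -/
noncomputable def windowSum (τ C : ℝ) (R : ℤ) (q : ℝ) : ℂ :=
  ∑ i ∈ Finset.Icc (-R) R, smoothedBox (1 / τ ^ 2) C i * Complex.exp (2 * Real.pi * Complex.I * i * q)

/-- The window in the frequency domain as the algorithm computes it, at the frequency `q`. -/
noncomputable def windowFreq (B : ℕ) (α τ C : ℝ) (N : ℕ) (q : ℝ) : ℝ :=
  if 2 * B * |q| ≤ 1 - α then 1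
  else if 1 ≤ 2 * B * |q| then 0
  else 1 / 2 + Real.exp (-(τ * (C - |q|)) ^ 2 / 2) / √(2 * Real.pi)
    * oddSeries N (τ * (C - |q|))

theorem smoothedBox_neg (v C : ℝ) (i : ℤ) : smoothedBox v C (-i) = smoothedBox v C i := by
  unfold smoothedBox
  simp only [neg_eq_zero]
  split_ifs
  · rfl
  · push_cast
    rw [mul_neg, Real.sin_neg, mul_neg, mul_neg, neg_div_neg_eq, neg_sq]

theorem windowSum_neg (τ C : ℝ) (R : ℤ) (q : ℝ) : windowSum τ C R (-q) = windowSum τ C R q := by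
  unfold windowSum
  refine Finset.sum_equiv (Equiv.neg ℤ) (fun i => ?_) fun i _ => ?_
  · simp only [Finset.mem_Icc, Equiv.neg_apply]; omega
  · rw [Equiv.neg_apply, smoothedBox_neg]
    push_cast
    congr 2
    ring

variable {B : ℕ} {α T τ C : ℝ} {R : ℤ} {N : ℕ}

theorem WindowParams.τ_pos (h : WindowParams B α T τ C R N) : 0 < τ := by
  have h1 := h.α_pos
  have h2 := h.one_le_T
  have h3 : (0 : ℝ) < B := by exact_mod_cast (by have := h.two_le; omega : 0 < B)
  rw [h.τ_eq]
  positivity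

/-- Beyond the radius `R ≥ 8BT/α`, the Gaussian factor is so small that the coefficients are
dominated by a geometric series. -/
theorem abs_smoothedBox_le (h : WindowParams B α T τ C R N) {i : ℤ} (hi : R < |i|) :
    |smoothedBox (1 / τ ^ 2) C i|
      ≤ Real.exp (-(32 * T)) * (α / (2 * B)) * Real.exp (-(α / (2 * B))) ^ i.natAbs := by
  have hα := h.α_pos
  have hT := h.one_le_T
  have hB : (0 : ℝ) < B := by exact_mod_cast (by have := h.two_le; omega : 0 < B)
  have hR : 0 < 8 * B * T / α := by positivity
  have hi1 : 8 * B * T / α < |(i : ℝ)| := h.le_R.trans_lt (by exact_mod_cast hi)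
  have hi0 : 0 < |(i : ℝ)| := hR.trans hi1
  have hi2 : i ≠ 0 := by rintro rfl; simp at hi0
  set l := α / (2 * B) with hl
  have hlpos : 0 < l := by positivity
  have h1 : 4 * T ≤ l * |(i : ℝ)| := by
    have : l * (8 * B * T / α) = 4 * T := by rw [hl]; field_simp; ring
    rw [← this]; gcongr
  have h2 : 1 / τ ^ 2 = l ^ 2 / (8 * T) := by
    rw [h.τ_eq, mul_pow, Real.sq_sqrt (by positivity), hl]
    field_simp; ring
  have hπ := Real.pi_gt_three
  have h3 : 9 * (l * |(i : ℝ)|) ≤ 2 * Real.pi ^ 2 * (1 / τ ^ 2) * i ^ 2 := by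
    rw [h2, ← sq_abs (i : ℝ)]
    have : 2 * Real.pi ^ 2 * (l ^ 2 / (8 * T)) * |(i : ℝ)| ^ 2
        = Real.pi ^ 2 * (l * |(i : ℝ)|) * ((l * |(i : ℝ)|) / (4 * T)) := by field_simp; ring
    rw [this]
    have h4 : 1 ≤ (l * |(i : ℝ)|) / (4 * T) := by rw [le_div_iff₀ (by positivity)]; linarith
    have h5 : 9 ≤ Real.pi ^ 2 := by nlinarith
    calc 9 * (l * |(i : ℝ)|) ≤ Real.pi ^ 2 * (l * |(i : ℝ)|) * 1 := by
          rw [mul_one]; gcongr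
      _ ≤ _ := by gcongr
  have h6 : Real.exp (-2 * Real.pi ^ 2 * (1 / τ ^ 2) * i ^ 2)
      ≤ Real.exp (-(32 * T)) * Real.exp (-l) ^ i.natAbs := by
    rw [← Real.exp_nat_mul, ← Real.exp_add]
    refine Real.exp_le_exp.2 ?_
    have : ((i.natAbs : ℕ) : ℝ) = |(i : ℝ)| := by rw [Nat.cast_natAbs, Int.cast_abs]
    rw [this]
    nlinarith
  have h7 : 1 / (Real.pi * |(i : ℝ)|) ≤ l := by
    rw [div_le_iff₀ (by positivity)]
    nlinarith
  unfold smoothedBox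
  rw [if_neg hi2, abs_div, abs_mul, abs_of_pos (Real.exp_pos _), abs_mul,
    abs_of_pos Real.pi_pos]
  calc _ ≤ Real.exp (-2 * Real.pi ^ 2 * (1 / τ ^ 2) * i ^ 2) * 1 / (Real.pi * |(i : ℝ)|) := by
        gcongr; exact Real.abs_sin_le_one _
    _ = Real.exp (-2 * Real.pi ^ 2 * (1 / τ ^ 2) * i ^ 2) * (1 / (Real.pi * |(i : ℝ)|)) := by ring
    _ ≤ (Real.exp (-(32 * T)) * Real.exp (-l) ^ i.natAbs) * l := by gcongr
    _ = _ := by ring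

/-- The truncated Fourier series differs from the full one by the geometric tail. -/
theorem norm_windowSum_sub_le (h : WindowParams B α T τ C R N) (q : ℝ) :
    ‖windowSum τ C R q - ((gaussianReal 0 (1 / NNReal.mk (τ ^ 2) (sq_nonneg τ))).real
      (periodicBox C q) : ℂ)‖ ≤ Real.exp (-T) := by
  have hα := h.α_pos
  have hα1 := h.α_lt
  have hT := h.one_le_T
  have hτ := h.τ_pos
  have hB2 : (2 : ℝ) ≤ B := by exact_mod_cast h.two_le
  have hv : ((1 / NNReal.mk (τ ^ 2) (sq_nonneg τ) : ℝ≥0) : ℝ) = 1 / τ ^ 2 := by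
    rw [NNReal.coe_div]; rfl
  have hv0 : (1 / NNReal.mk (τ ^ 2) (sq_nonneg τ) : ℝ≥0) ≠ 0 := by
    intro h0
    rw [h0] at hv
    have : (0 : ℝ) < 1 / τ ^ 2 := by positivity
    simp at hv
    exact (pow_pos hτ 2).ne hv
  have hC0 : 0 ≤ C := by
    rw [h.C_eq]
    apply div_nonneg <;> linarith
  have hC : C ≤ 1 / 4 := by
    rw [h.C_eq, div_le_div_iff₀ (by positivity) (by norm_num)]
    linarith
  have hs := hasSum_smoothedBox hv0 hC0 hC q
  rw [hv] at hs
  set l := α / (2 * B) with hl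
  have hlpos : 0 < l := by positivity
  have hl1 : l ≤ 1 := by
    rw [hl, div_le_one (by positivity)]; linarith
  have h1 := norm_sum_Icc_sub_le hs (K := Real.exp (-(32 * T)) * l) (r := Real.exp (-l)) (R := R)
    (by positivity) (Real.exp_pos _).le (by rw [Real.exp_lt_one_iff]; linarith) (by
      intro i hi
      have h2 : (2 * Real.pi * Complex.I * i * q : ℂ) = ((2 * Real.pi * i * q : ℝ) : ℂ) * Complex.I := by
        push_cast; ring
      rw [norm_mul, h2, Complex.norm_exp_ofReal_mul_I, mul_one, Complex.norm_real,
        Real.norm_eq_abs]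
      exact abs_smoothedBox_le h hi)
  refine h1.trans ?_
  have h3 : l / 2 ≤ 1 - Real.exp (-l) := by
    have h4 := Real.add_one_le_exp l
    have h5 : Real.exp (-l) * Real.exp l = 1 := by rw [← Real.exp_add]; simp
    have h6 : Real.exp (-l) * (1 + l) ≤ 1 := by
      rw [← h5]; gcongr; linarith
    have h7 := Real.exp_pos (-l)
    nlinarith
  have h8 : (4 : ℝ) ≤ Real.exp (31 * T) := by linarith [Real.add_one_le_exp (31 * T)]
  calc 2 * (Real.exp (-(32 * T)) * l) / (1 - Real.exp (-l))
      ≤ 2 * (Real.exp (-(32 * T)) * l) / (l / 2) := by gcongr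
    _ = 4 * Real.exp (-(32 * T)) := by field_simp; ring
    _ ≤ Real.exp (31 * T) * Real.exp (-(32 * T)) := by gcongr
    _ = Real.exp (-T) := by rw [← Real.exp_add]; congr 1; ring

/-- The parameter `τ` is chosen to make a deviation of half the width of the transition region
improbable. -/
theorem WindowParams.tail_le (h : WindowParams B α T τ C R N) :
    (gaussianReal 0 (1 / NNReal.mk (τ ^ 2) (sq_nonneg τ))).real {z | α / (4 * B) ≤ |z|}
      ≤ 2 * Real.exp (-T) := by
  have hα := h.α_pos
  have hT := h.one_le_T
  have hτ := h.τ_pos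
  have hB2 : (2 : ℝ) ≤ B := by exact_mod_cast h.two_le
  have hv : ((1 / NNReal.mk (τ ^ 2) (sq_nonneg τ) : ℝ≥0) : ℝ) = 1 / τ ^ 2 := by
    rw [NNReal.coe_div]; rfl
  have hv0 : (1 / NNReal.mk (τ ^ 2) (sq_nonneg τ) : ℝ≥0) ≠ 0 := by
    intro h0
    rw [h0] at hv
    have : (0 : ℝ) < 1 / τ ^ 2 := by positivity
    simp at hv
    exact (pow_pos hτ 2).ne hv
  refine gaussianReal_tail hv0 (by positivity) ?_
  rw [hv, h.τ_eq, mul_pow, Real.sq_sqrt (by positivity)]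
  refine le_of_eq ?_
  field_simp

/-- The window vanishes, up to the accuracy, outside its bin. -/
theorem norm_windowSum_le (h : WindowParams B α T τ C R N) {q : ℝ}
    (hq : ∀ n : ℤ, 1 ≤ 2 * B * |q - n|) : ‖windowSum τ C R q‖ ≤ 4 * Real.exp (-T) := by
  have hB2 : (2 : ℝ) ≤ B := by exact_mod_cast h.two_le
  have h1 := norm_windowSum_sub_le h q
  have h2 := periodicBox_outer (gaussianReal 0 (1 / NNReal.mk (τ ^ 2) (sq_nonneg τ))) (C := C)
    (q := q) (g := α / (4 * B)) (by
      intro n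
      have h3 : C + α / (4 * B) = 1 / (2 * B) := by rw [h.C_eq]; field_simp; ring
      rw [h3, div_le_iff₀ (by positivity)]
      linarith [hq n])
  have h4 := h.tail_le
  have h5 : ‖((gaussianReal 0 (1 / NNReal.mk (τ ^ 2) (sq_nonneg τ))).real
      (periodicBox C q) : ℂ)‖ ≤ 2 * Real.exp (-T) := by
    rw [Complex.norm_real, Real.norm_of_nonneg measureReal_nonneg]; linarith
  calc ‖windowSum τ C R q‖ ≤ _ := norm_le_norm_sub_add _ _
    _ ≤ Real.exp (-T) + 2 * Real.exp (-T) := add_le_add h1 h5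
    _ ≤ _ := by linarith [Real.exp_pos (-T)]

/-- Inside its bin the window agrees, up to the accuracy, with the computed values. -/
theorem norm_windowSum_sub_windowFreq_le (h : WindowParams B α T τ C R N) {q : ℝ}
    (hq : 2 * B * |q| ≤ 1) :
    ‖windowSum τ C R q - (windowFreq B α τ C N q : ℂ)‖ ≤ 4 * Real.exp (-T) := by
  have hα := h.α_pos
  have hα1 := h.α_lt
  have hT := h.one_le_T
  have hτ := h.τ_pos
  have hB2 : (2 : ℝ) ≤ B := by exact_mod_cast h.two_le
  have hq' : |q| ≤ 1 / (2 * B) := by rw [le_div_iff₀ (by positivity)]; linarith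
  have hE := Real.exp_pos (-T)
  have hCg : C + α / (4 * B) = 1 / (2 * B) := by rw [h.C_eq]; field_simp; ring
  have hCg' : C - α / (4 * B) = (1 - α) / (2 * B) := by rw [h.C_eq]; field_simp; ring
  have hB4 : 1 / (2 * B : ℝ) ≤ 1 / 4 := by
    rw [div_le_div_iff₀ (by positivity) (by norm_num)]; linarith
  have htail := h.tail_le
  unfold windowFreq
  split_ifs with h1 h2
  · have h3 := periodicBox_inner (gaussianReal 0 (1 / NNReal.mk (τ ^ 2) (sq_nonneg τ))) (C := C)
      (q := q) (g := α / (4 * B)) (by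
        rw [hCg', le_div_iff₀ (by positivity)]; linarith)
    have h4 : ‖((gaussianReal 0 (1 / NNReal.mk (τ ^ 2) (sq_nonneg τ))).real
      (periodicBox C q) : ℂ) - ((1 : ℝ) : ℂ)‖ ≤ 2 * Real.exp (-T) := by
      rw [← Complex.ofReal_sub, Complex.norm_real, Real.norm_eq_abs]; exact h3.trans htail
    calc _ ≤ _ := norm_sub_le_norm_sub_add_norm_sub _ _ _
      _ ≤ Real.exp (-T) + 2 * Real.exp (-T) := add_le_add (norm_windowSum_sub_le h q) h4
      _ ≤ _ := by linarith
  · rw [Complex.ofReal_zero, sub_zero]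
    refine norm_windowSum_le h fun n => ?_
    by_cases hn : n = 0
    · subst hn; simpa using h2
    · have h3 : (1 : ℝ) ≤ |(n : ℝ)| := by
        exact_mod_cast Int.one_le_abs hn
      have h4 : |(n : ℝ)| ≤ |q - n| + |q| := by
        have := abs_sub_abs_le_abs_sub (n : ℝ) q
        rw [abs_sub_comm] at this
        linarith
      have h5 : 3 / 4 ≤ |q - n| := by linarith
      nlinarith
  · -- the window is even, so that `q` may be replaced by `|q|`
    have h3 : windowSum τ C R q = windowSum τ C R |q| := by
      rcases abs_choice q with h | h
      · rw [h]
      · rw [h, windowSum_neg]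
    rw [h3]
    generalize |q| = x at *
    have hx0 : (1 - α) / (2 * B) ≤ x := by
      rw [div_le_iff₀ (by positivity)]; linarith
    have hx : 0 ≤ x := le_trans (div_nonneg (by linarith) (by positivity)) hx0
    have hgC : α / (4 * B) ≤ C := by
      rw [h.C_eq, div_le_div_iff₀ (by positivity) (by positivity)]
      nlinarith
    have h4 := periodicBox_transition (gaussianReal 0 (1 / NNReal.mk (τ ^ 2) (sq_nonneg τ)))
      (C := C) (q := x) (g := α / (4 * B)) hgC (by rw [hCg]; exact hB4) hx (by rw [hCg]; exact hq')
    have h5 := gaussianReal_Ioi (v := 1 / NNReal.mk (τ ^ 2) (sq_nonneg τ)) hτ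
      (by rw [NNReal.coe_div]; rfl) (C - x)
    rw [neg_sub] at h5
    set y := τ * (C - x) with hy
    have hy2 : y ^ 2 ≤ 2 * T := by
      have h6 : |C - x| ≤ α / (4 * B) := by
        rw [abs_le]
        constructor <;> linarith
      have h7 : (C - x) ^ 2 ≤ (α / (4 * B)) ^ 2 := sq_le_sq' (abs_le.1 h6).1 (abs_le.1 h6).2
      have h8 : τ ^ 2 * (α / (4 * B)) ^ 2 = 2 * T := by
        rw [h.τ_eq, mul_pow, Real.sq_sqrt (by positivity)]
        field_simp
      rw [hy, mul_pow, ← h8]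
      gcongr
    have h6 := (abs_integral_sub_oddSeries N y).trans (oddSeries_error hT h.le_N hy2)
    have h7 : 1 / √(2 * Real.pi) ≤ 1 := by
      rw [div_le_one (by have := Real.pi_pos; positivity), Real.one_le_sqrt]
      linarith [Real.pi_gt_three]
    have h8 : |(gaussianReal 0 (1 / NNReal.mk (τ ^ 2) (sq_nonneg τ))).real (Set.Ioi (x - C))
        - (1 / 2 + Real.exp (-y ^ 2 / 2) / √(2 * Real.pi) * oddSeries N y)| ≤ Real.exp (-T) := by
      rw [h5]
      have h9 : (1 / 2 + 1 / √(2 * Real.pi) * ∫ s in (0 : ℝ)..y, Real.exp (-s ^ 2 / 2))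
          - (1 / 2 + Real.exp (-y ^ 2 / 2) / √(2 * Real.pi) * oddSeries N y)
          = 1 / √(2 * Real.pi) * ((∫ s in (0 : ℝ)..y, Real.exp (-s ^ 2 / 2))
            - Real.exp (-y ^ 2 / 2) * oddSeries N y) := by ring
      rw [h9, abs_mul, abs_of_nonneg (by positivity)]
      calc _ ≤ 1 * Real.exp (-T) := by gcongr
        _ = _ := one_mul _
    have h10 : ‖((gaussianReal 0 (1 / NNReal.mk (τ ^ 2) (sq_nonneg τ))).real
        (periodicBox C x) : ℂ)
        - ((1 / 2 + Real.exp (-y ^ 2 / 2) / √(2 * Real.pi) * oddSeries N y : ℝ) : ℂ)‖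
        ≤ 3 * Real.exp (-T) := by
      rw [← Complex.ofReal_sub, Complex.norm_real, Real.norm_eq_abs]
      calc _ ≤ _ := abs_sub_le _ _ _
        _ ≤ 2 * Real.exp (-T) + Real.exp (-T) := add_le_add (h4.trans htail) h8
        _ = _ := by ring
    calc _ ≤ _ := norm_sub_le_norm_sub_add_norm_sub _ _ _
      _ ≤ Real.exp (-T) + 3 * Real.exp (-T) := add_le_add (norm_windowSum_sub_le h x) h10
      _ ≤ _ := by linarith

end Window

/-! ### Hashing of the spectrum into bins -/

section Bins

/-- The root of unity `exp (-2πi · num / den)`, in the form in which the program computes it. -/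
noncomputable def root (num den : ℤ) : ℂ :=
  Complex.exp (((0 - 2 * Real.pi * num / den : ℝ) : ℂ) * Complex.I)

theorem root_add (a b n : ℤ) : root (a + b) n = root a n * root b n := by
  unfold root
  rw [← Complex.exp_add]
  congr 1
  push_cast
  ring

theorem root_mul_self (k : ℤ) {n : ℤ} (hn : n ≠ 0) : root (n * k) n = 1 := by
  unfold root
  rw [Complex.exp_eq_one_iff]
  refine ⟨-k, ?_⟩
  have : (n : ℂ) ≠ 0 := by exact_mod_cast hn
  push_cast
  field_simp
  ring

@[simp] theorem root_zero (n : ℤ) : root 0 n = 1 := by simp [root]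

theorem norm_root (a n : ℤ) : ‖root a n‖ = 1 := Complex.norm_exp_ofReal_mul_I _

theorem root_congr {a b n : ℤ} (hn : n ≠ 0) (h : a ≡ b [ZMOD n]) : root a n = root b n := by
  obtain ⟨c, hc⟩ := h.dvd
  rw [show b = a + n * c by linarith, root_add, root_mul_self c hn, mul_one]

theorem root_mul_left (a n : ℤ) {c : ℤ} (hc : c ≠ 0) : root (c * a) (c * n) = root a n := by
  unfold root
  have : (c : ℂ) ≠ 0 := by exact_mod_cast hc
  congr 1
  push_cast
  rw [show (2 * Real.pi * (c * a) / (c * n) : ℂ) = 2 * Real.pi * a / n by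
    rw [show (2 * Real.pi * (c * a) : ℂ) = c * (2 * Real.pi * a) by ring, mul_div_mul_left _ _ this]]

/-- Fourier inversion, with an integer argument. -/
theorem eq_sum_spectrum {n : ℕ} [NeZero n] (x : ZMod n → ℂ) (j : ℤ) :
    x (j : ZMod n) = 1 / (√n : ℂ) * ∑ f : ZMod n,
      spectrum x f * Complex.exp (2 * Real.pi * Complex.I * f.val * j / n) := by
  have h1 := congrFun (LinearEquiv.symm_apply_apply ZMod.dft x) (j : ZMod n)
  rw [ZMod.invDFT_apply] at h1
  rw [← h1]
  have hn : (0 : ℝ) < n := by exact_mod_cast NeZero.pos n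
  have h2 : (√n : ℂ) * √n = n := by
    rw [← Complex.ofReal_mul, Real.mul_self_sqrt hn.le]; simp
  have h3 : (√n : ℂ) ≠ 0 := by
    rw [Ne, Complex.ofReal_eq_zero]; exact (Real.sqrt_pos.2 hn).ne'
  have h5 : (n : ℂ)⁻¹ = (√n : ℂ)⁻¹ * (√n : ℂ)⁻¹ := by rw [← mul_inv, h2]
  rw [smul_eq_mul, h5, mul_assoc, one_div]
  congr 1
  rw [Finset.mul_sum]
  refine Finset.sum_congr rfl fun f _ => ?_
  have h4 : (f * (j : ZMod n)) = ((f.val * j : ℤ) : ZMod n) := by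
    push_cast
    rw [ZMod.natCast_zmod_val]
  rw [smul_eq_mul, h4, ZMod.stdAddChar_coe]
  unfold spectrum
  push_cast
  rw [one_div]
  ring_nf

/-- The contribution of the position `i` of the permuted signal to the bins, in the time domain. -/
noncomputable def timeTerm {n : ℕ} (x : ZMod n → ℂ) (τ C : ℝ) (σ a b i : ℤ) : ℂ :=
  ((√n * smoothedBox (1 / τ ^ 2) C i : ℝ) : ℂ) * x ((σ * (i - a) : ℤ) : ZMod n)
    * root (σ * b * i) n

theorem sum_range_eq_sum_Icc {R : ℤ} (F : ℤ → ℂ) :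
    ∑ l ∈ Finset.range (2 * R + 1).toNat, F (l - R) = ∑ i ∈ Finset.Icc (-R) R, F i := by
  refine Finset.sum_nbij' (fun l => (l : ℤ) - R) (fun i => (i + R).toNat) ?_ ?_ ?_ ?_ ?_
  · intro l hl; simp only [Finset.mem_range] at hl; simp only [Finset.mem_Icc]; omega
  · intro l hl; simp only [Finset.mem_Icc] at hl; simp only [Finset.mem_range]; omega
  · intro l hl; simp
  · intro l hl; simp only [Finset.mem_Icc] at hl; omega
  · intro l hl; rfl

/-- The transform of the folded signal, in terms of the spectrum and the window. -/
theorem sum_root_mul_timeTerm {n : ℕ} [NeZero n] (x : ZMod n → ℂ) (τ C : ℝ) (σ a b : ℤ) {R : ℤ}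
    {B M : ℕ} (hn : n = B * M) (j : ℤ) :
    ∑ q ∈ Finset.range B, root (j * q) B * (∑ l ∈ Finset.range (2 * R + 1).toNat,
        if ((l : ℤ) - R) % B = q then timeTerm x τ C σ a b (l - R) else 0)
      = ∑ f : ZMod n, spectrum x f * root (a * σ * f.val) n
          * windowSum τ C R ((σ * (f.val - b) - j * M : ℤ) / n : ℝ) := by
  have hn0 : 0 < n := NeZero.pos n
  have hB : 0 < B := by
    rcases Nat.eq_zero_or_pos B with h | h
    · subst h; omega
    · exact h
  have hM : 0 < M := by
    rcases Nat.eq_zero_or_pos M with h | h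
    · subst h; omega
    · exact h
  have h1 : ∀ q : ℕ, (∑ l ∈ Finset.range (2 * R + 1).toNat,
        if ((l : ℤ) - R) % B = q then timeTerm x τ C σ a b (l - R) else 0)
      = ∑ i ∈ Finset.Icc (-R) R, if i % B = q then timeTerm x τ C σ a b i else 0 := fun q =>
    sum_range_eq_sum_Icc fun i => if i % B = q then timeTerm x τ C σ a b i else 0
  simp_rw [h1, Finset.mul_sum]
  rw [Finset.sum_comm]
  have h2 : ∀ i : ℤ, ∑ q ∈ Finset.range B, root (j * q) B
      * (if i % B = q then timeTerm x τ C σ a b i else 0)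
      = root (j * M * i) n * timeTerm x τ C σ a b i := by
    intro i
    have h0 : 0 ≤ i % B := Int.emod_nonneg _ (by omega)
    have h0' : i % B < B := Int.emod_lt_of_pos _ (by omega)
    rw [Finset.sum_eq_single (i % B).toNat]
    · rw [if_pos (by omega), Int.toNat_of_nonneg h0]
      congr 1
      rw [show j * M * i = (M : ℤ) * (j * i) by ring, hn, Nat.mul_comm, Nat.cast_mul,
        root_mul_left _ _ (by omega)]
      exact root_congr (by omega) ((Int.ModEq.refl j).mul (Int.mod_modEq _ _))
    · intro q _ hq
      rw [if_neg (by omega), mul_zero]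
    · intro hq
      simp only [Finset.mem_range] at hq
      omega
  simp_rw [h2]
  unfold timeTerm windowSum
  simp_rw [eq_sum_spectrum x, Finset.mul_sum, Finset.sum_mul, Finset.mul_sum]
  rw [Finset.sum_comm]
  refine Finset.sum_congr rfl fun f _ => Finset.sum_congr rfl fun i _ => ?_
  have h3 : (√n : ℂ) ≠ 0 := by
    rw [Ne, Complex.ofReal_eq_zero]
    exact (Real.sqrt_pos.2 (by exact_mod_cast hn0)).ne'
  have h4 : Complex.exp (2 * Real.pi * Complex.I * f.val * (σ * (i - a) : ℤ) / n)
      * root (σ * b * i) n * root (j * M * i) n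
      = root (a * σ * f.val) n * Complex.exp (2 * Real.pi * Complex.I * i
        * ((σ * (f.val - b) - j * M : ℤ) / n : ℝ)) := by
    unfold root
    rw [← Complex.exp_add, ← Complex.exp_add, ← Complex.exp_add]
    congr 1
    push_cast
    ring
  push_cast at h4 ⊢
  calc _ = (√n * (1 / √n)) * (smoothedBox (1 / τ ^ 2) C i * spectrum x f) *
        (Complex.exp (2 * Real.pi * Complex.I * f.val * (σ * (i - a)) / n)
          * root (σ * b * i) n * root (j * M * i) n) := by ring
    _ = _ := by
      rw [h4, mul_one_div_cancel h3]
      ring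

theorem windowSum_add_int (τ C : ℝ) (R : ℤ) (q : ℝ) (z : ℤ) :
    windowSum τ C R (q + z) = windowSum τ C R q := by
  unfold windowSum
  refine Finset.sum_congr rfl fun i _ => ?_
  congr 1
  have h : (2 * Real.pi * Complex.I * i * ((q + z : ℝ) : ℂ))
      = 2 * Real.pi * Complex.I * i * q + ((i * z : ℤ) : ℂ) * (2 * Real.pi * Complex.I) := by
    push_cast; ring
  rw [h, Complex.exp_add, Complex.exp_int_mul_two_pi_mul_I, mul_one]

/-- The index of the bin nearest to the frequency `q`, for bins of width `M`, not reduced modulo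
the number of bins. -/
def binIndex (M q : ℤ) : ℤ := (2 * q + M) / (2 * M)

/-- The offset of the frequency `q` from the centre of its bin. -/
def binOffset (M q : ℤ) : ℤ := q - binIndex M q * M

theorem binOffset_bounds {M : ℤ} (hM : 0 < M) (q : ℤ) :
    -M ≤ 2 * binOffset M q ∧ 2 * binOffset M q < M := by
  unfold binOffset binIndex
  have h1 := Int.mul_ediv_add_emod (2 * q + M) (2 * M)
  have h2 := Int.emod_nonneg (2 * q + M) (show 2 * M ≠ 0 by omega)
  have h3 := Int.emod_lt_of_pos (2 * q + M) (show 0 < 2 * M by omega)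
  constructor <;> nlinarith

theorem binIndex_mod_eq {M B q j z : ℤ} (hj0 : 0 ≤ j) (hj : j < B)
    (h : 2 * |q - j * M - z * (B * M)| < M) : binIndex M q % B = j := by
  have hM : 0 < M := by have := abs_nonneg (q - j * M - z * (B * M)); omega
  have h1 : binIndex M q = j + z * B := by
    unfold binIndex
    have h2 : -M < 2 * (q - j * M - z * (B * M)) ∧ 2 * (q - j * M - z * (B * M)) < M := by
      have h3 := abs_lt.1 (show |q - j * M - z * (B * M)| < |q - j * M - z * (B * M)| + 1 by omega)
      have h4 := neg_abs_le (q - j * M - z * (B * M))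
      have h5 := le_abs_self (q - j * M - z * (B * M))
      constructor <;> omega
    rw [Int.ediv_eq_iff_of_pos (by omega)]
    constructor <;> nlinarith
  rw [h1, Int.add_mul_emod_self_right]
  exact Int.emod_eq_of_lt hj0 hj

variable {B M : ℕ} {α T τ C : ℝ} {R : ℤ} {N : ℕ}

/-- The window at the distance of the frequency `q` from the centre of bin `j`. -/
theorem norm_windowSum_bin_le (h : WindowParams B α T τ C R N) (hM : 0 < M) {q q' j : ℤ}
    (hqq : q ≡ q' [ZMOD (B * M : ℕ)]) (hj0 : 0 ≤ j) (hj : j < B) :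
    ‖windowSum τ C R ((q - j * M : ℤ) / (B * M : ℕ) : ℝ)
      - (if binIndex M q' % B = j then
          (windowFreq B α τ C N ((binOffset M q' : ℝ) / (B * M : ℕ)) : ℂ) else 0)‖
      ≤ 4 * Real.exp (-T) := by
  have hB : 0 < B := by have := h.two_le; omega
  have hn : (0 : ℝ) < (B * M : ℕ) := by exact_mod_cast Nat.mul_pos hB hM
  obtain ⟨c, hc⟩ := hqq.dvd
  have hBM : ((B * M : ℕ) : ℝ) = B * M := by push_cast; ring
  have hM' : (0 : ℝ) < M := by exact_mod_cast hM
  have hB' : (0 : ℝ) < B := by exact_mod_cast hB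
  split_ifs with h1
  · have h2 := Int.mul_ediv_add_emod (binIndex M q') B
    set d := binIndex M q' / B with hd
    have h3 : ((q - j * M : ℤ) : ℝ) / (B * M : ℕ)
        = (binOffset M q' : ℝ) / (B * M : ℕ) + ((d - c : ℤ) : ℝ) := by
      have h4 : q - j * M = binOffset M q' + (d - c) * (B * M : ℕ) := by
        unfold binOffset
        rw [← h2, h1]
        push_cast at hc ⊢
        linear_combination -hc
      rw [h4]
      push_cast
      field_simp
    rw [h3, windowSum_add_int]
    refine norm_windowSum_sub_windowFreq_le h ?_
    obtain ⟨h5, h6⟩ := binOffset_bounds (show (0 : ℤ) < M by omega) q'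
    have h7 : 2 * |(binOffset M q' : ℝ)| ≤ M := by
      have : 2 * |binOffset M q'| ≤ M := by
        rcases abs_cases (binOffset M q') with h | h <;> omega
      exact_mod_cast this
    rw [abs_div, abs_of_pos hn, hBM]
    rw [show 2 * (B : ℝ) * (|(binOffset M q' : ℝ)| / (B * M)) = 2 * |(binOffset M q' : ℝ)| / M by
      field_simp]
    rw [div_le_one hM']
    exact h7
  · rw [sub_zero]
    refine norm_windowSum_le h fun z => ?_
    by_contra hlt
    rw [not_le] at hlt
    refine h1 (binIndex_mod_eq (z := z + c) hj0 hj ?_)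
    have h3 : q' - j * M - (z + c) * (B * M) = (q - j * M) - z * (B * M : ℕ) := by
      push_cast at hc ⊢
      linear_combination hc
    rw [h3]
    have h4 : ((q - j * M : ℤ) : ℝ) / (B * M : ℕ) - z
        = (((q - j * M) - z * (B * M : ℕ) : ℤ) : ℝ) / (B * M : ℕ) := by
      push_cast
      field_simp
    rw [h4, abs_div, abs_of_pos hn, hBM,
      show ∀ y : ℝ, 2 * (B : ℝ) * (y / (B * M)) = 2 * y / M by intro y; field_simp,
      div_lt_one hM'] at hlt
    exact_mod_cast hlt

/-- The value of bin `j` after the subtraction of the spectrum already known is, up to the accuracy,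
the sum of the residual coefficients hashed into it. -/
theorem norm_bin_sub_le {n : ℕ} [NeZero n] (x : ZMod n → ℂ) (X z : ZMod n → ℤ)
    (hX : ∀ f, spectrum x f = X f) (h : WindowParams B α T τ C R N) (hn : n = B * M) (σ a b : ℤ)
    {j : ℤ} (hj0 : 0 ≤ j) (hj : j < B) :
    ‖(∑ q ∈ Finset.range B, root (j * q) B * (∑ l ∈ Finset.range (2 * R + 1).toNat,
        if ((l : ℤ) - R) % B = q then timeTerm x τ C σ a b (l - R) else 0)
      - ∑ f : ZMod n, if binIndex M (σ * (f.val - b) % n) % B = j then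
          (windowFreq B α τ C N (binOffset M (σ * (f.val - b) % n) / n) : ℂ) * z f
            * root (a * σ * f.val) n else 0)
      - ∑ f : ZMod n, (if binIndex M (σ * (f.val - b) % n) % B = j then
          (windowFreq B α τ C N (binOffset M (σ * (f.val - b) % n) / n) : ℂ) * (X f - z f : ℤ)
            * root (a * σ * f.val) n else 0)‖
      ≤ (∑ f : ZMod n, |(X f : ℝ)|) * (4 * Real.exp (-T)) := by
  have hM : 0 < M := by
    rcases Nat.eq_zero_or_pos M with h | h
    · subst h; have := NeZero.pos n; omega
    · exact h
  rw [sum_root_mul_timeTerm x τ C σ a b hn, ← Finset.sum_sub_distrib, ← Finset.sum_sub_distrib,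
    Finset.sum_mul]
  refine (norm_sum_le _ _).trans (Finset.sum_le_sum fun f _ => ?_)
  have h1 := norm_windowSum_bin_le h hM (q := σ * (f.val - b)) (q' := σ * (f.val - b) % n) (j := j)
    (by rw [← hn]; exact (Int.mod_modEq _ _).symm) hj0 hj
  rw [← hn] at h1
  rw [hX f]
  calc _ = ‖(X f : ℂ) * root (a * σ * f.val) n * (windowSum τ C R ((σ * (f.val - b) - j * M : ℤ) / n : ℝ)
      - (if binIndex M (σ * (f.val - b) % n) % B = j then
          (windowFreq B α τ C N ((binOffset M (σ * (f.val - b) % n) : ℝ) / n) : ℂ) else 0))‖ := by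
        congr 1
        split_ifs
        · push_cast; ring
        · ring
    _ ≤ _ := by
        rw [norm_mul, norm_mul, norm_root, mul_one, Complex.norm_intCast]
        gcongr

end Bins

/-! ### Reading a coefficient off its bin -/

section Decode

/-- If two approximations of `r` and of `r · exp (-2πi s / n)` are good to within `1 / (64 n²)`,
then the first determines the integer `r`, and their quotient determines `s` modulo `n`. -/
theorem decode_bin {n : ℕ} (hn : 2 ≤ n) {U U' : ℂ} {r s : ℤ} (hr : r ≠ 0)
    (hU : ‖U - r‖ ≤ 1 / (64 * n ^ 2)) (hU' : ‖U' - r * root s n‖ ≤ 1 / (64 * n ^ 2)) :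
    1 / 2 < ‖U‖ ∧ round U.re = r ∧
      round (phase (U / U') * n / (2 * Real.pi)) ≡ s [ZMOD n] := by
  have hn' : (2 : ℝ) ≤ n := by exact_mod_cast hn
  have hr1 : (1 : ℝ) ≤ |(r : ℝ)| := by exact_mod_cast Int.one_le_abs hr
  have hr1' : (1 : ℝ) ≤ ‖(r : ℂ)‖ := by rw [Complex.norm_intCast]; exact hr1
  have hr0 : (r : ℂ) ≠ 0 := by exact_mod_cast hr
  have hη : (1 : ℝ) / (64 * n ^ 2) ≤ 1 / (64 * n) / 2 := by
    rw [div_div, div_le_div_iff₀ (by positivity) (by positivity)]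
    nlinarith
  have hη2 : (1 : ℝ) / (64 * n) ≤ 1 / 128 := by
    rw [div_le_div_iff₀ (by positivity) (by positivity)]
    linarith
  refine ⟨?_, ?_, ?_⟩
  · have := norm_sub_norm_le (r : ℂ) U
    rw [norm_sub_rev] at this
    linarith
  · have h1 : |U.re - r| ≤ 1 / (64 * n ^ 2) := by
      have := Complex.abs_re_le_norm (U - r)
      simp only [Complex.sub_re, Complex.intCast_re] at this
      linarith
    have h2 : round (U.re - r) = 0 := by
      rw [round_eq_zero_iff]
      have := abs_le.1 h1
      constructor <;> linarith
    rw [round_sub_intCast] at h2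
    omega
  · set ρ := root s n with hρ
    have hρ1 : ‖ρ‖ = 1 := norm_root s n
    have hρ0 : ρ ≠ 0 := by rw [← norm_ne_zero_iff, hρ1]; norm_num
    obtain ⟨e₁, he₁⟩ : ∃ e₁, U = r * (1 + e₁) := ⟨(U - r) / r, by field_simp; ring⟩
    obtain ⟨e₂, he₂⟩ : ∃ e₂, U' = r * ρ * (1 + e₂) :=
      ⟨(U' - r * ρ) / (r * ρ), by field_simp; ring⟩
    have h1 : ‖e₁‖ ≤ 1 / (64 * n ^ 2) := by
      have h3 : U - r = r * e₁ := by rw [he₁]; ring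
      rw [h3, norm_mul] at hU
      nlinarith [norm_nonneg e₁]
    have h2 : ‖e₂‖ ≤ 1 / (64 * n ^ 2) := by
      have h3 : U' - r * ρ = r * ρ * e₂ := by rw [he₂]; ring
      rw [h3, norm_mul, norm_mul, hρ1, mul_one] at hU'
      nlinarith [norm_nonneg e₂]
    have h3 : (1 : ℝ) / 2 ≤ ‖1 + e₂‖ := by
      have := norm_sub_norm_le (1 : ℂ) (-e₂)
      rw [norm_neg, norm_one, sub_neg_eq_add] at this
      linarith
    have h3' : (1 + e₂) ≠ 0 := by rw [← norm_pos_iff]; linarith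
    obtain ⟨y, hy⟩ : ∃ y, y = (e₁ - e₂) / (1 + e₂) := ⟨_, rfl⟩
    have h4 : U / U' = ρ⁻¹ * (1 + y) := by
      rw [he₁, he₂, hy]; field_simp; ring
    have h5 : ‖y‖ ≤ 1 / (16 * n) := by
      rw [hy, norm_div, div_le_iff₀ (by linarith)]
      have h6 := norm_sub_le e₁ e₂
      have h7 : (1 : ℝ) / (16 * n) = 4 * (1 / (64 * n)) := by field_simp; norm_num
      rw [h7]
      have h8 : 0 < (1 : ℝ) / (64 * n) := by positivity
      nlinarith
    have hn16 : (1 : ℝ) / (16 * n) ≤ 1 / 32 := by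
      rw [div_le_div_iff₀ (by positivity) (by positivity)]
      linarith
    have h6 : |(1 + y).arg| ≤ 3 / 2 * (1 / (16 * n)) := by
      have h7 := Complex.norm_log_one_add_half_le_self (z := y) (by linarith)
      have h8 := Complex.abs_im_le_norm (Complex.log (1 + y))
      rw [Complex.log_im] at h8
      linarith
    have h1y : (1 + y) ≠ 0 := by
      intro h0
      have : y = -1 := by linear_combination h0
      rw [this, norm_neg, norm_one] at h5
      linarith
    have hUU0 : U / U' ≠ 0 := by rw [h4]; exact mul_ne_zero (inv_ne_zero hρ0) h1y
    have hph : Complex.exp (phase (U / U') * Complex.I) = Complex.exp ((U / U').arg * Complex.I) := by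
      unfold phase
      split_ifs
      · push_cast
        rw [add_mul, Complex.exp_add, Complex.exp_two_pi_mul_I, mul_one]
      · rfl
    have hnorm : ‖U / U'‖ = ‖1 + y‖ := by rw [h4, norm_mul, norm_inv, hρ1]; simp
    have h7 : Complex.exp (phase (U / U') * Complex.I)
        = Complex.exp ((2 * Real.pi * s / n : ℝ) * Complex.I)
          * Complex.exp ((1 + y).arg * Complex.I) := by
      rw [hph]
      have h8 := Complex.norm_mul_exp_arg_mul_I (U / U')
      have h9 := Complex.norm_mul_exp_arg_mul_I (1 + y)
      have h10 : ρ⁻¹ = Complex.exp ((2 * Real.pi * s / n : ℝ) * Complex.I) := by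
        rw [hρ, root, ← Complex.exp_neg]
        congr 1
        push_cast
        ring
      rw [← h10]
      have h11 : (‖1 + y‖ : ℂ) ≠ 0 := by
        rw [Ne, Complex.ofReal_eq_zero, norm_eq_zero]; exact h1y
      apply mul_left_cancel₀ h11
      calc (‖1 + y‖ : ℂ) * Complex.exp ((U / U').arg * Complex.I)
          = ρ⁻¹ * (1 + y) := by rw [← hnorm, h8, h4]
        _ = ρ⁻¹ * (‖1 + y‖ * Complex.exp ((1 + y).arg * Complex.I)) := by rw [h9]
        _ = _ := by ring
    rw [← Complex.exp_add, Complex.exp_eq_exp_iff_exists_int] at h7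
    obtain ⟨k, hk⟩ := h7
    have h8 : phase (U / U') = 2 * Real.pi * s / n + (1 + y).arg + k * (2 * Real.pi) := by
      have h9 : ((phase (U / U') : ℝ) : ℂ) * Complex.I
          = ((2 * Real.pi * s / n + (1 + y).arg + k * (2 * Real.pi) : ℝ) : ℂ) * Complex.I := by
        rw [hk]; push_cast; ring
      exact_mod_cast mul_right_cancel₀ Complex.I_ne_zero h9
    have hπ := Real.pi_gt_three
    have h9 : phase (U / U') * n / (2 * Real.pi)
        = (1 + y).arg * n / (2 * Real.pi) + ((s + k * n : ℤ) : ℝ) := by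
      rw [h8]
      push_cast
      field_simp
      ring
    have h10 : round ((1 + y).arg * n / (2 * Real.pi)) = 0 := by
      have h11 : |(1 + y).arg * n / (2 * Real.pi)| ≤ 1 / 4 := by
        rw [abs_div, abs_mul, abs_of_pos (show (0 : ℝ) < 2 * Real.pi by positivity),
          abs_of_pos (show (0 : ℝ) < n by positivity), div_le_iff₀ (by positivity)]
        have h12 : 3 / 2 * (1 / (16 * (n : ℝ))) * n = 3 / 32 := by field_simp; norm_num
        nlinarith
      rw [round_eq_zero_iff]
      have := abs_le.1 h11
      constructor <;> linarith
    rw [h9, round_add_intCast, h10, zero_add]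
    exact (Int.modEq_iff_dvd.2 ⟨-k, by ring⟩)

/-- A bin without residual coefficients is recognized as empty. -/
theorem empty_bin {n : ℕ} (hn : 2 ≤ n) {U : ℂ} (hU : ‖U‖ ≤ 1 / (64 * n ^ 2)) : ¬ 1 / 2 < ‖U‖ := by
  have hn' : (2 : ℝ) ≤ n := by exact_mod_cast hn
  have : (1 : ℝ) / (64 * n ^ 2) ≤ 1 / 2 := by
    rw [div_le_div_iff₀ (by positivity) (by positivity)]
    nlinarith
  linarith

end Decode

/-! ### Collisions and transition regions under a random permutation of the spectrum -/

section Counting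

/-- Frequencies in the same bin are at distance less than the width `M` of a bin. -/
theorem binIndex_eq_imp {M B n q q' : ℤ} (hM : 0 < M) (hn : n = B * M)
    (h : binIndex M q % B = binIndex M q' % B) : ∃ e : ℤ, |e| < M ∧ q - q' ≡ e [ZMOD n] := by
  refine ⟨binOffset M q - binOffset M q', ?_, ?_⟩
  · obtain ⟨h1, h2⟩ := binOffset_bounds hM q
    obtain ⟨h3, h4⟩ := binOffset_bounds hM q'
    rw [abs_lt]
    constructor <;> omega
  · obtain ⟨c, hc⟩ := (show binIndex M q ≡ binIndex M q' [ZMOD B] from h).dvd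
    refine Int.modEq_iff_dvd.2 ⟨c, ?_⟩
    unfold binOffset
    rw [hn]
    linear_combination M * hc

open scoped Classical in
/-- For a random odd factor, the multiples of a fixed non-zero residue modulo a power of two are
spread out. -/
theorem card_odd_mul_near_zero {p μ : ℕ} (hp : 1 ≤ p) {D : ℤ}
    (hD : ¬ ((2 ^ p : ℕ) : ℤ) ∣ D) :
    ((Finset.range (2 ^ (p - 1))).filter fun j : ℕ =>
      ∃ e : ℤ, |e| < (2 ^ μ : ℕ) ∧ (2 * (j : ℤ) + 1) * D ≡ e [ZMOD (2 ^ p : ℕ)]).card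
      ≤ 2 * 2 ^ μ := by
  have hD0 : D ≠ 0 := by rintro rfl; exact hD (dvd_zero _)
  obtain ⟨e, D', hD', rfl⟩ : ∃ (e : ℕ) (D' : ℤ), ¬ (2 : ℤ) ∣ D' ∧ D = 2 ^ e * D' := by
    have hfin : FiniteMultiplicity (2 : ℤ) D :=
      Int.finiteMultiplicity_iff.2 ⟨by decide, hD0⟩
    obtain ⟨D', h1, h2⟩ := hfin.exists_eq_pow_mul_and_not_dvd
    exact ⟨_, D', h2, h1⟩
  have hep : e < p := by
    by_contra h
    refine hD (Dvd.dvd.mul_right ?_ _)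
    push_cast
    exact pow_dvd_pow 2 (by omega)
  have hcop : ∀ j : ℕ, IsCoprime (2 ^ p : ℤ) ((2 * (j : ℤ) + 1)) := fun j =>
    IsCoprime.pow_left ⟨-j, 1, by ring⟩
  set A := (Finset.range (2 ^ (p - 1))).filter fun j : ℕ =>
      ∃ e' : ℤ, |e'| < (2 ^ μ : ℕ) ∧ (2 * (j : ℤ) + 1) * (2 ^ e * D') ≡ e' [ZMOD (2 ^ p : ℕ)]
  have hA : ∀ j ∈ A, ∃ y : ℤ, |2 ^ e * y| < (2 ^ μ : ℕ) ∧
      (2 * (j : ℤ) + 1) * (2 ^ e * D') ≡ 2 ^ e * y [ZMOD (2 ^ p : ℕ)] := by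
    intro j hj
    obtain ⟨-, e', h1, h2⟩ := Finset.mem_filter.1 hj
    have h3 : (2 ^ e : ℤ) ∣ e' := by
      have h4 : (2 ^ e : ℤ) ∣ (2 ^ p : ℕ) := by push_cast; exact pow_dvd_pow 2 hep.le
      have h5 := (h4.trans h2.dvd)
      have h6 : (2 ^ e : ℤ) ∣ (2 * (j : ℤ) + 1) * (2 ^ e * D') :=
        Dvd.intro_left ((2 * (j : ℤ) + 1) * D') (by ring)
      simpa using dvd_add h5 h6
    obtain ⟨y, rfl⟩ := h3
    exact ⟨y, h1, h2⟩
  rcases le_or_gt μ e with hμe | hμe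
  · have : A = ∅ := by
      refine Finset.eq_empty_of_forall_notMem fun j hj => ?_
      obtain ⟨y, h1, h2⟩ := hA j hj
      have hy : y = 0 := by
        by_contra hy
        have h3 : (2 ^ μ : ℤ) ≤ 2 ^ e := pow_le_pow_right₀ (by norm_num) hμe
        have h4 := Int.one_le_abs hy
        rw [abs_mul, abs_of_pos (by positivity : (0 : ℤ) < 2 ^ e)] at h1
        push_cast at h1
        nlinarith [pow_pos (show (0 : ℤ) < 2 by norm_num) e]
      rw [hy, mul_zero] at h2
      have h5 := Int.modEq_zero_iff_dvd.1 h2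
      push_cast at h5
      refine hD ?_
      push_cast
      exact (hcop j).dvd_of_dvd_mul_left h5
    rw [this]
    simp
  · choose! y hy1 hy2 using hA
    have hcard : A.card ≤ (Finset.Ioo (-(2 ^ (μ - e) : ℤ)) (2 ^ (μ - e))
        ×ˢ Finset.range (2 ^ e)).card := by
      refine Finset.card_le_card_of_injOn (fun j => (y j, j / 2 ^ (p - 1 - e))) ?_ ?_
      · intro j hj
        have hj' : j ∈ A := hj
        have h1 := hy1 j hj'
        rw [abs_mul, abs_of_pos (by positivity : (0 : ℤ) < 2 ^ e)] at h1
        have h2 : (2 ^ μ : ℤ) = 2 ^ e * 2 ^ (μ - e) := by rw [← pow_add]; congr 1; omega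
        push_cast at h1
        rw [h2] at h1
        have h3 := lt_of_mul_lt_mul_left h1 (by positivity)
        have h4 := (Finset.mem_filter.1 hj').1
        simp only [Finset.coe_product, Set.mem_prod, Finset.mem_coe, Finset.mem_Ioo,
          Finset.mem_range] at *
        refine ⟨abs_lt.1 h3, ?_⟩
        rw [Nat.div_lt_iff_lt_mul (by positivity), ← pow_add]
        rwa [show e + (p - 1 - e) = p - 1 by omega]
      · intro j hj j' hj' hjj
        simp only [Prod.mk.injEq] at hjj
        have h1 := hy2 j hj
        have h2 := hy2 j' hj'
        rw [hjj.1] at h1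
        have h3 := (h2.trans h1.symm).dvd
        have h4 : (2 * (j : ℤ) + 1) * (2 ^ e * D') - (2 * (j' : ℤ) + 1) * (2 ^ e * D')
            = 2 ^ (e + 1) * (D' * (j - j')) := by rw [pow_succ]; ring
        rw [h4] at h3
        have h5 : ((2 ^ p : ℕ) : ℤ) = 2 ^ (e + 1) * 2 ^ (p - 1 - e) := by
          push_cast; rw [← pow_add]; congr 1; omega
        rw [h5] at h3
        have h6 := (mul_dvd_mul_iff_left (by positivity : (2 ^ (e + 1) : ℤ) ≠ 0)).1 h3
        have h7 : IsCoprime (2 ^ (p - 1 - e) : ℤ) D' :=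
          IsCoprime.pow_left ((Int.prime_two.coprime_iff_not_dvd).2 hD')
        have h8 := h7.dvd_of_dvd_mul_left h6
        have h9 : j' ≡ j [MOD 2 ^ (p - 1 - e)] := by
          rw [← Int.natCast_modEq_iff, Int.modEq_iff_dvd]
          push_cast
          exact h8
        rw [← Nat.div_add_mod j (2 ^ (p - 1 - e)), ← Nat.div_add_mod j' (2 ^ (p - 1 - e)), hjj.2,
          show j % 2 ^ (p - 1 - e) = j' % 2 ^ (p - 1 - e) from h9.symm]
    refine hcard.trans ?_
    rw [Finset.card_product, Int.card_Ioo, Finset.card_range]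
    have h10 : 2 ^ μ = 2 ^ (μ - e) * 2 ^ e := by rw [← pow_add]; congr 1; omega
    rw [h10, ← mul_assoc]
    refine Nat.mul_le_mul_right _ ?_
    zify
    rw [Int.toNat_of_nonneg (by have : (1 : ℤ) ≤ 2 ^ (μ - e) := one_le_pow₀ (by norm_num); linarith)]
    linarith

/-- The frequency `q` is too close to the border of its bin. -/
def inTransition (B n M : ℕ) (α : ℝ) (q : ℤ) : Prop :=
  ¬ 2 * (B : ℝ) * |(binOffset M q : ℝ)| ≤ (1 - α) * n

theorem not_inTransition_of_width_one {B n : ℕ} {α : ℝ} (hα : α ≤ 1) (q : ℤ) :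
    ¬ inTransition B n 1 α q := by
  have h : binOffset 1 q = 0 := by
    have := binOffset_bounds (show (0 : ℤ) < 1 by norm_num) q
    omega
  unfold inTransition
  rw [Nat.cast_one, h]
  push Not
  have : 0 ≤ (1 - α) * n := mul_nonneg (by linarith) (Nat.cast_nonneg _)
  simpa using this

open scoped Classical in
theorem card_transition_offsets {M : ℕ} {α : ℝ} (hα : 0 ≤ α) :
    (((Finset.Icc (-(M : ℤ)) M).filter fun o : ℤ =>
      (1 - α) * M < 2 * |(o : ℝ)| ∧ 2 * |o| ≤ M).card : ℝ) ≤ α * M + 2 := by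
  set x : ℝ := (1 - α) * M / 2 with hx
  set P := Finset.Ioc ⌊x⌋ ((M : ℤ) / 2) with hP
  have hsub : ((Finset.Icc (-(M : ℤ)) M).filter fun o : ℤ =>
      (1 - α) * M < 2 * |(o : ℝ)| ∧ 2 * |o| ≤ M) ⊆ P ∪ P.image fun o => -o := by
    intro o ho
    obtain ⟨-, h1, h2⟩ := Finset.mem_filter.1 ho
    have h3 : |o| ∈ P := by
      rw [hP, Finset.mem_Ioc]
      constructor
      · rw [Int.floor_lt, Int.cast_abs]; linarith
      · omega
    rcases abs_choice o with h | h
    · rw [h] at h3; exact Finset.mem_union_left _ h3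
    · refine Finset.mem_union_right _ (Finset.mem_image.2 ⟨|o|, h3, by omega⟩)
  have hPc : (P.card : ℝ) ≤ α * M / 2 + 1 := by
    rw [hP, Int.card_Ioc]
    have h4 := Int.lt_floor_add_one x
    have h5 : ((((M : ℤ) / 2 : ℤ)) : ℝ) ≤ M / 2 := by
      rw [le_div_iff₀ (by norm_num)]
      exact_mod_cast (by omega : (M : ℤ) / 2 * 2 ≤ M)
    have h6 : (((((M : ℤ) / 2 - ⌊x⌋).toNat : ℕ) : ℤ) : ℝ) ≤ α * M / 2 + 1 := by
      rw [Int.toNat_eq_max, Int.cast_max]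
      refine max_le ?_ (by push_cast; positivity)
      push_cast at h5 ⊢
      linarith
    exact_mod_cast h6
  have h7 := (Finset.card_le_card hsub).trans (Finset.card_union_le _ _)
  have h8 : (P.image fun o => -o).card ≤ P.card := Finset.card_image_le
  have h9 : (((Finset.Icc (-(M : ℤ)) M).filter fun o : ℤ =>
      (1 - α) * M < 2 * |(o : ℝ)| ∧ 2 * |o| ≤ M).card : ℝ) ≤ P.card + P.card := by
    exact_mod_cast h7.trans (Nat.add_le_add_left h8 _)
  linarith

open scoped Classical in
/-- For a random shift, a fixed frequency is rarely close to the border of its bin. -/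
theorem card_inTransition_le {B n M : ℕ} (hM : 0 < M) (hB : 0 < B) (hn : n = B * M) {α : ℝ}
    (hα : 0 ≤ α) {σ : ℤ} (hσ : IsCoprime (n : ℤ) σ) (f : ℤ) :
    (((Finset.range n).filter fun b : ℕ => inTransition B n M α (σ * (f - b) % n)).card : ℝ)
      ≤ α * n + 2 * B := by
  have hn0 : 0 < n := hn ▸ Nat.mul_pos hB hM
  set S := (Finset.Icc (-(M : ℤ)) M).filter fun o : ℤ =>
      (1 - α) * M < 2 * |(o : ℝ)| ∧ 2 * |o| ≤ M with hS
  have hcard : ((Finset.range n).filter fun b : ℕ => inTransition B n M α (σ * (f - b) % n)).card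
      ≤ ((Finset.Ico (0 : ℤ) B) ×ˢ S).card := by
    refine Finset.card_le_card_of_injOn
      (fun b => ((σ * (f - b) % n) / M, binOffset M (σ * (f - b) % n))) ?_ ?_
    · intro b hb
      have h1 := (Finset.mem_filter.1 (Finset.mem_coe.1 hb)).2
      have hq0 : 0 ≤ σ * (f - b) % n := Int.emod_nonneg _ (by omega)
      have hq1 : σ * (f - b) % n < n := Int.emod_lt_of_pos _ (by omega)
      simp only [Finset.coe_product, Set.mem_prod, Finset.mem_coe, Finset.mem_Ico]
      generalize σ * (f - b) % n = q at *
      obtain ⟨h2, h3⟩ := binOffset_bounds (show (0 : ℤ) < M by omega) q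
      refine ⟨⟨Int.ediv_nonneg hq0 (by omega), ?_⟩, ?_⟩
      · rw [Int.ediv_lt_iff_lt_mul (by omega)]
        rw [hn] at hq1
        exact_mod_cast hq1
      · rw [hS, Finset.mem_filter, Finset.mem_Icc]
        refine ⟨by constructor <;> omega, ?_, by rcases abs_cases (binOffset M q) with h | h <;> omega⟩
        unfold inTransition at h1
        rw [not_le, hn] at h1
        push_cast at h1
        have hB' : (0 : ℝ) < B := by exact_mod_cast hB
        refine lt_of_mul_lt_mul_left ?_ hB'.le
        linarith
    · intro b hb b' hb' hbb
      simp only [Prod.mk.injEq] at hbb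
      have hbn := Finset.mem_range.1 (Finset.mem_filter.1 (Finset.mem_coe.1 hb)).1
      have hbn' := Finset.mem_range.1 (Finset.mem_filter.1 (Finset.mem_coe.1 hb')).1
      have h1 : (σ * (f - b) % n) % M = (σ * (f - b') % n) % M := by
        have h2 := hbb.2
        unfold binOffset at h2
        refine (Int.modEq_iff_dvd.2
          ⟨binIndex M (σ * (f - b') % n) - binIndex M (σ * (f - b) % n), ?_⟩ :
            (σ * (f - b) % n) ≡ (σ * (f - b') % n) [ZMOD M])
        linear_combination -h2
      have h3 : σ * (f - b) % n = σ * (f - b') % n := by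
        rw [← Int.mul_ediv_add_emod (σ * (f - b) % n) M, ← Int.mul_ediv_add_emod (σ * (f - b') % n) M,
          hbb.1, h1]
      have h4 := (show σ * (f - b) ≡ σ * (f - b') [ZMOD n] from h3).dvd
      rw [← mul_sub] at h4
      have h5 := hσ.dvd_of_dvd_mul_left h4
      have h6 : (n : ℤ) ∣ (b : ℤ) - b' := by simpa using h5
      have h7 : b' ≡ b [MOD n] := by
        rw [← Int.natCast_modEq_iff, Int.modEq_iff_dvd]; exact h6
      exact (Nat.ModEq.eq_of_lt_of_lt h7 hbn' hbn).symm
  have h2 := card_transition_offsets (M := M) hα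
  rw [Finset.card_product, Int.card_Ico] at hcard
  have h3 : (((Finset.range n).filter fun b : ℕ =>
      inTransition B n M α (σ * (f - b) % n)).card : ℝ) ≤ B * S.card := by
    have h4 : ((B : ℤ) - 0).toNat = B := by omega
    rw [h4] at hcard
    exact_mod_cast hcard
  calc _ ≤ (B : ℝ) * S.card := h3
    _ ≤ B * (α * M + 2) := by gcongr
    _ = α * n + 2 * B := by rw [hn]; push_cast; ring

/-- The bin of the coefficient `f` under the spectrum permutation `σ`, `b`. -/
def binOf (n B M : ℕ) (σ b f : ℤ) : ℤ := binIndex M (σ * (f - b) % n) % B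

open scoped Classical in
/-- The coefficients in `S` that collide with another one or are close to the border of their bin.
-/
noncomputable def badSet {n : ℕ} (B M : ℕ) (α : ℝ) (σ b : ℤ) (S : Finset (ZMod n)) :
    Finset (ZMod n) :=
  S.filter fun f => (∃ f' ∈ S, f' ≠ f ∧ binOf n B M σ b f.val = binOf n B M σ b f'.val) ∨
    inTransition B n M α (σ * (f.val - b) % n)

/-- The average number of bad coefficients over all spectrum permutations. -/
theorem sum_card_badSet_le {p : ℕ} (hp : 1 ≤ p) {B M : ℕ} (hn : 2 ^ p = B * M)
    {α : ℝ} (hα : 0 ≤ α) (S : Finset (ZMod (2 ^ p))) :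
    ∑ j ∈ Finset.range (2 ^ (p - 1)), ∑ b ∈ Finset.range (2 ^ p),
        ((badSet B M α (2 * (j : ℤ) + 1) b S).card : ℝ)
      ≤ (2 ^ (p - 1) * 2 ^ p) * (S.card * (4 * S.card / B + α + 2 / M)) := by
  classical
  have hM0 : 0 < M := by
    rcases Nat.eq_zero_or_pos M with h | h
    · subst h; simp at hn
    · exact h
  have hB0 : 0 < B := by
    rcases Nat.eq_zero_or_pos B with h | h
    · subst h; simp at hn
    · exact h
  obtain ⟨μ, -, hMμ⟩ := (Nat.dvd_prime_pow Nat.prime_two).1 (Dvd.intro_left B hn.symm)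
  have hnR : (2 ^ p : ℝ) = B * M := by exact_mod_cast hn
  have hpp : (2 ^ p : ℝ) = 2 * 2 ^ (p - 1) := by
    rw [← pow_succ']; congr 1; omega
  have hBR : (0 : ℝ) < B := by exact_mod_cast hB0
  have hMR : (0 : ℝ) < M := by exact_mod_cast hM0
  -- a bad coefficient is counted once for every other one it collides with
  have h1 : ∀ j b : ℕ, ((badSet B M α (2 * (j : ℤ) + 1) b S).card : ℝ) ≤
      ∑ f ∈ S, (∑ f' ∈ S.erase f,
        (if ∃ e : ℤ, |e| < M ∧ (2 * (j : ℤ) + 1) * ((f.val : ℤ) - f'.val) ≡ e [ZMOD (2 ^ p : ℕ)]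
          then (1 : ℝ) else 0)
        + if inTransition B (2 ^ p) M α ((2 * (j : ℤ) + 1) * (f.val - b) % (2 ^ p : ℕ))
          then 1 else 0) := by
    intro j b
    unfold badSet
    rw [Finset.card_filter]
    push_cast
    refine Finset.sum_le_sum fun f hf => ?_
    have hs : 0 ≤ ∑ f' ∈ S.erase f,
        (if ∃ e : ℤ, |e| < M ∧ (2 * (j : ℤ) + 1) * ((f.val : ℤ) - f'.val) ≡ e [ZMOD (2 ^ p : ℕ)]
          then (1 : ℝ) else 0) := Finset.sum_nonneg fun _ _ => by split_ifs <;> norm_num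
    have ht : (0 : ℝ) ≤ if inTransition B (2 ^ p) M α
        ((2 * (j : ℤ) + 1) * (f.val - b) % (2 ^ p : ℕ)) then 1 else 0 := by split_ifs <;> norm_num
    push_cast at hs ht ⊢
    split_ifs with h h' h'
    · linarith
    · rcases h with ⟨f', hf', hne, hbin⟩ | h
      · have h2 : (1 : ℝ) ≤ ∑ f' ∈ S.erase f, (if ∃ e : ℤ, |e| < M ∧
            (2 * (j : ℤ) + 1) * ((f.val : ℤ) - f'.val) ≡ e [ZMOD 2 ^ p] then (1 : ℝ) else 0) := by
          obtain ⟨e, he, hmod⟩ := binIndex_eq_imp (M := M) (B := B) (n := (2 ^ p : ℕ)) (by omega)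
            (by rw [hn]; push_cast; ring) hbin
          have h3 := Finset.single_le_sum (f := fun f' => (if ∃ e : ℤ, |e| < M ∧
            (2 * (j : ℤ) + 1) * ((f.val : ℤ) - f'.val) ≡ e [ZMOD 2 ^ p] then (1 : ℝ) else 0))
            (fun _ _ => by split_ifs <;> norm_num) (Finset.mem_erase.2 ⟨hne, hf'⟩)
          refine le_trans ?_ h3
          rw [if_pos]
          refine ⟨e, he, ?_⟩
          have h4 := (Int.mod_modEq ((2 * (j : ℤ) + 1) * (f.val - b)) (2 ^ p : ℕ)).symm.sub
            (Int.mod_modEq ((2 * (j : ℤ) + 1) * (f'.val - b)) (2 ^ p : ℕ)).symm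
          have h5 := h4.trans hmod
          push_cast at h5
          rw [show (2 * (j : ℤ) + 1) * ((f.val : ℤ) - f'.val)
            = (2 * (j : ℤ) + 1) * (f.val - b) - (2 * (j : ℤ) + 1) * (f'.val - b) by ring]
          exact h5
        linarith
      · exact absurd h h'
    · linarith
    · linarith
  have h2 : ∀ f f' : ZMod (2 ^ p), f' ≠ f → ∑ j ∈ Finset.range (2 ^ (p - 1)),
      (if ∃ e : ℤ, |e| < M ∧ (2 * (j : ℤ) + 1) * ((f.val : ℤ) - f'.val) ≡ e [ZMOD (2 ^ p : ℕ)]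
          then (1 : ℝ) else 0) ≤ 2 * M := by
    intro f f' hne
    have hD : ¬ ((2 ^ p : ℕ) : ℤ) ∣ (f.val : ℤ) - f'.val := by
      intro hd
      apply hne
      have : (f'.val : ℤ) ≡ f.val [ZMOD (2 ^ p : ℕ)] := Int.modEq_iff_dvd.2 hd
      rw [Int.natCast_modEq_iff] at this
      exact ZMod.val_injective _ (Nat.ModEq.eq_of_lt_of_lt this (ZMod.val_lt _) (ZMod.val_lt _))
    have := card_odd_mul_near_zero (μ := μ) hp hD
    rw [Finset.sum_boole, hMμ]
    exact_mod_cast this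
  have h3 : ∀ (f : ZMod (2 ^ p)) (j : ℕ), ∑ b ∈ Finset.range (2 ^ p),
      (if inTransition B (2 ^ p) M α ((2 * (j : ℤ) + 1) * (f.val - b) % (2 ^ p : ℕ))
          then (1 : ℝ) else 0) ≤ α * 2 ^ p + 2 * B := by
    intro f j
    rw [Finset.sum_boole]
    have := card_inTransition_le (n := 2 ^ p) hM0 hB0 hn hα (σ := 2 * (j : ℤ) + 1)
      (by push_cast; exact IsCoprime.pow_left ⟨-j, 1, by ring⟩) f.val
    push_cast at this ⊢
    exact this
  calc _ ≤ ∑ j ∈ Finset.range (2 ^ (p - 1)), ∑ b ∈ Finset.range (2 ^ p),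
      ∑ f ∈ S, (∑ f' ∈ S.erase f,
        (if ∃ e : ℤ, |e| < M ∧ (2 * (j : ℤ) + 1) * ((f.val : ℤ) - f'.val) ≡ e [ZMOD (2 ^ p : ℕ)]
          then (1 : ℝ) else 0)
        + if inTransition B (2 ^ p) M α ((2 * (j : ℤ) + 1) * (f.val - b) % (2 ^ p : ℕ))
          then 1 else 0) := Finset.sum_le_sum fun j _ => Finset.sum_le_sum fun b _ => h1 j b
    _ = ∑ f ∈ S, ((2 ^ p : ℝ) * ∑ f' ∈ S.erase f, ∑ j ∈ Finset.range (2 ^ (p - 1)),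
        (if ∃ e : ℤ, |e| < M ∧ (2 * (j : ℤ) + 1) * ((f.val : ℤ) - f'.val) ≡ e [ZMOD (2 ^ p : ℕ)]
          then (1 : ℝ) else 0) + ∑ j ∈ Finset.range (2 ^ (p - 1)), ∑ b ∈ Finset.range (2 ^ p),
        if inTransition B (2 ^ p) M α ((2 * (j : ℤ) + 1) * (f.val - b) % (2 ^ p : ℕ))
          then 1 else 0) := by
      rw [Finset.sum_congr rfl fun j _ => Finset.sum_comm, Finset.sum_comm]
      refine Finset.sum_congr rfl fun f _ => ?_
      simp_rw [Finset.sum_add_distrib]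
      congr 1
      simp only [Finset.sum_const, Finset.card_range, nsmul_eq_mul]
      rw [← Finset.mul_sum, Finset.sum_comm]
      push_cast
      rfl
    _ ≤ ∑ f ∈ S, ((2 ^ p : ℝ) * ∑ f' ∈ S.erase f, (2 * M : ℝ)
        + ∑ j ∈ Finset.range (2 ^ (p - 1)), (α * 2 ^ p + 2 * B)) := by
      refine Finset.sum_le_sum fun f _ => add_le_add ?_ (Finset.sum_le_sum fun j _ => h3 f j)
      gcongr with f' hf'
      exact h2 f f' (Finset.ne_of_mem_erase hf')
    _ ≤ ∑ f ∈ S, ((2 ^ p : ℝ) * (S.card * (2 * M)) + 2 ^ (p - 1) * (α * 2 ^ p + 2 * B)) := by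
      refine Finset.sum_le_sum fun f _ => ?_
      simp only [Finset.sum_const, Finset.card_range, nsmul_eq_mul]
      push_cast
      gcongr
      exact Finset.erase_subset _ _
    _ = _ := by
      simp only [Finset.sum_const, nsmul_eq_mul]
      have h4 : (2 * B : ℝ) = 2 ^ p * (2 / M) := by rw [hnR]; field_simp
      have h5 : (2 ^ p : ℝ) * (2 * M) = 2 ^ (p - 1) * 2 ^ p * (4 / B) := by
        rw [show (2 ^ (p - 1) * 2 ^ p * (4 / B) : ℝ) = 2 ^ p * (2 * (2 * 2 ^ (p - 1)) / B) by ring,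
          ← hpp, hnR]
        field_simp
      rw [h4]
      linear_combination (S.card : ℝ) ^ 2 * h5

/-- Every coefficient that is still wrong after a round is a bad one, or has been overwritten on
behalf of a bin that contains only bad ones. -/
theorem card_residual_le {ι : Type*} [Fintype ι] [DecidableEq ι] {r r' : ι → ℤ} {bin : ι → ℤ}
    {active : ℤ → Prop} {target : ℤ → ι} {val : ℤ → ℤ} {J : Set ℤ} {bad : Finset ι}
    (h1 : ∀ i, (∃ j ∈ J, active j ∧ target j = i ∧ r' i = r i - val j) ∨
      ((∀ j ∈ J, active j → target j ≠ i) ∧ r' i = r i))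
    (h2 : ∀ j ∈ J, active j → ∃ f, r f ≠ 0 ∧ bin f = j)
    (h3 : ∀ f, r f ≠ 0 → f ∉ bad →
      bin f ∈ J ∧ active (bin f) ∧ target (bin f) = f ∧ val (bin f) = r f) :
    (Finset.univ.filter fun i => r' i ≠ 0).card ≤ 2 * bad.card := by
  have hsub : (Finset.univ.filter fun i => r' i ≠ 0) ⊆ bad ∪ bad.image fun f => target (bin f) := by
    intro i hi
    have hi' : r' i ≠ 0 := (Finset.mem_filter.1 hi).2
    rcases h1 i with ⟨j, hj, ha, ht, hr⟩ | ⟨hno, hr⟩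
    · obtain ⟨f, hf, hfj⟩ := h2 j hj ha
      by_cases hfb : f ∈ bad
      · exact Finset.mem_union_right _ (Finset.mem_image.2 ⟨f, hfb, by rw [hfj, ht]⟩)
      · obtain ⟨-, -, h4, h5⟩ := h3 f hf hfb
        rw [hfj] at h4 h5
        rw [ht] at h4
        subst h4
        exact absurd (by rw [hr, h5, sub_self]) hi'
    · by_cases hib : i ∈ bad
      · exact Finset.mem_union_left _ hib
      · obtain ⟨h4, h5, h6, -⟩ := h3 i (hr ▸ hi') hib
        exact absurd h6 (hno _ h4 h5)
  calc _ ≤ _ := Finset.card_le_card hsub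
    _ ≤ _ := Finset.card_union_le _ _
    _ ≤ bad.card + bad.card := Nat.add_le_add_left Finset.card_image_le _
    _ = _ := by ring

end Counting

/-! ### The window as a program -/

section Programs

open scoped Nat

@[simp] theorem cpxVal_rootE (s : State Name) (a b : IExpr) :
    cpxVal s (rootE a b) = root (intVal s a) (intVal s b) := by
  rw [cpxVal_cis]
  simp [root]

theorem exec_windowTime (s : State Name) : (windowTime.exec s).realReg .g
    = √(s.intReg .n) * smoothedBox (1 / s.realReg .tau ^ 2) (s.realReg .C) (s.intReg .i) := by
  unfold windowTime smoothedBox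
  simp
  split_ifs with h
  · simp
  · simp
    rw [mul_assoc, mul_div_assoc]
    congr 4
    ring

/-- The loop that sums the series of the Gaussian distribution function. -/
theorem exec_seriesLoop (s : State Name) {N : ℕ} {y : ℝ} (hN : s.intReg .N = N)
    (hy : s.realReg .y = y) (ht : s.realReg .term = y) (hs : s.realReg .ser = y) :
    ((Stmt.loop .r (int .N) (
         .term ≔ real .term * (real .y * real .y) / toR (2 * int .r + 3) ;;
         .ser ≔ real .ser + real .term)).exec s).realReg .ser = oddSeries N y := by
  have h := exec_loop_induct (v := .r) (e := int .N) (s := s) (body := (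
         .term ≔ real .term * (real .y * real .y) / toR (2 * int .r + 3) ;;
         .ser ≔ real .ser + real .term))
    (fun j s' => s'.realReg .y = y ∧ s'.realReg .term = y ^ (2 * j + 1) / ((2 * j + 1)‼ : ℝ) ∧
      s'.realReg .ser = oddSeries j y) (by simp [hy, ht, hs, oddSeries]) (by
      rintro j - s' ⟨h1, h2, h3⟩
      have h4 : y ^ (2 * j + 1) / ((2 * j + 1)‼ : ℝ) * (y * y) / (2 * j + 3)
          = y ^ (2 * (j + 1) + 1) / ((2 * (j + 1) + 1)‼ : ℝ) := by
        rw [show 2 * (j + 1) + 1 = 2 * j + 1 + 2 by ring, Nat.doubleFactorial_add_two]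
        have : ((2 * j + 1)‼ : ℝ) ≠ 0 := by exact_mod_cast (Nat.doubleFactorial_pos _).ne'
        push_cast
        field_simp
        ring
      simp [h1, h2, h3, h4, oddSeries, Finset.sum_range_succ _ (j + 1)])
  simp only [intVal_reg, hN, Int.toNat_natCast] at h
  exact h.2.2

theorem exec_windowFrequency (s : State Name) {B n N : ℕ} (hn : 0 < n) (hB : s.intReg .B = B)
    (hn' : s.intReg .n = n) (hN : s.intReg .N = N) : (windowFrequency.exec s).realReg .g
    = windowFreq B (s.realReg .alpha) (s.realReg .tau) (s.realReg .C) N (s.intReg .o / n) := by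
  have hnR : (0 : ℝ) < n := by exact_mod_cast hn
  have habs : |(s.intReg .o / n : ℝ)| = |(s.intReg .o : ℝ)| / n := by
    rw [abs_div, abs_of_pos hnR]
  have h1 : (2 * (B : ℝ) * |(s.intReg .o / n : ℝ)| ≤ 1 - s.realReg .alpha)
      ↔ 2 * (B : ℝ) * |(s.intReg .o : ℝ)| ≤ (1 - s.realReg .alpha) * n := by
    rw [habs, ← mul_div_assoc, div_le_iff₀ hnR]
  have h2 : (1 ≤ 2 * (B : ℝ) * |(s.intReg .o / n : ℝ)|)
      ↔ (n : ℤ) ≤ 2 * B * |s.intReg .o| := by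
    rw [habs, ← mul_div_assoc, le_div_iff₀ hnR, one_mul]
    exact_mod_cast Iff.rfl
  unfold windowFrequency windowFreq
  rw [exec_ifElse, exec_ifElse]
  simp only [h1, h2, holds_leReal, holds_leInt, realVal_toR, intVal_mul, intVal_two, intVal_reg,
    intVal_abs, realVal_mul, realVal_sub, realVal_one, realVal_reg, hB, hn', Int.cast_mul,
    Int.cast_ofNat, Int.cast_natCast, Int.cast_abs]
  split_ifs
  · simp
  · simp
  · rw [exec_seq, exec_seq, exec_seq, exec_seq]
    set s₁ := (Name.ser ≔ real Name.y).exec ((Name.term ≔ real Name.y).exec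
      ((Name.y ≔ real Name.tau * (real Name.C - toR (absE (int Name.o)) / toR (int Name.n))).exec s))
      with hs₁
    have h3 : s₁.realReg .y = s.realReg .tau * (s.realReg .C - |(s.intReg .o / n : ℝ)|) := by
      simp [hs₁, habs, hn']
    have h4 := exec_seriesLoop s₁ (N := N) (y := s₁.realReg .y) (by simp [hs₁, hN]) rfl
      (by simp [hs₁]) (by simp [hs₁])
    set s₂ := (Stmt.loop .r (int .N) (
         .term ≔ real .term * (real .y * real .y) / toR (2 * int .r + 3) ;;
         .ser ≔ real .ser + real .term)).exec s₁ with hs₂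
    have h5 : s₂.realReg .y = s₁.realReg .y := exec_realReg _ _ _ (by decide)
    simp only [exec_setReal, realReg_setReal, if_true, realVal_add, realVal_div, realVal_one,
      realVal_two, realVal_mul, realVal_exp, realVal_sqrt, realVal_pi, realVal_sub, realVal_zero,
      realVal_reg, h4, h5, ← h3]
    ring_nf

open scoped Classical in
/-- Evaluating the window takes more than constant time only in the transition region. -/
theorem steps_windowFrequency_le (s : State Name) {B n N : ℕ} {M : ℕ} (hB : s.intReg .B = B)
    (hn' : s.intReg .n = n) (hN : s.intReg .N = N) {q : ℤ} (ho : s.intReg .o = binOffset M q) :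
    windowFrequency.steps s
      ≤ 100 + if inTransition B n M (s.realReg .alpha) q then 30 * N else 0 := by
  unfold windowFrequency
  rw [Stmt.steps]
  have h0 : (Cond.leReal (toR (2 * int .B * absE (int .o))) ((1 - real .alpha) * toR (int .n))).holds s
      ↔ ¬ inTransition B n M (s.realReg .alpha) q := by
    simp [inTransition, hB, hn', ho]
  have hc : (Cond.leReal (toR (2 * int .B * absE (int .o)))
      ((1 - real .alpha) * toR (int .n))).cost ≤ 20 := by decide
  rw [if_congr h0 rfl rfl, ite_not]
  split_ifs with h
  · rw [Stmt.steps]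
    have hc' : (Cond.leInt (int .n) (2 * int .B * absE (int .o))).cost ≤ 20 := by decide
    split_ifs
    · have h1 : (Name.g ≔ (0 : RExpr)).steps s ≤ 10 := Stmt.steps_le _ rfl (by decide)
      omega
    · rw [steps_seq, steps_seq, steps_seq, steps_seq]
      set s₁ := (Name.ser ≔ real Name.y).exec ((Name.term ≔ real Name.y).exec
        ((Name.y ≔ real Name.tau * (real Name.C - toR (absE (int Name.o)) / toR (int Name.n))).exec s))
        with hs₁
      have h1 := Stmt.steps_simpleLoop_le (x := .r) (e := int .N) (s := s₁) (body := (
         .term ≔ real .term * (real .y * real .y) / toR (2 * int .r + 3) ;;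
         .ser ≔ real .ser + real .term)) 30 N rfl (by
          have : intVal s₁ (int .N) = N := by simp [hs₁, hN]
          exact this) (by decide)
      have h2 : (Name.y ≔ real Name.tau * (real Name.C
        - toR (absE (int Name.o)) / toR (int Name.n))).steps s ≤ 12 := Stmt.steps_le _ rfl (by decide)
      have h3 : ∀ s', (Name.term ≔ real .y).steps s' ≤ 2 := fun s' => Stmt.steps_le _ rfl (by decide)
      have h4 : ∀ s', (Name.ser ≔ real .y).steps s' ≤ 2 := fun s' => Stmt.steps_le _ rfl (by decide)
      have h5 : ∀ s', (Name.g ≔ 1 / 2 + expE (0 - real .y * real .y / 2) / sqrtE (2 * .pi)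
        * real .ser).steps s' ≤ 30 := fun s' => Stmt.steps_le _ rfl (by decide)
      have h6 : (int Name.N).cost = 1 := rfl
      have := h3 ((Name.y ≔ real Name.tau * (real Name.C
        - toR (absE (int Name.o)) / toR (int Name.n))).exec s)
      have := h4 ((Name.term ≔ real Name.y).exec
        ((Name.y ≔ real Name.tau * (real Name.C - toR (absE (int Name.o)) / toR (int Name.n))).exec s))
      have := h5 ((Stmt.loop .r (int .N) (
         .term ≔ real .term * (real .y * real .y) / toR (2 * int .r + 3) ;;
         .ser ≔ real .ser + real .term)).exec s₁)
      omega
  · have h1 : (Name.g ≔ (1 : RExpr)).steps s ≤ 10 := Stmt.steps_le _ rfl (by decide)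
    omega

/-- The program computes the least power of two that is at least `s.intReg v`. -/
theorem exec_powerOfTwoAbove {pow lg v : Name} (h1 : pow ≠ lg) (h2 : pow ≠ .i) (h3 : lg ≠ .i)
    (h4 : v ≠ pow) (h5 : v ≠ lg) (h6 : v ≠ .i) (s : State Name) {e : ℕ} (he : 0 < e)
    (hv : s.intReg v = e) : ∃ l : ℕ,
      ((powerOfTwoAbove pow lg (int v)).exec s).intReg pow = 2 ^ l ∧
      ((powerOfTwoAbove pow lg (int v)).exec s).intReg lg = l ∧ e ≤ 2 ^ l ∧ 2 ^ l < 2 * e := by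
  unfold powerOfTwoAbove
  rw [exec_seq, exec_seq]
  set s₁ := (lg ≔ (0 : IExpr)).exec ((pow ≔ (1 : IExpr)).exec s) with hs₁
  have h := exec_loop_induct (v := .i) (e := int v) (s := s₁) (body := (
      .ifThen (.ltInt (int pow) (int v)) (pow ≔ 2 * int pow ;; lg ≔ int lg + 1)))
    (fun j s' => s'.intReg v = e ∧ ∃ l : ℕ, s'.intReg pow = 2 ^ l ∧ s'.intReg lg = l ∧
      (e ≤ 2 ^ l ∨ l = j) ∧ 2 ^ l < 2 * e)
    ⟨by simp [hs₁, h4, h5, hv], 0, by simp [hs₁, h1], by simp [hs₁], Or.inr rfl, by omega⟩ (by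
      rintro j - s' ⟨h7, l, h8, h9, h10, h11⟩
      simp only [exec_ifThen, holds_ltInt, intVal_reg, intReg_setInt, h2, h6, if_false, h7, h8]
      split_ifs with h12
      · have h13 : 2 ^ l < e := by exact_mod_cast h12
        refine ⟨by simp [h4, h5, h6, h7], l + 1, ?_, ?_, ?_, ?_⟩
        · simp [h1, h2, h8, pow_succ]; ring
        · simp [h1.symm, h3, h9]
        · right; rcases h10 with h | h <;> omega
        · rw [pow_succ]; omega
      · have h13 : e ≤ 2 ^ l := by rw [not_lt] at h12; exact_mod_cast h12
        exact ⟨by simp [h6, h7], l, by simp [h2, h8], by simp [h3, h9], Or.inl h13, h11⟩)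
  have h7 : intVal s₁ (int v) = e := by simp [hs₁, h4, h5, hv]
  rw [h7, Int.toNat_natCast] at h
  obtain ⟨-, l, h8, h9, h10, h11⟩ := h
  refine ⟨l, h8, h9, ?_, h11⟩
  rcases h10 with h | h
  · exact h
  · subst h; exact Nat.lt_two_pow_self.le

theorem steps_powerOfTwoAbove_le {pow lg v : Name} (h4 : v ≠ pow) (h5 : v ≠ lg) (s : State Name)
    {e : ℕ} (hv : s.intReg v = e) :
    (powerOfTwoAbove pow lg (int v)).steps s ≤ 10 + e * 20 := by
  unfold powerOfTwoAbove
  rw [steps_seq, steps_seq]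
  have h1 : (pow ≔ (1 : IExpr)).steps s ≤ 2 := le_rfl
  have h2 : (lg ≔ (0 : IExpr)).steps ((pow ≔ (1 : IExpr)).exec s) ≤ 2 := le_rfl
  have h3 := Stmt.steps_simpleLoop_le (x := .i) (e := int v)
    (s := (lg ≔ (0 : IExpr)).exec ((pow ≔ (1 : IExpr)).exec s)) (body := (
      .ifThen (.ltInt (int pow) (int v)) (pow ≔ 2 * int pow ;; lg ≔ int lg + 1))) 20 e rfl (by
        have : intVal ((lg ≔ (0 : IExpr)).exec ((pow ≔ (1 : IExpr)).exec s)) (int v) = e := by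
          simp [h4, h5, hv]
        exact this) (by
          change 12 + 1 ≤ 20
          omega)
  have h6 : (int v).cost = 1 := rfl
  omega

end Programs

/-! ### The fast Fourier transform -/

section FFT

theorem sum_range_two_mul (m : ℕ) (F : ℕ → ℂ) :
    ∑ q ∈ Finset.range (2 * m), F q = ∑ q ∈ Finset.range m, (F (2 * q) + F (2 * q + 1)) := by
  induction m with
  | zero => simp
  | succ m ih =>
    rw [show 2 * (m + 1) = 2 * m + 1 + 1 by ring, Finset.sum_range_succ, Finset.sum_range_succ, ih,
      Finset.sum_range_succ]
    ring

/-- The transform of length `Q` of the entries of `f` at the positions `row + q * w`. -/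
noncomputable def stridedDFT (f : ℤ → ℂ) (Q w : ℕ) (row col : ℤ) : ℂ :=
  ∑ q ∈ Finset.range Q, root (col * q) Q * f (row + q * w)

theorem stridedDFT_emod (f : ℤ → ℂ) {Q : ℕ} (hQ : 0 < Q) (w : ℕ) (row col : ℤ) :
    stridedDFT f Q w row (col % Q) = stridedDFT f Q w row col := by
  unfold stridedDFT
  refine Finset.sum_congr rfl fun q _ => ?_
  rw [root_congr (by omega : (Q : ℤ) ≠ 0) ((Int.mod_modEq col Q).mul_right q)]

/-- One step of the decimation in time: the sum is split into its even and odd terms. -/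
theorem stridedDFT_butterfly (f : ℤ → ℂ) {Q : ℕ} (hQ : 0 < Q) (w : ℕ) (row col : ℤ) :
    stridedDFT f (2 * Q) w row col
      = stridedDFT f Q (2 * w) row (col % Q)
        + root col (2 * Q) * stridedDFT f Q (2 * w) (row + w) (col % Q) := by
  rw [stridedDFT_emod f hQ, stridedDFT_emod f hQ]
  unfold stridedDFT
  rw [sum_range_two_mul, Finset.sum_add_distrib, Finset.mul_sum]
  have h : ∀ q : ℕ, root (col * (2 * q : ℕ)) (2 * Q : ℕ) = root (col * q) Q := by
    intro q
    rw [← root_mul_left (col * q) Q (by norm_num : (2 : ℤ) ≠ 0)]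
    push_cast
    congr 1
    ring
  congr 1
  · refine Finset.sum_congr rfl fun q _ => ?_
    rw [h]
    push_cast
    ring_nf
  · refine Finset.sum_congr rfl fun q _ => ?_
    rw [show col * ((2 * q + 1 : ℕ) : ℤ) = col + col * (2 * q : ℕ) by push_cast; ring, root_add, h]
    push_cast
    ring_nf

/-- One pass over the array doubles the length `Q` of the transforms it holds and halves their
number. -/
theorem exec_fft_stage {v : Name} (hv : v ≠ .tmp) (s : State Name) (f : ℤ → ℂ) {Q w : ℕ}
    (hQ : 0 < Q) (hw : 0 < w) (hsQ : s.intReg .Q = Q) (hsB : s.intReg .B = 2 * Q * w)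
    (hs : ∀ row col : ℤ, 0 ≤ row → row < 2 * w → 0 ≤ col → col < Q →
      s.cpxArr v (row * Q + col) = stridedDFT f Q (2 * w) row col) :
    ∀ row col : ℤ, 0 ≤ row → row < w → 0 ≤ col → col < 2 * Q →
      (Stmt.exec (.loop .l (int .B) (
      .col ≔ int .l % (2 * int .Q) ;;
      .row ≔ int .l / (2 * int .Q) ;;
      .store .tmp (int .l)
        (cpxAt v (int .row * int .Q + int .col % int .Q)
          + rootE (int .col) (2 * int .Q)
            * cpxAt v ((int .row + int .B / (2 * int .Q)) * int .Q + int .col % int .Q))) ;;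
    .loop .l (int .B) (.store v (int .l) (cpxAt .tmp (int .l)))) s).cpxArr v
        (row * (2 * Q) + col) = stridedDFT f (2 * Q) w row col := by
  rw [exec_seq]
  have h1 := exec_loop_induct (v := .l) (e := int .B) (s := s) (body := (
      .col ≔ int .l % (2 * int .Q) ;;
      .row ≔ int .l / (2 * int .Q) ;;
      .store .tmp (int .l)
        (cpxAt v (int .row * int .Q + int .col % int .Q)
          + rootE (int .col) (2 * int .Q)
            * cpxAt v ((int .row + int .B / (2 * int .Q)) * int .Q + int .col % int .Q))))
    (fun j s' => s'.intReg .Q = Q ∧ s'.intReg .B = 2 * Q * w ∧ s'.cpxArr v = s.cpxArr v ∧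
      ∀ l : ℤ, 0 ≤ l → l < j →
        s'.cpxArr .tmp l = stridedDFT f (2 * Q) w (l / (2 * Q)) (l % (2 * Q)))
    ⟨hsQ, hsB, rfl, fun l h0 h1 => by push_cast at h1; omega⟩ (by
      rintro j hj s' ⟨h1, h2, h3, h4⟩
      rw [intVal_reg, hsB] at hj
      refine ⟨by simp [h1], by simp [h2], by simp [hv, h3], fun l hl0 hl => ?_⟩
      simp only [exec_seq, exec_setInt, exec_storeCpx, cpxArr_storeCpx, if_true,
        Function.update_apply]
      simp [h1, h2, h3]
      rcases eq_or_ne l j with hlj | hlj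
      · subst hlj
        rw [if_pos rfl, stridedDFT_butterfly f hQ]
        have hQ0 : (0 : ℤ) < 2 * Q := by omega
        have h5 : (2 * Q * w : ℤ) / (2 * Q) = w := Int.mul_ediv_cancel_left _ hQ0.ne'
        have h6 : (j : ℤ) / (2 * Q) < w := by
          rw [Int.ediv_lt_iff_lt_mul hQ0]; linarith
        have h7 : 0 ≤ (j : ℤ) / (2 * Q) := Int.ediv_nonneg (by omega) hQ0.le
        have h8 := Int.emod_nonneg ((j : ℤ) % (2 * Q)) (by omega : (Q : ℤ) ≠ 0)
        have h9 := Int.emod_lt_of_pos ((j : ℤ) % (2 * Q)) (by omega : 0 < (Q : ℤ))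
        have h10 : (j : ℤ) % (2 * Q) % Q = j % Q := Int.emod_emod_of_dvd _ (Dvd.intro_left 2 rfl)
        rw [h10] at h8 h9 ⊢
        rw [h5, hs _ _ h7 (by linarith) h8 h9, hs _ _ (by omega) (by omega) h8 h9]
      · rw [if_neg hlj]
        exact h4 l hl0 (by push_cast at hl; omega))
  set s₁ := (Stmt.loop .l (int .B) _).exec s with hs₁
  obtain ⟨h2, h3, h4, h5⟩ := h1
  rw [intVal_reg, hsB] at h5
  have h6 := exec_loop_induct (v := .l) (e := int .B) (s := s₁) (body := (
      .store v (int .l) (cpxAt .tmp (int .l))))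
    (fun j s' => s'.cpxArr .tmp = s₁.cpxArr .tmp ∧
      ∀ l : ℤ, 0 ≤ l → l < j → s'.cpxArr v l = s₁.cpxArr .tmp l)
    ⟨rfl, fun l h0 h1 => by push_cast at h1; omega⟩ (by
      rintro j - s' ⟨h7, h8⟩
      refine ⟨by simp [hv.symm, h7], fun l hl0 hl => ?_⟩
      simp [Function.update_apply, h7]
      split_ifs with hlj
      · rw [hlj]
      · exact h8 l hl0 (by push_cast at hl; omega))
  rw [intVal_reg, h3] at h6
  intro row col hr0 hr hc0 hc
  have hlt : row * (2 * Q) + col < 2 * Q * w := by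
    have : (row + 1) * (2 * Q) ≤ w * (2 * Q) := by gcongr; omega
    linarith
  have hnn : 0 ≤ row * (2 * Q) + col := by positivity
  have hlt' : row * (2 * Q) + col < ((2 * Q * w : ℤ).toNat : ℤ) := by omega
  rw [h6.2 _ hnn hlt', h5 _ hnn hlt']
  congr 1
  · rw [add_comm, Int.add_mul_ediv_right _ _ (by omega), Int.ediv_eq_zero_of_lt hc0 hc, zero_add]
  · rw [add_comm, Int.add_mul_emod_self_right, Int.emod_eq_of_lt hc0 hc]

theorem exec_fft {v : Name} (hv : v ≠ .tmp) (s : State Name) {e : ℕ} (hB : s.intReg .B = 2 ^ e)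
    (he : s.intReg .logB = e) {j : ℤ} (hj0 : 0 ≤ j) (hj : j < 2 ^ e) :
    ((fft v).exec s).cpxArr v j
      = ∑ q ∈ Finset.range (2 ^ e), root (j * q) (2 ^ e : ℕ) * s.cpxArr v q := by
  unfold fft
  rw [exec_seq]
  set s₁ := (Name.Q ≔ (1 : IExpr)).exec s with hs₁
  have h := exec_loop_induct (v := .s) (e := int .logB) (s := s₁) (body := (
    .loop .l (int .B) (
      .col ≔ int .l % (2 * int .Q) ;;
      .row ≔ int .l / (2 * int .Q) ;;
      .store .tmp (int .l)
        (cpxAt v (int .row * int .Q + int .col % int .Q)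
          + rootE (int .col) (2 * int .Q)
            * cpxAt v ((int .row + int .B / (2 * int .Q)) * int .Q + int .col % int .Q))) ;;
    .loop .l (int .B) (.store v (int .l) (cpxAt .tmp (int .l))) ;;
    .Q ≔ 2 * int .Q))
    (fun t s' => s'.intReg .Q = (2 ^ t : ℕ) ∧ s'.intReg .B = 2 ^ e ∧
      ∀ row col : ℤ, 0 ≤ row → row < (2 ^ (e - t) : ℕ) → 0 ≤ col → col < (2 ^ t : ℕ) →
        s'.cpxArr v (row * (2 ^ t : ℕ) + col)
          = stridedDFT (s.cpxArr v) (2 ^ t) (2 ^ (e - t)) row col)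
    (by
      refine ⟨by simp [hs₁], by simp [hs₁, hB], fun row col _ _ hc0 hc => ?_⟩
      have : col = 0 := by push_cast at hc; omega
      subst this
      simp [hs₁, stridedDFT])
    (by
      rintro t ht s' ⟨h1, h2, h3⟩
      have ht' : t < e := by
        have : intVal s₁ (int .logB) = e := by simp [hs₁, he]
        rw [this] at ht
        exact_mod_cast ht
      have h4 : e - t = (e - (t + 1)) + 1 := by omega
      have h5 : 2 ^ (e - t) = 2 * 2 ^ (e - (t + 1)) := by rw [h4, pow_succ']
      have h6 : (2 : ℤ) ^ e = 2 * (2 ^ t : ℕ) * (2 ^ (e - (t + 1)) : ℕ) := by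
        push_cast
        rw [mul_assoc, mul_left_comm, ← pow_succ', ← h4, ← pow_add]
        congr 1; omega
      have h7 := exec_fft_stage hv (s'.setInt .s t) (s.cpxArr v) (Q := 2 ^ t)
        (w := 2 ^ (e - (t + 1))) (by positivity) (by positivity) (by simp [h1]) (by
          rw [← h6]; simp [h2]) (by
          rw [h5] at h3
          intro row col hr0 hr hc0 hc
          rw [cpxArr_setInt]
          exact h3 row col hr0 (by push_cast at hr ⊢; exact hr) hc0 hc)
      refine ⟨?_, ?_, ?_⟩
      · rw [exec_seq, exec_seq, exec_setInt, intReg_setInt, if_pos rfl, intVal_mul, intVal_two,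
          intVal_reg, exec_intReg _ _ _ (by rfl), exec_intReg _ _ _ (by rfl), intReg_setInt,
          if_neg (by decide), h1, pow_succ']
        push_cast; rfl
      · rw [exec_intReg _ _ _ (by rfl), intReg_setInt, if_neg (by decide), h2]
      · intro row col hr0 hr hc0 hc
        have h8 := h7 row col hr0 hr hc0 (by rw [pow_succ'] at hc; push_cast at hc ⊢; exact hc)
        rw [exec_seq] at h8 ⊢
        rw [exec_seq, exec_setInt, cpxArr_setInt, pow_succ']
        push_cast at h8 ⊢
        exact h8)
  have h1 : intVal s₁ (int .logB) = e := by simp [hs₁, he]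
  rw [h1, Int.toNat_natCast] at h
  obtain ⟨-, -, h2⟩ := h
  have h3 := h2 0 j le_rfl (by simp) hj0 (by push_cast; exact hj)
  rw [zero_mul, zero_add] at h3
  rw [h3]
  unfold stridedDFT
  simp

theorem steps_fft_le (v : Name) (s : State Name) {B e : ℕ} (hB : s.intReg .B = B)
    (he : s.intReg .logB = e) : ((fft v).steps s) ≤ 10 + e * (80 * B + 20) := by
  unfold fft
  rw [steps_seq]
  set s₁ := (Name.Q ≔ (1 : IExpr)).exec s with hs₁
  have h := steps_loop_le_sum (v := .s) (e := int .logB) (s := s₁) (body := (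
    .loop .l (int .B) (
      .col ≔ int .l % (2 * int .Q) ;;
      .row ≔ int .l / (2 * int .Q) ;;
      .store .tmp (int .l)
        (cpxAt v (int .row * int .Q + int .col % int .Q)
          + rootE (int .col) (2 * int .Q)
            * cpxAt v ((int .row + int .B / (2 * int .Q)) * int .Q + int .col % int .Q))) ;;
    .loop .l (int .B) (.store v (int .l) (cpxAt .tmp (int .l))) ;;
    .Q ≔ 2 * int .Q))
    (fun t s' => s'.intReg .B = B) (by simp [hs₁, hB]) (by
      intro t _ s' h1
      rw [exec_intReg _ _ _ (by rfl), intReg_setInt, if_neg (by decide), h1])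
    (fun _ => 80 * B + 19) (by
      intro t _ s' h1
      rw [steps_seq, steps_seq]
      have h2 := Stmt.steps_simpleLoop_le (x := .l) (e := int .B) (s := s'.setInt .s t) (body := (
        .col ≔ int .l % (2 * int .Q) ;;
        .row ≔ int .l / (2 * int .Q) ;;
        .store .tmp (int .l)
        (cpxAt v (int .row * int .Q + int .col % int .Q)
          + rootE (int .col) (2 * int .Q)
            * cpxAt v ((int .row + int .B / (2 * int .Q)) * int .Q + int .col % int .Q))))
        60 B rfl (by
          have : intVal (s'.setInt .s t) (int .B) = B := by simp [h1]
          exact this) (Nat.le_of_ble_eq_true rfl)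
      set s₂ := (Stmt.loop .l (int .B) (
        .col ≔ int .l % (2 * int .Q) ;;
        .row ≔ int .l / (2 * int .Q) ;;
        .store .tmp (int .l)
        (cpxAt v (int .row * int .Q + int .col % int .Q)
          + rootE (int .col) (2 * int .Q)
            * cpxAt v ((int .row + int .B / (2 * int .Q)) * int .Q + int .col % int .Q)))).exec
        (s'.setInt .s t) with hs₂
      have h3 : s₂.intReg .B = B := by
        rw [hs₂, exec_intReg _ _ _ (by rfl), intReg_setInt, if_neg (by decide), h1]
      have h4 := Stmt.steps_simpleLoop_le (x := .l) (e := int .B) (s := s₂) (body :=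
        (.store v (int .l) (cpxAt .tmp (int .l)))) 10 B rfl h3 (Nat.le_of_ble_eq_true rfl)
      have h5 : ∀ s', (Name.Q ≔ 2 * int .Q).steps s' ≤ 4 := fun s' => le_rfl
      have h6 := h5 ((Stmt.loop .l (int .B) (.store v (int .l) (cpxAt .tmp (int .l)))).exec s₂)
      have h7 : (int Name.B).cost = 1 := rfl
      omega)
  have h1 : intVal s₁ (int .logB) = e := by simp [hs₁, he]
  rw [h1, Int.toNat_natCast, Finset.sum_const, Finset.card_range, smul_eq_mul] at h
  have h2 : (Name.Q ≔ (1 : IExpr)).steps s = 2 := rfl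
  have h3 : (int Name.logB).cost = 1 := rfl
  have h4 : e * (1 + (80 * B + 19)) = e * (80 * B + 20) := by ring
  omega

end FFT

/-! ### Hashing to bins as a program -/

section Hashing

/-- The part of the memory that the hashing procedure reads: the parameters of the window and of the
spectrum permutation, the signal `x`, and the list `zl` of length `Z` of the indices where the known
part `zh` of the spectrum is stored. -/
structure HashEnv (n B M e N Z : ℕ) (σ b R : ℤ) (α τ C : ℝ) (x : ZMod n → ℂ) (zl zh : ℤ → ℤ)
    (s : State Name) : Prop where
  n_eq : s.intReg .n = n
  B_eq : s.intReg .B = B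
  M_eq : s.intReg .M = M
  logB_eq : s.intReg .logB = e
  N_eq : s.intReg .N = N
  zcnt_eq : s.intReg .zcnt = Z
  sigma_eq : s.intReg .sigma = σ
  b_eq : s.intReg .b = b
  R_eq : s.intReg .R = R
  alpha_eq : s.realReg .alpha = α
  tau_eq : s.realReg .tau = τ
  C_eq : s.realReg .C = C
  x_eq : ∀ j : ℤ, 0 ≤ j → j < n → s.cpxArr .x j = x (j : ZMod n)
  zlist_eq : s.intArr .zlist = zl
  zhat_eq : s.intArr .zhat = zh

/-- Whether a statement leaves the part of the memory described by `HashEnv` unchanged. -/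
def Stmt.keepsHashEnv (st : Stmt Name) : Bool :=
  ([Name.n, .B, .M, .logB, .N, .zcnt, .sigma, .b, .R].all fun v => !st.writesReg .int v) &&
  ([Name.alpha, .tau, .C].all fun v => !st.writesReg .real v) &&
  ([Name.zlist, .zhat].all fun v => !st.writesArr .int v) && !st.writesArr .cpx .x

variable {n B M e N Z : ℕ} {σ b R : ℤ} {α τ C : ℝ} {x : ZMod n → ℂ} {zl zh : ℤ → ℤ}

theorem HashEnv.exec {s : State Name} (h : HashEnv n B M e N Z σ b R α τ C x zl zh s)
    (st : Stmt Name) (hst : st.keepsHashEnv = true) :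
    HashEnv n B M e N Z σ b R α τ C x zl zh (st.exec s) := by
  simp only [Stmt.keepsHashEnv, List.all_cons, List.all_nil, Bool.and_true, Bool.and_eq_true,
    Bool.not_eq_true'] at hst
  obtain ⟨⟨⟨⟨h1, h2, h3, h4, h5, h6, h7, h8, h9⟩, h10, h11, h12⟩, h13, h14⟩, h15⟩ := hst
  exact ⟨(exec_intReg _ _ _ h1).trans h.n_eq, (exec_intReg _ _ _ h2).trans h.B_eq,
    (exec_intReg _ _ _ h3).trans h.M_eq, (exec_intReg _ _ _ h4).trans h.logB_eq,
    (exec_intReg _ _ _ h5).trans h.N_eq, (exec_intReg _ _ _ h6).trans h.zcnt_eq,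
    (exec_intReg _ _ _ h7).trans h.sigma_eq, (exec_intReg _ _ _ h8).trans h.b_eq,
    (exec_intReg _ _ _ h9).trans h.R_eq, (exec_realReg _ _ _ h10).trans h.alpha_eq,
    (exec_realReg _ _ _ h11).trans h.tau_eq, (exec_realReg _ _ _ h12).trans h.C_eq,
    fun j h0 h1 => by rw [exec_cpxArr _ _ _ h15]; exact h.x_eq j h0 h1,
    (exec_intArr _ _ _ h13).trans h.zlist_eq, (exec_intArr _ _ _ h14).trans h.zhat_eq⟩

theorem HashEnv.setInt {s : State Name} (h : HashEnv n B M e N Z σ b R α τ C x zl zh s)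
    (v : Name) (z : ℤ) (hv : v ∉ [Name.n, .B, .M, .logB, .N, .zcnt, .sigma, .b, .R]) :
    HashEnv n B M e N Z σ b R α τ C x zl zh (s.setInt v z) := by
  simp only [List.mem_cons, List.not_mem_nil, or_false, not_or] at hv
  obtain ⟨h1, h2, h3, h4, h5, h6, h7, h8, h9⟩ := hv
  constructor <;> simp [Ne.symm h1, Ne.symm h2, Ne.symm h3, Ne.symm h4, Ne.symm h5, Ne.symm h6,
    Ne.symm h7, Ne.symm h8, Ne.symm h9, h.n_eq, h.B_eq, h.M_eq, h.logB_eq, h.N_eq, h.zcnt_eq,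
    h.sigma_eq, h.b_eq, h.R_eq, h.alpha_eq, h.tau_eq, h.C_eq, h.zlist_eq, h.zhat_eq]
  exact h.x_eq

/-- The body of the loop that folds the windowed signal into the bins. -/
def foldBody (a : IExpr) (out : Name) : Stmt Name :=
    .i ≔ int .l - int .R ;;
    windowTime ;;
    .q ≔ int .i % int .B ;;
    .store out (int .q)
      (cpxAt out (int .q)
        + toC (real .g) * cpxAt .x ((int .sigma * (int .i - a)) % int .n)
          * rootE (int .sigma * int .b * int .i) (int .n))

/-- The body of the loop that subtracts the known part of the spectrum from the bins. -/
def subtractBody (a : IExpr) (out : Name) : Stmt Name :=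
    .i ≔ intAt .zlist (int .l) ;;
    .q ≔ (int .sigma * (int .i - int .b)) % int .n ;;
    .h ≔ (2 * int .q + int .M) / (2 * int .M) ;;
    .o ≔ int .q - int .h * int .M ;;
    windowFrequency ;;
    .q ≔ int .h % int .B ;;
    .store out (int .q)
      (cpxAt out (int .q)
        - toC (real .g) * toC (toR (intAt .zhat (int .i)))
          * rootE (a * int .sigma * int .i) (int .n))

theorem hashToBins_eq (a : IExpr) (out : Name) : hashToBins a out =
    (.loop .j (int .B) (.store out (int .j) (0 : CExpr)) ;;
    .loop .l (2 * int .R + 1) (foldBody a out) ;;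
    fft out ;;
    .loop .l (int .zcnt) (subtractBody a out)) := rfl

/-- The names of the arrays that hold the bins. -/
def IsBins (out : Name) : Prop := out = .u ∨ out = .u'

theorem keepsHashEnv_foldBody {a : IExpr} {out : Name} (ho : IsBins out) :
    (foldBody a out).keepsHashEnv = true := by rcases ho with rfl | rfl <;> rfl

theorem keepsHashEnv_subtractBody {a : IExpr} {out : Name} (ho : IsBins out) :
    (subtractBody a out).keepsHashEnv = true := by rcases ho with rfl | rfl <;> rfl

theorem exec_foldBody [NeZero n] {a : IExpr} {a' : ℤ} (ha : ∀ s, intVal s a = a') {out : Name}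
    {s : State Name} (h : HashEnv n B M e N Z σ b R α τ C x zl zh s) (l : ℤ)
    (hl : s.intReg .l = l) :
    ((foldBody a out).exec s).cpxArr out = Function.update (s.cpxArr out) ((l - R) % B)
      (s.cpxArr out ((l - R) % B) + timeTerm x τ C σ a' b (l - R)) := by
  unfold foldBody
  rw [exec_seq, exec_seq, exec_seq]
  set s₁ := (Name.i ≔ int .l - int .R).exec s with hs₁
  have h₁ : HashEnv n B M e N Z σ b R α τ C x zl zh s₁ := h.exec _ rfl
  have hi : s₁.intReg .i = l - R := by simp [hs₁, hl, h.R_eq]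
  have ho : s₁.cpxArr out = s.cpxArr out := rfl
  set s₂ := windowTime.exec s₁ with hs₂
  have h₂ : HashEnv n B M e N Z σ b R α τ C x zl zh s₂ := h₁.exec _ rfl
  have hg : s₂.realReg .g = √n * smoothedBox (1 / τ ^ 2) C (l - R) := by
    rw [hs₂, exec_windowTime, h₁.n_eq, h₁.tau_eq, h₁.C_eq, hi]; simp
  have hi₂ : s₂.intReg .i = l - R := (exec_intReg _ _ _ rfl).trans hi
  have ho₂ : s₂.cpxArr out = s.cpxArr out := exec_cpxArr _ _ _ rfl
  have hn : (0 : ℤ) < n := by exact_mod_cast NeZero.pos n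
  have hx := h₂.x_eq (σ * (l - R - a') % n) (Int.emod_nonneg _ hn.ne') (Int.emod_lt_of_pos _ hn)
  have hcast : ((σ * (l - R - a') % n : ℤ) : ZMod n) = ((σ * (l - R - a') : ℤ) : ZMod n) := by
    rw [ZMod.intCast_eq_intCast_iff]; exact Int.mod_modEq _ _
  rw [hcast] at hx
  simp [hi₂, h₂.B_eq, ho₂, hg, ha, h₂.sigma_eq, h₂.n_eq, h₂.b_eq, hx, timeTerm]

/-- What is subtracted from its bin for the known coefficient `f`. -/
noncomputable def subtractTerm (B M N : ℕ) (α τ C : ℝ) (n : ℕ) (σ a b f z : ℤ) : ℂ :=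
  (windowFreq B α τ C N (binOffset M (σ * (f - b) % n) / n) : ℂ) * z * root (a * σ * f) n

theorem exec_subtractBody [NeZero n] {a : IExpr} {a' : ℤ} (ha : ∀ s, intVal s a = a') {out : Name}
    {s : State Name} (h : HashEnv n B M e N Z σ b R α τ C x zl zh s) (l : ℤ)
    (hl : s.intReg .l = l) :
    ((subtractBody a out).exec s).cpxArr out =
      Function.update (s.cpxArr out) (binOf n B M σ b (zl l))
      (s.cpxArr out (binOf n B M σ b (zl l))
        - subtractTerm B M N α τ C n σ a' b (zl l) (zh (zl l))) := by
  unfold subtractBody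
  rw [exec_seq, exec_seq, exec_seq, exec_seq, exec_seq, exec_seq]
  set s₁ := (Name.o ≔ int .q - int .h * int .M).exec
    ((Name.h ≔ (2 * int .q + int .M) / (2 * int .M)).exec
    ((Name.q ≔ (int .sigma * (int .i - int .b)) % int .n).exec
    ((Name.i ≔ intAt .zlist (int .l)).exec s))) with hs₁
  have h₁ : HashEnv n B M e N Z σ b R α τ C x zl zh s₁ :=
    (((h.exec _ rfl).exec _ rfl).exec _ rfl).exec _ rfl
  have hi : s₁.intReg .i = zl l := by simp [hs₁, hl, h.zlist_eq]
  have hh : s₁.intReg .h = binIndex M (σ * (zl l - b) % n) := by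
    simp [hs₁, hl, h.zlist_eq, h.sigma_eq, h.b_eq, h.n_eq, h.M_eq, binIndex]
  have ho : s₁.intReg .o = binOffset M (σ * (zl l - b) % n) := by
    simp [hs₁, hl, h.zlist_eq, h.sigma_eq, h.b_eq, h.n_eq, h.M_eq, binIndex, binOffset]
  have hout : s₁.cpxArr out = s.cpxArr out := rfl
  set s₂ := windowFrequency.exec s₁ with hs₂
  have h₂ : HashEnv n B M e N Z σ b R α τ C x zl zh s₂ := h₁.exec _ rfl
  have hg : s₂.realReg .g = windowFreq B α τ C N (binOffset M (σ * (zl l - b) % n) / n) := by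
    rw [hs₂, exec_windowFrequency s₁ (NeZero.pos n) h₁.B_eq h₁.n_eq h₁.N_eq, h₁.alpha_eq,
      h₁.tau_eq, h₁.C_eq, ho]
  have hi₂ : s₂.intReg .i = zl l := (exec_intReg _ _ _ rfl).trans hi
  have hh₂ : s₂.intReg .h = binIndex M (σ * (zl l - b) % n) := (exec_intReg _ _ _ rfl).trans hh
  have ho₂ : s₂.cpxArr out = s.cpxArr out := exec_cpxArr _ _ _ rfl
  simp [hi₂, hh₂, h₂.B_eq, ho₂, hg, ha, h₂.sigma_eq, h₂.n_eq, h₂.zhat_eq, subtractTerm,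
    binOf]

/-- The contents of the bins computed by the program. -/
noncomputable def binValue {n : ℕ} (B M N Z : ℕ) (α τ C : ℝ) (x : ZMod n → ℂ) (zl zh : ℤ → ℤ)
    (R σ a b j : ℤ) : ℂ :=
  ∑ q ∈ Finset.range B, root (j * q) B * (∑ l ∈ Finset.range (2 * R + 1).toNat,
        if ((l : ℤ) - R) % B = q then timeTerm x τ C σ a b (l - R) else 0)
    - ∑ l ∈ Finset.range Z, if binOf n B M σ b (zl l) = j then
        subtractTerm B M N α τ C n σ a b (zl l) (zh (zl l)) else 0

/-- The program `hashToBins` computes `binValue`. -/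
theorem exec_hashToBins [NeZero n] {a : IExpr} {a' : ℤ} (ha : ∀ s, intVal s a = a') {out : Name}
    (ho : IsBins out) (hBe : B = 2 ^ e) {s : State Name}
    (h : HashEnv n B M e N Z σ b R α τ C x zl zh s) {j : ℤ} (hj0 : 0 ≤ j) (hj : j < B) :
    ((hashToBins a out).exec s).cpxArr out j = binValue B M N Z α τ C x zl zh R σ a' b j := by
  have hB : (0 : ℤ) < B := by rw [hBe]; positivity
  have hotmp : out ≠ .tmp := by rcases ho with rfl | rfl <;> decide
  rw [hashToBins_eq, exec_seq, exec_seq, exec_seq]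
  have h1 := exec_loop_induct (v := .j) (e := int .B) (s := s)
    (body := .store out (int .j) (0 : CExpr))
    (fun i s' => ∀ q : ℤ, 0 ≤ q → q < i → s'.cpxArr out q = 0)
    (fun q h0 h1 => by push_cast at h1; omega) (by
      intro i _ s' hs' q h0 h1
      simp [Function.update_apply]
      intro hq
      exact hs' q h0 (by push_cast at h1; omega))
  set s₁ := (Stmt.loop .j (int .B) (.store out (int .j) (0 : CExpr))).exec s with hs₁
  have h₁ : HashEnv n B M e N Z σ b R α τ C x zl zh s₁ :=
    h.exec _ (by rcases ho with rfl | rfl <;> rfl)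
  rw [intVal_reg, h.B_eq, Int.toNat_natCast] at h1
  have h2 := exec_loop_induct (v := .l) (e := 2 * int .R + 1) (s := s₁) (body := foldBody a out)
    (fun i s' => HashEnv n B M e N Z σ b R α τ C x zl zh s' ∧ ∀ q : ℤ, 0 ≤ q → q < B →
      s'.cpxArr out q = ∑ l ∈ Finset.range i,
        if ((l : ℤ) - R) % B = q then timeTerm x τ C σ a' b (l - R) else 0)
    ⟨h₁, fun q h0 hq => by simpa using h1 q h0 hq⟩ (by
      rintro i - s' ⟨h3, h4⟩
      have h5 := h3.setInt .l i (by decide)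
      refine ⟨h5.exec _ (keepsHashEnv_foldBody ho), fun q h0 hq => ?_⟩
      rw [exec_foldBody ha h5 i (by simp), Finset.sum_range_succ, Function.update_apply,
        cpxArr_setInt]
      split_ifs with h6 h7 h7
      · rw [← h6, h4 q h0 hq]
      · exact absurd h6.symm h7
      · exact absurd h7.symm h6
      · rw [h4 q h0 hq, add_zero])
  set s₂ := (Stmt.loop .l (2 * int .R + 1) (foldBody a out)).exec s₁ with hs₂
  have h3 : intVal s₁ (2 * int .R + 1) = 2 * R + 1 := by simp [h₁.R_eq]
  rw [h3] at h2
  obtain ⟨h₂, h4⟩ := h2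
  set s₃ := (fft out).exec s₂ with hs₃
  have h₃ : HashEnv n B M e N Z σ b R α τ C x zl zh s₃ :=
    h₂.exec _ (by rcases ho with rfl | rfl <;> rfl)
  have h5 : ∀ j : ℤ, 0 ≤ j → j < B → s₃.cpxArr out j
      = ∑ q ∈ Finset.range B, root (j * q) B * (∑ l ∈ Finset.range (2 * R + 1).toNat,
        if ((l : ℤ) - R) % B = q then timeTerm x τ C σ a' b (l - R) else 0) := by
    intro j hj0 hj
    rw [hs₃, exec_fft hotmp s₂ (e := e) (by rw [h₂.B_eq, hBe]; push_cast; rfl) h₂.logB_eq hj0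
      (by rw [hBe] at hj; exact_mod_cast hj), ← hBe]
    refine Finset.sum_congr rfl fun q hq => ?_
    rw [h4 q (by omega) (by rw [Finset.mem_range] at hq; omega)]
  have h6 := exec_loop_induct (v := .l) (e := int .zcnt) (s := s₃) (body := subtractBody a out)
    (fun i s' => HashEnv n B M e N Z σ b R α τ C x zl zh s' ∧ ∀ j : ℤ, 0 ≤ j → j < B →
      s'.cpxArr out j = s₃.cpxArr out j - ∑ l ∈ Finset.range i,
        if binOf n B M σ b (zl l) = j then
          subtractTerm B M N α τ C n σ a' b (zl l) (zh (zl l)) else 0)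
    ⟨h₃, fun q h0 hq => by simp⟩ (by
      rintro i - s' ⟨h3, h4⟩
      have h5 := h3.setInt .l i (by decide)
      refine ⟨h5.exec _ (keepsHashEnv_subtractBody ho), fun q h0 hq => ?_⟩
      rw [exec_subtractBody ha h5 i (by simp), Finset.sum_range_succ, Function.update_apply,
        cpxArr_setInt]
      split_ifs with h6 h7 h7
      · rw [← h6, h4 q h0 hq]; ring
      · exact absurd h6.symm h7
      · exact absurd h7.symm h6
      · rw [h4 q h0 hq, add_zero])
  rw [intVal_reg, h₃.zcnt_eq, Int.toNat_natCast] at h6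
  rw [h6.2 j hj0 hj, h5 j hj0 hj]
  rfl

open scoped Classical in
theorem steps_subtractBody_le {a : IExpr} (ha : a = 0 ∨ a = 1) (out : Name) {s : State Name}
    (h : HashEnv n B M e N Z σ b R α τ C x zl zh s) {l : ℤ} (hl : s.intReg .l = l) :
    (subtractBody a out).steps s
      ≤ 199 + if inTransition B n M α (σ * (zl l - b) % n) then 30 * N else 0 := by
  unfold subtractBody
  rw [steps_seq, steps_seq, steps_seq, steps_seq, steps_seq, steps_seq]
  have c1 : ∀ s, (Name.i ≔ intAt .zlist (int .l)).steps s ≤ 10 := fun s =>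
    Stmt.steps_le _ rfl (by decide)
  have c2 : ∀ s, (Name.q ≔ (int .sigma * (int .i - int .b)) % int .n).steps s ≤ 10 := fun s =>
    Stmt.steps_le _ rfl (by decide)
  have c3 : ∀ s, (Name.h ≔ (2 * int .q + int .M) / (2 * int .M)).steps s ≤ 10 := fun s =>
    Stmt.steps_le _ rfl (by decide)
  have c4 : ∀ s, (Name.o ≔ int .q - int .h * int .M).steps s ≤ 10 := fun s =>
    Stmt.steps_le _ rfl (by decide)
  have c5 : ∀ s, (Name.q ≔ int .h % int .B).steps s ≤ 10 := fun s =>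
    Stmt.steps_le _ rfl (by decide)
  have c6 : ∀ s, (Stmt.store out (int .q)
      (cpxAt out (int .q)
        - toC (real .g) * toC (toR (intAt .zhat (int .i)))
          * rootE (a * int .sigma * int .i) (int .n))).steps s ≤ 40 := by
    intro s
    rcases ha with rfl | rfl <;> exact Stmt.steps_le _ rfl (Nat.le_of_ble_eq_true rfl)
  have c1' := c1 s
  set s₁ := (Name.i ≔ intAt .zlist (int .l)).exec s with hs₁
  have c2' := c2 s₁
  set s₂ := (Name.q ≔ (int .sigma * (int .i - int .b)) % int .n).exec s₁ with hs₂
  have c3' := c3 s₂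
  set s₃ := (Name.h ≔ (2 * int .q + int .M) / (2 * int .M)).exec s₂ with hs₃
  have c4' := c4 s₃
  set s₄ := (Name.o ≔ int .q - int .h * int .M).exec s₃ with hs₄
  have h₄ : HashEnv n B M e N Z σ b R α τ C x zl zh s₄ :=
    (((h.exec _ rfl).exec _ rfl).exec _ rfl).exec _ rfl
  have ho : s₄.intReg .o = binOffset M (σ * (zl l - b) % n) := by
    simp [hs₄, hs₃, hs₂, hs₁, hl, h.zlist_eq, h.sigma_eq, h.b_eq, h.n_eq, h.M_eq, binIndex,
      binOffset]
  have c7 := steps_windowFrequency_le s₄ h₄.B_eq h₄.n_eq h₄.N_eq ho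
  rw [h₄.alpha_eq] at c7
  have c5' := c5 (windowFrequency.exec s₄)
  have c6' := c6 ((Name.q ≔ int .h % int .B).exec (windowFrequency.exec s₄))
  omega

open scoped Classical in
/-- The cost depends on the random choices only through the number of coefficients that need a
series evaluation. -/
theorem steps_hashToBins_le {a : IExpr} (ha : a = 0 ∨ a = 1) {out : Name} (ho : IsBins out)
    {s : State Name} (h : HashEnv n B M e N Z σ b R α τ C x zl zh s) :
    (hashToBins a out).steps s ≤ 50 + 10 * B + 200 * (2 * R + 1).toNat + e * (80 * B + 20)
      + ∑ l ∈ Finset.range Z,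
        (200 + if inTransition B n M α (σ * (zl l - b) % n) then 30 * N else 0) := by
  rw [hashToBins_eq, steps_seq, steps_seq, steps_seq]
  have c1 := Stmt.steps_simpleLoop_le (x := .j) (e := int .B) (s := s)
    (body := .store out (int .j) (0 : CExpr)) 10 B rfl h.B_eq (Nat.le_of_ble_eq_true rfl)
  set s₁ := (Stmt.loop .j (int .B) (.store out (int .j) (0 : CExpr))).exec s with hs₁
  have h₁ : HashEnv n B M e N Z σ b R α τ C x zl zh s₁ :=
    h.exec _ (by rcases ho with rfl | rfl <;> rfl)
  have c2 := Stmt.steps_loop_le (x := .l) (e := 2 * int .R + 1) (s := s₁) (body := foldBody a out)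
    199 (fun s' => by
      rcases ha with rfl | rfl <;> exact Stmt.steps_le _ rfl (Nat.le_of_ble_eq_true rfl))
  have h2 : (2 * int .R + 1 : IExpr).eval s₁ = 2 * R + 1 := by
    have : intVal s₁ (2 * int .R + 1) = 2 * R + 1 := by simp [h₁.R_eq]
    exact this
  rw [h2] at c2
  have h2' : (2 * int .R + 1 : IExpr).cost = 5 := rfl
  set s₂ := (Stmt.loop .l (2 * int .R + 1) (foldBody a out)).exec s₁ with hs₂
  have h₂ : HashEnv n B M e N Z σ b R α τ C x zl zh s₂ :=
    h₁.exec _ (by rcases ho with rfl | rfl <;> rfl)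
  have c3 := steps_fft_le out s₂ h₂.B_eq h₂.logB_eq
  set s₃ := (fft out).exec s₂ with hs₃
  have h₃ : HashEnv n B M e N Z σ b R α τ C x zl zh s₃ :=
    h₂.exec _ (by rcases ho with rfl | rfl <;> rfl)
  have c4 := steps_loop_le_sum (v := .l) (e := int .zcnt) (s := s₃) (body := subtractBody a out)
    (fun _ s' => HashEnv n B M e N Z σ b R α τ C x zl zh s') h₃
    (fun i _ s' h5 => (h5.setInt .l i (by decide)).exec _ (keepsHashEnv_subtractBody ho))
    (fun l => 199 + if inTransition B n M α (σ * (zl l - b) % n) then 30 * N else 0)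
    (fun i _ s' h5 => steps_subtractBody_le ha out (h5.setInt .l i (by decide)) (by simp))
  rw [intVal_reg, h₃.zcnt_eq, Int.toNat_natCast] at c4
  have h4 : ∑ l ∈ Finset.range Z,
      (1 + (199 + if inTransition B n M α (σ * (zl l - b) % n) then 30 * N else 0))
      = ∑ l ∈ Finset.range Z,
        (200 + if inTransition B n M α (σ * (zl l - b) % n) then 30 * N else 0) :=
    Finset.sum_congr rfl fun l _ => by ring
  rw [h4] at c4
  have h5 : (int Name.B).cost = 1 := rfl
  have h6 : (int Name.zcnt).cost = 1 := rfl
  have h7 : (2 * R + 1).toNat * (199 + 1) = 200 * (2 * R + 1).toNat := by ring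
  omega

end Hashing

/-! ### One round of the algorithm as a program -/

section Round

/-- The body of the Newton iteration for the inverse of `sigma`. -/
def newtonBody : Stmt Name :=
  .sigmaInv ≔ (int .sigmaInv * (2 - int .sigma * int .sigmaInv)) % int .n

/-- The body of the loop that reads off one coefficient from each bin. -/
def decodeBody : Stmt Name :=
  .ifThen (.ltReal (1 / 2) (.un .absCpx (cpxAt .u (int .j)))) (
    .i ≔ (int .sigmaInv
        * roundE (.un .phase (cpxAt .u (int .j) / cpxAt .u' (int .j))
            * toR (int .n) / (2 * .pi))) % int .n ;;
    .store .what (int .i) (roundE (.un .re (cpxAt .u (int .j)))) ;;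
    .store .wlist (int .wcnt) (int .i) ;;
    .wcnt ≔ int .wcnt + 1)

/-- The body of the loop that adds the coefficients found to the known part of the spectrum. -/
def updateBody : Stmt Name :=
  .i ≔ intAt .wlist (int .l) ;;
  .ifThen (.eqInt (intAt .seen (int .i)) 0) (
    .store .seen (int .i) (1 : IExpr) ;;
    .store .zlist (int .zcnt) (int .i) ;;
    .zcnt ≔ int .zcnt + 1) ;;
  .store .zhat (int .i) (intAt .zhat (int .i) + intAt .what (int .i)) ;;
  .store .what (int .i) (0 : IExpr)

/-- The part of a round that follows the random choices. -/
def recover : Stmt Name :=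
  .sigmaInv ≔ (1 : IExpr) ;;
  .loop .i (roundE (real .T)) newtonBody ;;
  windowParameters ;;
  hashToBins 0 .u ;;
  hashToBins 1 .u' ;;
  .wcnt ≔ (0 : IExpr) ;;
  .loop .j (int .B) decodeBody ;;
  .loop .l (int .wcnt) updateBody

/-- The part of a round that precedes the random choices. -/
def chooseBins (m d : ℕ) : Stmt Name :=
  .ifElse (.leInt (int .n) (.lit (2 ^ (m + d)) * int .kt))
    (.B ≔ int .n)
    (.B ≔ .lit (2 ^ m) * int .kt)

theorem noiselessSparseFFTInner_eq (m d : ℕ) : noiselessSparseFFTInner m d =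
    (chooseBins m d ;;
    .M ≔ int .n / int .B ;;
    powerOfTwoAbove .Q .logB (int .B) ;;
    .rand .sigma (int .n / 2) ;;
    .sigma ≔ 2 * int .sigma + 1 ;;
    .rand .b (int .n) ;;
    recover) := rfl

/-- Newton's iteration doubles the number of correct binary digits of the inverse, and it starts
with one correct digit since `σ` is odd. -/
theorem exec_newton {p : ℕ} {σ : ℤ} (hσ : σ % 2 = 1) {s : State Name}
    (hn : s.intReg .n = 2 ^ p) (hs : s.intReg .sigma = σ) (hT : (p : ℤ) ≤ round (s.realReg .T)) :
    (2 ^ p : ℤ) ∣ 1 - σ * ((Stmt.loop .i (roundE (real .T)) newtonBody).exec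
      ((Name.sigmaInv ≔ (1 : IExpr)).exec s)).intReg .sigmaInv := by
  set s₁ := (Name.sigmaInv ≔ (1 : IExpr)).exec s with hs₁
  have h := exec_loop_induct (v := .i) (e := roundE (real .T)) (s := s₁) (body := newtonBody)
    (fun J s' => s'.intReg .n = 2 ^ p ∧ s'.intReg .sigma = σ ∧
      (2 : ℤ) ^ (min (J + 1) p) ∣ 1 - σ * s'.intReg .sigmaInv)
    ⟨by simpa [hs₁] using hn, by simpa [hs₁] using hs, by
      have h1 : (2 : ℤ) ∣ 1 - σ * s₁.intReg .sigmaInv := by simp [hs₁]; omega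
      exact (pow_dvd_pow 2 (by simp)).trans (by simpa using h1 : (2 : ℤ) ^ 1 ∣ _)⟩ (by
      rintro J - s' ⟨h1, h2, h3⟩
      refine ⟨by simp [newtonBody, h1], by simp [newtonBody, h2], ?_⟩
      simp only [newtonBody, exec_setInt, intReg_setInt, intVal_mod, intVal_mul, intVal_sub,
        intVal_two, intVal_reg, if_true, reduceCtorEq, if_false, h1, h2]
      set v := s'.intReg .sigmaInv
      have h4 : (2 : ℤ) ^ (min (J + 1 + 1) p) ∣ (1 - σ * v) * (1 - σ * v) := by
        refine (pow_dvd_pow (2 : ℤ) (?_ : _ ≤ min (J + 1) p + min (J + 1) p)).trans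
          (pow_add (2 : ℤ) _ _ ▸ mul_dvd_mul h3 h3)
        omega
      have h5 : (2 : ℤ) ^ (min (J + 1 + 1) p) ∣ σ * (v * (2 - σ * v)) -
          σ * (v * (2 - σ * v) % 2 ^ p) := by
        rw [← mul_sub]
        exact ((pow_dvd_pow (2 : ℤ) (min_le_right _ _)).trans (Int.dvd_self_sub_emod)).mul_left _
      have := dvd_add h4 h5
      rwa [show (1 - σ * v) * (1 - σ * v) + (σ * (v * (2 - σ * v)) - σ * (v * (2 - σ * v) % 2 ^ p))
        = 1 - σ * (v * (2 - σ * v) % 2 ^ p) by ring] at this)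
  have h1 : intVal s₁ (roundE (real .T)) = round (s.realReg .T) := by simp [hs₁]
  rw [h1] at h
  have h2 := h.2.2
  rwa [min_eq_right (by omega)] at h2

theorem WindowParams.of_eq {B : ℕ} {α T : ℝ} (hB : 2 ≤ B) (hα : 0 < α) (hα1 : α < 1) (hT : 1 ≤ T) :
    WindowParams B α T (4 * B / α * √(2 * T)) ((1 - α / 2) / (2 * B))
      (round (8 * B / α * T) + 1) (8 * round T + 8).toNat where
  two_le := hB
  α_pos := hα
  α_lt := hα1
  one_le_T := hT
  τ_eq := rfl
  C_eq := rfl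
  le_R := by
    have := abs_le.1 (abs_sub_round (8 * B / α * T))
    rw [show 8 * B * T / α = 8 * B / α * T by ring]
    push_cast
    linarith [this.2]
  le_N := by
    have := abs_le.1 (abs_sub_round T)
    have h1 : ((8 * round T + 8 : ℤ) : ℝ) ≤ ((8 * round T + 8).toNat : ℤ) := by
      exact_mod_cast Int.self_le_toNat _
    push_cast at h1
    linarith [this.2]

/-- The list `zl` of length `Z` contains every index in the support of `zh` exactly once, and `seen`
is the indicator function of its entries. -/
structure Stored (n Z : ℕ) (zl zh seen : ℤ → ℤ) : Prop where
  range : ∀ l : ℕ, l < Z → 0 ≤ zl l ∧ zl l < n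
  inj : ∀ l : ℕ, l < Z → ∀ l' : ℕ, l' < Z → zl l = zl l' → l = l'
  seen_iff : ∀ i, seen i ≠ 0 ↔ ∃ l : ℕ, l < Z ∧ zl l = i
  supp : ∀ i, zh i ≠ 0 → seen i ≠ 0

theorem Stored.update {n Z : ℕ} {zl zh seen : ℤ → ℤ} (h : Stored n Z zl zh seen) {i v : ℤ}
    (hi : seen i ≠ 0) : Stored n Z zl (Function.update zh i v) seen where
  range := h.range
  inj := h.inj
  seen_iff := h.seen_iff
  supp q hq := by
    by_cases hqi : q = i
    · subst hqi; exact hi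
    · rw [Function.update_of_ne hqi] at hq; exact h.supp q hq

theorem Stored.insert {n Z : ℕ} {zl zh seen : ℤ → ℤ} (h : Stored n Z zl zh seen) {i : ℤ}
    (hi0 : 0 ≤ i) (hin : i < n) (hi : seen i = 0) :
    Stored n (Z + 1) (Function.update zl Z i) zh (Function.update seen i 1) where
  range l hl := by
    rcases Nat.lt_succ_iff_lt_or_eq.1 hl with h1 | rfl
    · rw [Function.update_of_ne (by exact_mod_cast h1.ne)]; exact h.range l h1
    · rw [Function.update_self]; exact ⟨hi0, hin⟩
  inj l hl l' hl' e := by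
    have hne : ∀ l : ℕ, l < Z → zl l ≠ i := fun l h1 h2 => (h.seen_iff i).2 ⟨l, h1, h2⟩ hi
    rcases Nat.lt_succ_iff_lt_or_eq.1 hl with h1 | rfl <;>
      rcases Nat.lt_succ_iff_lt_or_eq.1 hl' with h2 | rfl
    · rw [Function.update_of_ne (by exact_mod_cast h1.ne),
        Function.update_of_ne (by exact_mod_cast h2.ne)] at e
      exact h.inj l h1 l' h2 e
    · rw [Function.update_of_ne (by exact_mod_cast h1.ne), Function.update_self] at e
      exact absurd e (hne l h1)
    · rw [Function.update_self, Function.update_of_ne (by exact_mod_cast h2.ne)] at e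
      exact absurd e.symm (hne l' h2)
    · rfl
  seen_iff q := by
    by_cases hq : q = i
    · subst hq
      simp only [Function.update_self]
      exact ⟨fun _ => ⟨Z, by omega, Function.update_self ..⟩, fun _ => one_ne_zero⟩
    · rw [Function.update_of_ne hq, h.seen_iff]
      constructor
      · rintro ⟨l, h1, h2⟩
        exact ⟨l, by omega, by rw [Function.update_of_ne (by exact_mod_cast h1.ne), h2]⟩
      · rintro ⟨l, h1, h2⟩
        rcases Nat.lt_succ_iff_lt_or_eq.1 h1 with h3 | rfl
        · rw [Function.update_of_ne (by exact_mod_cast h3.ne)] at h2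
          exact ⟨l, h3, h2⟩
        · rw [Function.update_self] at h2; exact absurd h2.symm hq
  supp q hq := by
    by_cases hqi : q = i
    · subst hqi; simp
    · rw [Function.update_of_ne hqi]; exact h.supp q hq

/-- The index read off from the bins `U` and `U'`. -/
noncomputable def decodeTarget (n inv : ℤ) (U U' : ℂ) : ℤ :=
  (inv * round (phase (U / U') * n / (2 * Real.pi))) % n

/-- The memory after the first `J` bins have been decoded. -/
structure Decoded (n inv : ℤ) (U U' : ℤ → ℂ) (J : ℕ) (s : State Name) : Prop where
  n_eq : s.intReg .n = n
  inv_eq : s.intReg .sigmaInv = inv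
  u_eq : s.cpxArr .u = U
  u'_eq : s.cpxArr .u' = U'
  wcnt_nonneg : 0 ≤ s.intReg .wcnt
  wcnt_le : s.intReg .wcnt ≤ J
  range : ∀ l : ℕ, (l : ℤ) < s.intReg .wcnt → 0 ≤ s.intArr .wlist l ∧ s.intArr .wlist l < n
  what_eq : ∀ i,
    (∃ j : ℕ, j < J ∧ 1 / 2 < ‖U j‖ ∧ decodeTarget n inv (U j) (U' j) = i ∧
      s.intArr .what i = round (U j).re ∧ ∃ l : ℕ, (l : ℤ) < s.intReg .wcnt ∧
        s.intArr .wlist l = i) ∨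
    ((∀ j : ℕ, j < J → 1 / 2 < ‖U j‖ → decodeTarget n inv (U j) (U' j) ≠ i) ∧
      s.intArr .what i = 0 ∧ ∀ l : ℕ, (l : ℤ) < s.intReg .wcnt → s.intArr .wlist l ≠ i)

theorem Decoded.step {n inv : ℤ} (hn : 0 < n) {U U' : ℤ → ℂ} {J : ℕ} {s : State Name}
    (h : Decoded n inv U U' J s) : Decoded n inv U U' (J + 1) (decodeBody.exec (s.setInt .j J)) := by
  classical
  by_cases hact : 1 / 2 < ‖U J‖
  · set T := decodeTarget n inv (U J) (U' J) with hT
    have hc : (Cond.ltReal (1 / 2) (.un .absCpx (cpxAt .u (int .j)))).holds (s.setInt .j J) := by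
      simpa [h.u_eq] using hact
    have e : decodeBody.exec (s.setInt .j J) =
        ((((s.setInt .j J).setInt .i T).storeInt .what T (round (U J).re)).storeInt .wlist
          (s.intReg .wcnt) T).setInt .wcnt (s.intReg .wcnt + 1) := by
      unfold decodeBody
      rw [exec_ifThen, if_pos hc]
      simp [h.u_eq, h.u'_eq, h.inv_eq, h.n_eq, hT, decodeTarget]
    rw [e]
    have hw0 := h.wcnt_nonneg
    have hwJ := h.wcnt_le
    set w := s.intReg .wcnt with hw
    obtain ⟨w', hw'⟩ := Int.eq_ofNat_of_zero_le hw0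
    have hT0 : 0 ≤ T := Int.emod_nonneg _ hn.ne'
    have hTn : T < n := Int.emod_lt_of_pos _ hn
    constructor
    · simpa using h.n_eq
    · simpa using h.inv_eq
    · simpa using h.u_eq
    · simpa using h.u'_eq
    · simp; omega
    · simp; omega
    · intro l hl
      simp only [intReg_setInt, if_true, intArr_setInt, intArr_storeInt] at hl ⊢
      by_cases hlw : (l : ℤ) = w
      · simp [hlw, hT0, hTn]
      · simpa [Function.update_of_ne hlw] using h.range l (by omega)
    · intro i
      simp only [intReg_setInt, if_true, intArr_setInt, intArr_storeInt, reduceCtorEq, if_false]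
      by_cases hi : i = T
      · subst hi
        exact Or.inl ⟨J, by omega, hact, rfl, Function.update_self .., w', by omega, by
          rw [hw', Function.update_self]⟩
      · rw [Function.update_of_ne hi]
        rcases h.what_eq i with ⟨j, h1, h2, h3, h4, l, h5, h6⟩ | ⟨h1, h2, h3⟩
        · exact Or.inl ⟨j, by omega, h2, h3, h4, l, by omega, by
            rw [Function.update_of_ne (by omega)]; exact h6⟩
        · refine Or.inr ⟨fun j hj ha => ?_, h2, fun l hl => ?_⟩
          · rcases Nat.lt_succ_iff_lt_or_eq.1 hj with h4 | rfl
            · exact h1 j h4 ha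
            · exact fun h5 => hi h5.symm
          · by_cases hlw : (l : ℤ) = w
            · rw [hlw, Function.update_self]; exact fun h5 => hi h5.symm
            · rw [Function.update_of_ne hlw]; exact h3 l (by omega)
  · have hc : ¬ (Cond.ltReal (1 / 2) (.un .absCpx (cpxAt .u (int .j)))).holds (s.setInt .j J) := by
      simpa [h.u_eq] using hact
    have e : decodeBody.exec (s.setInt .j J) = s.setInt .j J := by
      unfold decodeBody
      rw [exec_ifThen, if_neg hc]
    rw [e]
    have hwJ := h.wcnt_le
    constructor
    · simpa using h.n_eq
    · simpa using h.inv_eq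
    · simpa using h.u_eq
    · simpa using h.u'_eq
    · simpa using h.wcnt_nonneg
    · simp; omega
    · simpa using h.range
    · intro i
      simp only [intReg_setInt, reduceCtorEq, if_false, intArr_setInt]
      rcases h.what_eq i with ⟨j, h1, h2⟩ | ⟨h1, h2⟩
      · exact Or.inl ⟨j, by omega, h2⟩
      · refine Or.inr ⟨fun j hj ha => ?_, h2⟩
        rcases Nat.lt_succ_iff_lt_or_eq.1 hj with h4 | rfl
        · exact h1 j h4 ha
        · exact absurd ha hact

/-- The memory after the first `J` coefficients found have been added; `wl`, `wh`, `zh`, `Z` stand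
for the contents of `wlist`, `what`, `zhat`, `zcnt` at the beginning. -/
structure Updated (n Z : ℕ) (wl wh zh : ℤ → ℤ) (J : ℕ) (s : State Name) : Prop where
  wlist_eq : s.intArr .wlist = wl
  zcnt_nonneg : 0 ≤ s.intReg .zcnt
  zcnt_le : s.intReg .zcnt ≤ Z + J
  stored : Stored n (s.intReg .zcnt).toNat (s.intArr .zlist) (s.intArr .zhat) (s.intArr .seen)
  eq_of_mem : ∀ i, (∃ l : ℕ, l < J ∧ wl l = i) →
    s.intArr .zhat i = zh i + wh i ∧ s.intArr .what i = 0
  eq_of_not_mem : ∀ i, (¬ ∃ l : ℕ, l < J ∧ wl l = i) →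
    s.intArr .zhat i = zh i ∧ s.intArr .what i = wh i

theorem Updated.step {n Z : ℕ} {wl wh zh : ℤ → ℤ} {J : ℕ} {s : State Name}
    (h : Updated n Z wl wh zh J s) (h0 : 0 ≤ wl J) (h1 : wl J < n) :
    Updated n Z wl wh zh (J + 1) (updateBody.exec (s.setInt .l J)) := by
  classical
  have hz0 := h.zcnt_nonneg
  have hzJ := h.zcnt_le
  set i := wl J with hi
  set s₁ := (Stmt.ifThen (.eqInt (intAt .seen (int .i)) 0) (
    .store .seen (int .i) (1 : IExpr) ;;
    .store .zlist (int .zcnt) (int .i) ;;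
    .zcnt ≔ int .zcnt + 1)).exec ((s.setInt .l J).setInt .i i) with hs₁
  have e : updateBody.exec (s.setInt .l J) =
      (s₁.storeInt .zhat i (s₁.intArr .zhat i + s₁.intArr .what i)).storeInt .what i 0 := by
    have h2 : s₁.intReg .i = i := (exec_intReg _ _ _ rfl).trans (by simp)
    have h3 : updateBody.exec (s.setInt .l J) =
      (Stmt.store .what (int .i) (0 : IExpr)).exec
        ((Stmt.store .zhat (int .i) (intAt .zhat (int .i) + intAt .what (int .i))).exec s₁) := by
      rw [hs₁]
      unfold updateBody
      simp [h.wlist_eq, ← hi]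
    rw [h3]
    simp [h2]
  have hzh : s₁.intArr .zhat = s.intArr .zhat := (exec_intArr _ _ _ rfl).trans (by simp)
  have hwh : s₁.intArr .what = s.intArr .what := (exec_intArr _ _ _ rfl).trans (by simp)
  have hwl : s₁.intArr .wlist = wl := (exec_intArr _ _ _ rfl).trans (by simpa using h.wlist_eq)
  have key : 0 ≤ s₁.intReg .zcnt ∧ s₁.intReg .zcnt ≤ Z + J + 1 ∧ s₁.intArr .seen i ≠ 0 ∧
      Stored n (s₁.intReg .zcnt).toNat (s₁.intArr .zlist) (s.intArr .zhat) (s₁.intArr .seen) := by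
    by_cases hsn : s.intArr .seen i = 0
    · have e1 : s₁ = ((((s.setInt .l J).setInt .i i).storeInt .seen i 1).storeInt .zlist
          (s.intReg .zcnt) i).setInt .zcnt (s.intReg .zcnt + 1) := by
        rw [hs₁, exec_ifThen, if_pos (by simpa using hsn)]
        simp
      have h3 := h.stored.insert h0 h1 hsn
      rw [e1]
      simp only [intReg_setInt, if_true, intArr_setInt, intArr_storeInt, reduceCtorEq, if_false,
        Function.update_self]
      refine ⟨by omega, by omega, one_ne_zero, ?_⟩
      rw [show (s.intReg .zcnt + 1).toNat = (s.intReg .zcnt).toNat + 1 by omega]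
      rwa [Int.toNat_of_nonneg hz0] at h3
    · have e1 : s₁ = (s.setInt .l J).setInt .i i := by
        rw [hs₁, exec_ifThen, if_neg (by simpa using hsn)]
      rw [e1]
      exact ⟨by simpa using hz0, by simp; omega, by simpa using hsn, by simpa using h.stored⟩
  obtain ⟨k1, k2, k3, k4⟩ := key
  rw [e]
  constructor
  · simpa using hwl
  · simpa using k1
  · simp; omega
  · simpa [hzh] using k4.update k3
  · intro q hq
    simp only [intArr_storeInt, reduceCtorEq, if_false, if_true, hzh, hwh]
    by_cases hqi : q = i
    · subst hqi
      rw [Function.update_self, Function.update_self]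
      by_cases hm : ∃ l : ℕ, l < J ∧ wl l = i
      · obtain ⟨h4, h5⟩ := h.eq_of_mem i hm
        exact ⟨by rw [h4, h5, add_zero], rfl⟩
      · obtain ⟨h4, h5⟩ := h.eq_of_not_mem i hm
        exact ⟨by rw [h4, h5], rfl⟩
    · rw [Function.update_of_ne hqi, Function.update_of_ne hqi]
      obtain ⟨l, hl, hlq⟩ := hq
      refine h.eq_of_mem q ⟨l, ?_, hlq⟩
      rcases Nat.lt_succ_iff_lt_or_eq.1 hl with h4 | rfl
      · exact h4
      · exact absurd hlq.symm hqi
  · intro q hq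
    simp only [intArr_storeInt, reduceCtorEq, if_false, if_true, hzh, hwh]
    have hqi : q ≠ i := fun h4 => hq ⟨J, by omega, h4.symm⟩
    rw [Function.update_of_ne hqi, Function.update_of_ne hqi]
    exact h.eq_of_not_mem q fun ⟨l, hl, hlq⟩ => hq ⟨l, by omega, hlq⟩

end Round

/-! ### The memory during a round -/

section RoundCorrectness

/-- The memory when the random choices of a round have been made. -/
structure RoundEnv (n B M e Z : ℕ) (σ b : ℤ) (α T : ℝ) (x : ZMod n → ℂ) (s : State Name) :
    Prop where
  n_eq : s.intReg .n = n
  B_eq : s.intReg .B = B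
  M_eq : s.intReg .M = M
  logB_eq : s.intReg .logB = e
  zcnt_eq : s.intReg .zcnt = Z
  sigma_eq : s.intReg .sigma = σ
  b_eq : s.intReg .b = b
  alpha_eq : s.realReg .alpha = α
  T_eq : s.realReg .T = T
  x_eq : ∀ j : ℤ, 0 ≤ j → j < n → s.cpxArr .x j = x (j : ZMod n)
  what_eq : ∀ i, s.intArr .what i = 0
  stored : Stored n Z (s.intArr .zlist) (s.intArr .zhat) (s.intArr .seen)

variable {n B M e Z : ℕ} {σ b : ℤ} {α T : ℝ} {x : ZMod n → ℂ}

/-- The memory before the first call of the hashing procedure. -/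
theorem RoundEnv.hashEnv {s : State Name} (h : RoundEnv n B M e Z σ b α T x s) (hT : 1 ≤ T) :
    HashEnv n B M e (8 * round T + 8).toNat Z σ b (round (8 * B / α * T) + 1) α
      (4 * B / α * √(2 * T)) ((1 - α / 2) / (2 * B)) x (s.intArr .zlist) (s.intArr .zhat)
      (windowParameters.exec ((Stmt.loop .i (roundE (real .T)) newtonBody).exec
        ((Name.sigmaInv ≔ (1 : IExpr)).exec s))) := by
  set s₁ := (Stmt.loop .i (roundE (real .T)) newtonBody).exec
        ((Name.sigmaInv ≔ (1 : IExpr)).exec s) with hs₁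
  have hr : 0 ≤ round T := by
    have := abs_le.1 (abs_sub_round T)
    have h1 : (0 : ℝ) < round T := by linarith [this.2]
    exact_mod_cast h1.le
  have i1 : ∀ v : Name, v ≠ .sigmaInv → v ≠ .i → s₁.intReg v = s.intReg v := fun v h1 h2 => by
    rw [hs₁, exec_intReg _ _ _ (by simp [Stmt.writesReg, newtonBody, Ne.symm h1, Ne.symm h2])]
    simp [h1]
  have i2 : ∀ v, s₁.realReg v = s.realReg v := fun v => by
    rw [hs₁, exec_realReg _ _ _ (by simp [Stmt.writesReg, newtonBody])]
    simp
  have i3 : ∀ v, s₁.intArr v = s.intArr v := fun v => exec_intArr _ _ _ rfl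
  have i4 : s₁.cpxArr .x = s.cpxArr .x := exec_cpxArr _ _ _ rfl
  constructor
  all_goals simp [windowParameters, i1, i2, i3, i4, h.n_eq, h.B_eq, h.M_eq, h.logB_eq, h.zcnt_eq,
    h.sigma_eq, h.b_eq, h.alpha_eq, h.T_eq]
  · omega
  · exact h.x_eq


/-- After a round, the list of known indices is still valid, the scratch array `what` is zero again,
and every entry of `zhat` either has been changed by the rounded value of a bin that decodes to it,
or is unchanged because no bin decodes to it. -/
theorem exec_recover [NeZero n] {p : ℕ} (hn : n = 2 ^ p) (hBe : B = 2 ^ e) (hσ : σ % 2 = 1)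
    (hT : 1 ≤ T) (hpT : (p : ℤ) ≤ round T) {s : State Name}
    (h : RoundEnv n B M e Z σ b α T x s) {U : ℤ → ℤ → ℂ}
    (hU : U = fun a j => binValue B M (8 * round T + 8).toNat Z α (4 * B / α * √(2 * T))
      ((1 - α / 2) / (2 * B)) x (s.intArr .zlist) (s.intArr .zhat) (round (8 * B / α * T) + 1)
      σ a b j) :
    ∃ Z' : ℕ, Z' ≤ Z + B ∧ (recover.exec s).intReg .zcnt = Z' ∧
      (∀ i, (recover.exec s).intArr .what i = 0) ∧
      Stored n Z' ((recover.exec s).intArr .zlist) ((recover.exec s).intArr .zhat)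
        ((recover.exec s).intArr .seen) ∧
      ∃ inv : ℤ, (n : ℤ) ∣ 1 - σ * inv ∧ ∀ i,
        (∃ j : ℕ, j < B ∧ 1 / 2 < ‖U 0 j‖ ∧ decodeTarget n inv (U 0 j) (U 1 j) = i ∧
          (recover.exec s).intArr .zhat i = s.intArr .zhat i + round (U 0 j).re) ∨
        ((∀ j : ℕ, j < B → 1 / 2 < ‖U 0 j‖ → decodeTarget n inv (U 0 j) (U 1 j) ≠ i) ∧
          (recover.exec s).intArr .zhat i = s.intArr .zhat i) := by
  classical
  have hn0 : (0 : ℤ) < n := by exact_mod_cast NeZero.pos n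
  have hinv := exec_newton hσ (s := s) (p := p) (by rw [h.n_eq, hn]; push_cast; rfl) h.sigma_eq
    (by rw [h.T_eq]; exact hpT)
  have h₀ := h.hashEnv hT
  set s₀ := (Stmt.loop .i (roundE (real .T)) newtonBody).exec
        ((Name.sigmaInv ≔ (1 : IExpr)).exec s) with hs₀
  set inv := s₀.intReg .sigmaInv with hi
  set s₁ := windowParameters.exec s₀ with hs₁
  set s₂ := (hashToBins 0 .u).exec s₁ with hs₂
  have h₂ := h₀.exec (hashToBins 0 .u) rfl
  rw [← hs₂] at h₂
  set s₃ := (hashToBins 1 .u').exec s₂ with hs₃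
  have h₃ := h₂.exec (hashToBins 1 .u') rfl
  rw [← hs₃] at h₃
  have hu : ∀ j : ℤ, 0 ≤ j → j < B → s₃.cpxArr .u j = U 0 j := fun j h1 h2 => by
    rw [hs₃, exec_cpxArr _ _ _ rfl, hs₂, exec_hashToBins (a' := 0) (fun _ => rfl) (Or.inl rfl) hBe h₀
      h1 h2, hU]
  have hu' : ∀ j : ℤ, 0 ≤ j → j < B → s₃.cpxArr .u' j = U 1 j := fun j h1 h2 => by
    rw [hs₃, exec_hashToBins (a' := 1) (fun _ => rfl) (Or.inr rfl) hBe h₂ h1 h2, hU]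
  have hrec : recover.exec s = (Stmt.loop .l (int .wcnt) updateBody).exec
      ((Stmt.loop .j (int .B) decodeBody).exec ((Name.wcnt ≔ (0 : IExpr)).exec s₃)) := rfl
  rw [hrec]
  set s₄ := (Name.wcnt ≔ (0 : IExpr)).exec s₃ with hs₄
  have f1 : s₃.intReg .sigmaInv = inv :=
    (exec_intReg _ _ _ rfl).trans ((exec_intReg _ _ _ rfl).trans (exec_intReg _ _ _ rfl))
  have f2 : s₃.intArr .what = s.intArr .what :=
    (exec_intArr _ _ _ rfl).trans ((exec_intArr _ _ _ rfl).trans ((exec_intArr _ _ _ rfl).trans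
      ((exec_intArr _ _ _ rfl).trans (exec_intArr _ _ _ rfl))))
  have f3 : s₃.intArr .seen = s.intArr .seen :=
    (exec_intArr _ _ _ rfl).trans ((exec_intArr _ _ _ rfl).trans ((exec_intArr _ _ _ rfl).trans
      ((exec_intArr _ _ _ rfl).trans (exec_intArr _ _ _ rfl))))
  have hD := exec_loop_induct (v := .j) (e := int .B) (s := s₄) (body := decodeBody)
    (Decoded n inv (s₃.cpxArr .u) (s₃.cpxArr .u'))
    ⟨by simp [hs₄, h₃.n_eq], by simp [hs₄, f1], by simp [hs₄], by simp [hs₄], by simp [hs₄], by simp [hs₄],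
      fun l hl => by simp [hs₄] at hl; omega, fun i => Or.inr ⟨fun j hj => by omega,
        by simp [hs₄, f2, h.what_eq], fun l hl => by simp [hs₄] at hl; omega⟩⟩
    (fun j _ s' h' => h'.step hn0)
  have hB4 : intVal s₄ (int .B) = B := by simp [hs₄, h₃.B_eq]
  rw [hB4, Int.toNat_natCast] at hD
  set s₅ := (Stmt.loop .j (int .B) decodeBody).exec s₄ with hs₅
  have g1 : s₅.intReg .zcnt = Z := by
    rw [hs₅, exec_intReg _ _ _ rfl, hs₄, exec_intReg _ _ _ rfl, h₃.zcnt_eq]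
  have g2 : s₅.intArr .zlist = s.intArr .zlist := by
    rw [hs₅, exec_intArr _ _ _ rfl, hs₄, exec_intArr _ _ _ rfl, h₃.zlist_eq]
  have g3 : s₅.intArr .zhat = s.intArr .zhat := by
    rw [hs₅, exec_intArr _ _ _ rfl, hs₄, exec_intArr _ _ _ rfl, h₃.zhat_eq]
  have g4 : s₅.intArr .seen = s.intArr .seen := by
    rw [hs₅, exec_intArr _ _ _ rfl, hs₄, exec_intArr _ _ _ rfl, f3]
  have hUp := exec_loop_induct (v := .l) (e := int .wcnt) (s := s₅) (body := updateBody)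
    (Updated n Z (s₅.intArr .wlist) (s₅.intArr .what) (s₅.intArr .zhat))
    ⟨rfl, by simp [g1], by simp [g1], by rw [g1, g2, g3, g4]; exact h.stored,
      fun i ⟨l, hl, _⟩ => by omega, fun i _ => ⟨rfl, rfl⟩⟩
    (fun j hj s' h' => h'.step (hD.range j hj).1 (hD.range j hj).2)
  rw [intVal_reg] at hUp
  set s₆ := (Stmt.loop .l (int .wcnt) updateBody).exec s₅ with hs₆
  have hw0 := hD.wcnt_nonneg
  have hwB := hD.wcnt_le
  have hz0 := hUp.zcnt_nonneg
  have hzB := hUp.zcnt_le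
  refine ⟨(s₆.intReg .zcnt).toNat, by omega, by omega, fun i => ?_, hUp.stored, inv, ?_,
    fun i => ?_⟩
  · by_cases hm : ∃ l : ℕ, l < (s₅.intReg .wcnt).toNat ∧ s₅.intArr .wlist l = i
    · exact (hUp.eq_of_mem i hm).2
    · rw [(hUp.eq_of_not_mem i hm).2]
      rcases hD.what_eq i with ⟨j, -, -, -, -, l, h1, h2⟩ | ⟨-, h2, -⟩
      · exact absurd ⟨l, by omega, h2⟩ hm
      · exact h2
  · rw [hn]; push_cast; exact hinv
  · rcases hD.what_eq i with ⟨j, h1, h2, h3, h4, l, h5, h6⟩ | ⟨h1, -, h3⟩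
    · refine Or.inl ⟨j, h1, ?_⟩
      have := (hUp.eq_of_mem i ⟨l, by omega, h6⟩).1
      rw [hu j (by omega) (by omega)] at h2 h3 h4
      rw [hu' j (by omega) (by omega)] at h3
      refine ⟨h2, h3, ?_⟩
      rw [this, h4, g3]
    · refine Or.inr ⟨fun j hj => ?_, ?_⟩
      · have := h1 j hj
        rwa [hu j (by omega) (by omega), hu' j (by omega) (by omega)] at this
      · have := (hUp.eq_of_not_mem i fun ⟨l, hl, hli⟩ => h3 l (by omega) hli).1
        rw [this, g3]

end RoundCorrectness

/-! ### How a round changes the residual -/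

section Residual

variable {n B M e Z N : ℕ} {σ b R : ℤ} {α T τ C : ℝ} {x : ZMod n → ℂ}

theorem Stored.eq_zero {zl zh seen : ℤ → ℤ} (h : Stored n Z zl zh seen) {i : ℤ}
    (hi : ¬ ∃ l : ℕ, l < Z ∧ zl l = i) : zh i = 0 := by
  by_contra h1
  exact hi ((h.seen_iff i).1 (h.supp i h1))

/-- The sum over the list of stored coefficients is a sum over all of them. -/
theorem Stored.sum_eq [NeZero n] {zl zh seen : ℤ → ℤ} (h : Stored n Z zl zh seen) {F : ℤ → ℂ}
    (hF : ∀ i, zh i = 0 → F i = 0) :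
    ∑ l ∈ Finset.range Z, F (zl l) = ∑ f : ZMod n, F f.val := by
  have hval : ∀ l : ℕ, l < Z → (((zl l : ℤ) : ZMod n).val : ℤ) = zl l := fun l hl => by
    rw [ZMod.val_intCast]
    exact Int.emod_eq_of_lt (h.range l hl).1 (h.range l hl).2
  refine Finset.sum_of_injOn (fun l : ℕ => ((zl l : ℤ) : ZMod n)) ?_ (fun _ _ => Finset.mem_coe.2 (Finset.mem_univ _))
    ?_ ?_
  · intro l hl l' hl' e
    have hl := Finset.mem_range.1 (Finset.mem_coe.1 hl)
    have hl' := Finset.mem_range.1 (Finset.mem_coe.1 hl')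
    have := congrArg (fun z : ZMod n => (z.val : ℤ)) e
    simp only [hval l hl, hval l' hl'] at this
    exact h.inj l hl l' hl' this
  · intro f _ hf
    refine hF _ (h.eq_zero ?_)
    rintro ⟨l, hl, hlf⟩
    refine hf ⟨l, by simpa using hl, ?_⟩
    simp [hlf]
  · intro l hl
    rw [hval l (Finset.mem_range.1 hl)]

/-- The statement of `norm_bin_sub_le` for the bins that the program computes from its list of known
coefficients. -/
theorem norm_binValue_sub_le [NeZero n] {X : ZMod n → ℤ} (hX : ∀ f, spectrum x f = X f)
    (h : WindowParams B α T τ C R N) (hn : n = B * M) {zl zh seen : ℤ → ℤ}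
    (hst : Stored n Z zl zh seen) (a : ℤ) {j : ℤ} (hj0 : 0 ≤ j) (hj : j < B) :
    ‖binValue B M N Z α τ C x zl zh R σ a b j - ∑ f : ZMod n, (if binOf n B M σ b f.val = j then
          (windowFreq B α τ C N (binOffset M (σ * (f.val - b) % n) / n) : ℂ)
            * (X f - zh f.val : ℤ) * root (a * σ * f.val) n else 0)‖
      ≤ (∑ f : ZMod n, |(X f : ℝ)|) * (4 * Real.exp (-T)) := by
  have := norm_bin_sub_le x X (fun f => zh f.val) hX h hn σ a b hj0 hj
  unfold binValue
  rw [hst.sum_eq (F := fun i => if binOf n B M σ b i = j then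
    subtractTerm B M N α τ C n σ a b i (zh i) else 0)]
  · exact this
  · intro i hi
    simp [hi, subtractTerm]

theorem windowFreq_eq_one (hn : 0 < n) {q : ℤ} (h : ¬ inTransition B n M α q) :
    windowFreq B α τ C N (binOffset M q / n) = 1 := by
  unfold windowFreq
  rw [if_pos]
  unfold inTransition at h
  push Not at h
  have hn' : (0 : ℝ) < n := by exact_mod_cast hn
  rw [abs_div, Nat.abs_cast, mul_div_assoc', div_le_iff₀ hn']
  exact h

theorem binOf_nonneg (hB : 0 < B) (f : ℤ) : 0 ≤ binOf n B M σ b f :=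
  Int.emod_nonneg _ (by omega)

theorem binOf_lt (hB : 0 < B) (f : ℤ) : binOf n B M σ b f < B :=
  Int.emod_lt_of_pos _ (by omega)

/-- If the errors in the bins are small, one round turns the residual `r` into a residual whose
support is at most twice as large as the set of bad coefficients of `r`. -/
theorem card_residual_round_le [NeZero n] (hn2 : 2 ≤ n) (hB : 0 < B) {r r' : ZMod n → ℤ}
    {U : ℤ → ℤ → ℂ} {η : ℝ} (hη : η ≤ 1 / (64 * n ^ 2))
    (hU : ∀ a j : ℤ, 0 ≤ j → j < B → ‖U a j - ∑ f : ZMod n, (if binOf n B M σ b f.val = j then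
          (windowFreq B α τ C N (binOffset M (σ * (f.val - b) % n) / n) : ℂ)
            * r f * root (a * σ * f.val) n else 0)‖ ≤ η)
    {inv : ℤ} (hinv : (n : ℤ) ∣ 1 - σ * inv)
    (h : ∀ f : ZMod n, (∃ j : ℕ, j < B ∧ 1 / 2 < ‖U 0 j‖ ∧
          decodeTarget n inv (U 0 j) (U 1 j) = f.val ∧ r' f = r f - round (U 0 j).re) ∨
        ((∀ j : ℕ, j < B → 1 / 2 < ‖U 0 j‖ → decodeTarget n inv (U 0 j) (U 1 j) ≠ f.val) ∧
          r' f = r f)) :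
    (Finset.univ.filter fun f => r' f ≠ 0).card
      ≤ 2 * (badSet B M α σ b (Finset.univ.filter fun f => r f ≠ 0)).card := by
  classical
  have hn0 : (0 : ℤ) < n := by omega
  have htgt : ∀ (j : ℤ) (f : ZMod n), ((decodeTarget n inv (U 0 j) (U 1 j) : ℤ) : ZMod n) = f ↔
      decodeTarget n inv (U 0 j) (U 1 j) = f.val := by
    intro j f
    have h0 : 0 ≤ decodeTarget n inv (U 0 j) (U 1 j) := Int.emod_nonneg _ hn0.ne'
    have h1 : decodeTarget n inv (U 0 j) (U 1 j) < n := Int.emod_lt_of_pos _ hn0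
    constructor
    · rintro rfl
      rw [ZMod.val_intCast, Int.emod_eq_of_lt h0 h1]
    · intro h2
      rw [h2]
      simp
  refine card_residual_le (r := r) (bin := fun f => binOf n B M σ b f.val)
    (active := fun j => 1 / 2 < ‖U 0 j‖)
    (target := fun j => ((decodeTarget n inv (U 0 j) (U 1 j) : ℤ) : ZMod n))
    (val := fun j => round (U 0 j).re) (J := {j | 0 ≤ j ∧ j < B}) ?_ ?_ ?_
  · intro f
    rcases h f with ⟨j, h1, h2, h3, h4⟩ | ⟨h1, h2⟩
    · exact Or.inl ⟨j, ⟨by omega, by omega⟩, h2, (htgt _ _).2 h3, h4⟩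
    · refine Or.inr ⟨fun j hj hact => ?_, h2⟩
      obtain ⟨j', rfl⟩ := Int.eq_ofNat_of_zero_le hj.1
      exact fun h3 => h1 j' (by exact_mod_cast hj.2) hact ((htgt _ _).1 h3)
  · intro j hj hact
    by_contra hne
    push Not at hne
    have h1 := hU 0 j hj.1 hj.2
    rw [Finset.sum_eq_zero, sub_zero] at h1
    · exact empty_bin hn2 (h1.trans hη) hact
    · intro f _
      by_cases hf : r f = 0
      · simp [hf]
      · rw [if_neg (hne f hf)]
  · intro f hf hbad
    have h0 := binOf_nonneg (n := n) (M := M) (σ := σ) (b := b) hB (f.val : ℤ)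
    have h1 := binOf_lt (n := n) (M := M) (σ := σ) (b := b) hB (f.val : ℤ)
    unfold badSet at hbad
    simp only [Finset.mem_filter, Finset.mem_univ, true_and, not_and, not_or, not_exists] at hbad
    obtain ⟨hcol, htr⟩ := hbad hf
    have hsum : ∀ a : ℤ, ∑ f' : ZMod n, (if binOf n B M σ b f'.val = binOf n B M σ b f.val then
          (windowFreq B α τ C N (binOffset M (σ * (f'.val - b) % n) / n) : ℂ)
            * r f' * root (a * σ * f'.val) n else 0) = r f * root (a * σ * f.val) n := by
      intro a
      rw [Finset.sum_eq_single f]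
      · rw [if_pos rfl, windowFreq_eq_one (by omega) htr]
        simp
      · intro f' _ hne
        by_cases hf' : r f' = 0
        · simp [hf']
        · rw [if_neg fun h2 => hcol f' hf' hne h2.symm]
      · simp
    have hU0 := (hU 0 _ h0 h1).trans hη
    have hU1 := (hU 1 _ h0 h1).trans hη
    rw [hsum] at hU0 hU1
    have hroot : root (0 * σ * f.val) n = 1 := by simp [root]
    rw [hroot, mul_one] at hU0
    rw [one_mul] at hU1
    obtain ⟨h2, h3, h4⟩ := decode_bin hn2 hf hU0 hU1
    refine ⟨⟨h0, h1⟩, h2, (htgt _ _).2 ?_, h3⟩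
    unfold decodeTarget
    have h5 : inv * round (phase (U 0 (binOf n B M σ b f.val) / U 1 (binOf n B M σ b f.val)) *
        n / (2 * Real.pi)) ≡ f.val [ZMOD n] := by
      refine (h4.mul_left inv).trans ?_
      rw [Int.modEq_iff_dvd]
      have := hinv.mul_right (f.val : ℤ)
      rwa [show (f.val : ℤ) - inv * (σ * f.val) = (1 - σ * inv) * f.val by ring]
    have h6 := h5.eq
    push_cast at h6 ⊢
    rw [h6]
    exact Int.emod_eq_of_lt (by omega) (by exact_mod_cast ZMod.val_lt f)

/-- If each bin has width one, no coefficient is bad. -/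
theorem badSet_eq_empty [NeZero n] {p : ℕ} (hn : n = 2 ^ p) (hα : α ≤ 1) (hσ : σ % 2 = 1)
    (S : Finset (ZMod n)) : badSet n 1 α σ b S = ∅ := by
  classical
  unfold badSet
  rw [Finset.filter_eq_empty_iff]
  rintro f - (⟨f', -, hne, h⟩ | h)
  · apply hne
    obtain ⟨d, hd, hmod⟩ := binIndex_eq_imp (n := n) one_pos (mul_one _).symm h
    have hd0 : d = 0 := by have := abs_lt.1 hd; omega
    rw [hd0] at hmod
    have h1 : σ * (f.val - b) ≡ σ * (f'.val - b) [ZMOD n] := by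
      have h2 : σ * (f.val - b) % n ≡ σ * (f'.val - b) % n [ZMOD n] := by
        have := hmod.add_right (σ * (f'.val - b) % n)
        simpa using this
      exact (Int.mod_modEq _ _).symm.trans (h2.trans (Int.mod_modEq _ _))
    have hcop : IsCoprime (n : ℤ) σ := by
      rw [hn]; push_cast
      refine IsCoprime.pow_left ?_
      rw [Int.isCoprime_iff_gcd_eq_one]
      exact (Int.prime_two.coprime_iff_not_dvd.2 (by omega) |> Int.isCoprime_iff_gcd_eq_one.1)
    have h2 : (n : ℤ) ∣ (f'.val : ℤ) - f.val := by
      have h3 := h1.dvd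
      rw [show σ * ((f'.val : ℤ) - b) - σ * (f.val - b) = σ * (f'.val - f.val) by ring] at h3
      exact hcop.dvd_of_dvd_mul_left h3
    have h3 : ((f.val : ℤ) : ZMod n) = ((f'.val : ℤ) : ZMod n) := by
      rw [ZMod.intCast_eq_intCast_iff, Int.modEq_iff_dvd]; exact h2
    simpa using h3.symm
  · exact not_inTransition_of_width_one hα _ h

end Residual

/-! ### The cost of a round with given random choices -/

section RoundSteps

variable {n B M e Z : ℕ} {σ b : ℤ} {α T : ℝ} {x : ZMod n → ℂ}

open scoped Classical in
/-- The cost of a round once `σ` and `b` have been drawn. -/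
theorem steps_recover_le [NeZero n] (hT : 1 ≤ T) {s : State Name}
    (h : RoundEnv n B M e Z σ b α T x s) :
    recover.steps s ≤ 400 + 20 * (round T).toNat + 200 * B
      + 400 * (2 * (round (8 * B / α * T) + 1) + 1).toNat + e * (160 * B + 40)
      + ∑ l ∈ Finset.range Z, (400 + if inTransition B n M α (σ * (s.intArr .zlist l - b) % n) then
        60 * (8 * round T + 8).toNat else 0) := by
  have hn0 : (0 : ℤ) < n := by exact_mod_cast NeZero.pos n
  have h₁ := h.hashEnv hT
  have c1 : (Name.sigmaInv ≔ (1 : IExpr)).steps s ≤ 2 := Stmt.steps_le _ rfl (by decide)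
  have c2 := Stmt.steps_simpleLoop_le (x := .i) (e := roundE (real .T)) (body := newtonBody)
    (s := (Name.sigmaInv ≔ (1 : IExpr)).exec s) 20 (round T).toNat rfl (by
      have h1 : intVal ((Name.sigmaInv ≔ (1 : IExpr)).exec s) (roundE (real .T)) = round T := by
        simp [h.T_eq]
      have h2 : 0 ≤ round T := by
        have := abs_le.1 (abs_sub_round T)
        have h1 : (0 : ℝ) < round T := by linarith [this.2]
        exact_mod_cast h1.le
      exact h1.trans (Int.toNat_of_nonneg h2).symm) (Nat.le_of_ble_eq_true rfl)
  have c2' : (roundE (real Name.T)).cost = 2 := rfl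
  set s₀ := (Stmt.loop .i (roundE (real .T)) newtonBody).exec
        ((Name.sigmaInv ≔ (1 : IExpr)).exec s) with hs₀
  have c3 : windowParameters.steps s₀ ≤ 60 := Stmt.steps_le _ rfl (Nat.le_of_ble_eq_true rfl)
  set s₁ := windowParameters.exec s₀ with hs₁
  have c4 := steps_hashToBins_le (a := 0) (Or.inl rfl) (Or.inl rfl : IsBins .u) h₁
  have h₂ := h₁.exec (hashToBins 0 .u) rfl
  set s₂ := (hashToBins 0 .u).exec s₁ with hs₂
  have c5 := steps_hashToBins_le (a := 1) (Or.inr rfl) (Or.inr rfl : IsBins .u') h₂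
  have h₃ := h₂.exec (hashToBins 1 .u') rfl
  set s₃ := (hashToBins 1 .u').exec s₂ with hs₃
  have c6 : (Name.wcnt ≔ (0 : IExpr)).steps s₃ ≤ 2 := Stmt.steps_le _ rfl (by decide)
  have hB₄ : ((Name.wcnt ≔ (0 : IExpr)).exec s₃).intReg .B = B := by simp [h₃.B_eq]
  have c7 := Stmt.steps_simpleLoop_le (x := .j) (e := int .B) (body := decodeBody)
    (s := (Name.wcnt ≔ (0 : IExpr)).exec s₃) 80 B rfl hB₄ (Nat.le_of_ble_eq_true rfl)
  have c7' : (int Name.B).cost = 1 := rfl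
  set s₄ := (Name.wcnt ≔ (0 : IExpr)).exec s₃ with hs₄
  have hw := exec_loop_induct (v := .j) (e := int .B) (s := s₄) (body := decodeBody)
    (fun J s' => 0 ≤ s'.intReg .wcnt ∧ s'.intReg .wcnt ≤ J) (by simp [hs₄]) (by
      classical
      rintro J - s' ⟨h1, h2⟩
      unfold decodeBody
      rw [exec_ifThen]
      split_ifs <;> simp <;> omega)
  have hB₄' : intVal s₄ (int .B) = B := hB₄
  rw [hB₄', Int.toNat_natCast] at hw
  set s₅ := (Stmt.loop .j (int .B) decodeBody).exec s₄ with hs₅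
  obtain ⟨w, hw'⟩ := Int.eq_ofNat_of_zero_le hw.1
  have c8 := Stmt.steps_simpleLoop_le (x := .l) (e := int .wcnt) (body := updateBody)
    (s := s₅) 60 w rfl hw' (Nat.le_of_ble_eq_true rfl)
  have c8' : (int Name.wcnt).cost = 1 := rfl
  have hwB : w ≤ B := by omega
  have hrec : recover.steps s = (Name.sigmaInv ≔ (1 : IExpr)).steps s +
    ((Stmt.loop .i (roundE (real .T)) newtonBody).steps ((Name.sigmaInv ≔ (1 : IExpr)).exec s) +
    (windowParameters.steps s₀ + ((hashToBins 0 .u).steps s₁ + ((hashToBins 1 .u').steps s₂ +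
    ((Name.wcnt ≔ (0 : IExpr)).steps s₃ + ((Stmt.loop .j (int .B) decodeBody).steps s₄ +
    (Stmt.loop .l (int .wcnt) updateBody).steps s₅)))))) := rfl
  have hsum : ∑ l ∈ Finset.range Z, (400 + if inTransition B n M α
      (σ * (s.intArr .zlist l - b) % n) then 60 * (8 * round T + 8).toNat else 0) =
    2 * ∑ l ∈ Finset.range Z, (200 + if inTransition B n M α
      (σ * (s.intArr .zlist l - b) % n) then 30 * (8 * round T + 8).toNat else 0) := by
    rw [Finset.mul_sum]
    refine Finset.sum_congr rfl fun l _ => ?_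
    split_ifs <;> ring
  have he : e * (160 * B + 40) = 2 * (e * (80 * B + 20)) := by ring
  rw [hrec, hsum, he]
  omega

end RoundSteps

/-! ### Expectations over the runs of a program -/

section Expectation

open scoped ENNReal

/-- The expectation of `g` under the law `p`. -/
noncomputable def expect {α : Type*} (p : PMF α) (g : α → ℝ≥0∞) : ℝ≥0∞ := ∑' r, p r * g r

theorem expect_pure {α : Type*} (a : α) (g : α → ℝ≥0∞) : expect (PMF.pure a) g = g a := by
  unfold expect
  rw [tsum_eq_single a]
  · simp
  · intro b hb
    simp [hb]

theorem expect_bind {α β : Type*} (p : PMF α) (f : α → PMF β) (g : β → ℝ≥0∞) :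
    expect (p.bind f) g = expect p fun a => expect (f a) g := by
  unfold expect
  simp only [PMF.bind_apply, ← ENNReal.tsum_mul_right, ← ENNReal.tsum_mul_left]
  rw [ENNReal.tsum_comm]
  simp only [mul_assoc]

theorem expect_map {α β : Type*} (p : PMF α) (f : α → β) (g : β → ℝ≥0∞) :
    expect (p.map f) g = expect p fun a => g (f a) := by
  unfold PMF.map
  rw [expect_bind]
  simp [expect_pure]

theorem expect_mono {α : Type*} (p : PMF α) {g g' : α → ℝ≥0∞}
    (h : ∀ a ∈ p.support, g a ≤ g' a) : expect p g ≤ expect p g' := by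
  refine ENNReal.tsum_le_tsum fun a => ?_
  by_cases ha : p a = 0
  · simp [ha]
  · exact mul_le_mul_right (h a ((p.mem_support_iff a).2 ha)) _

theorem expect_const {α : Type*} (p : PMF α) (c : ℝ≥0∞) : expect p (fun _ => c) = c := by
  unfold expect
  rw [ENNReal.tsum_mul_right, p.tsum_coe, one_mul]

theorem expect_add {α : Type*} (p : PMF α) (g g' : α → ℝ≥0∞) :
    expect p (fun a => g a + g' a) = expect p g + expect p g' := by
  unfold expect
  simp only [mul_add]
  exact ENNReal.tsum_add

theorem forall_mem_support_of_expect {α : Type*} {p : PMF α} {Q : α → Prop} [DecidablePred Q]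
    (h : expect p (fun a => if Q a then 0 else 1) = 0) : ∀ a ∈ p.support, Q a := by
  intro a ha
  by_contra hQ
  unfold expect at h
  have := ENNReal.tsum_eq_zero.1 h a
  simp [hQ] at this
  exact (p.mem_support_iff a).1 ha this

variable {V : Type}

theorem expect_charge (c : ℕ) (p : RunM V) (g : State V × ℕ → ℝ≥0∞) :
    expect (RunM.charge c p) g = expect p fun r => g (r.1, c + r.2) := expect_map ..

theorem expect_andThen (p : RunM V) (f : State V → RunM V) (g : State V × ℕ → ℝ≥0∞) :
    expect (RunM.andThen p f) g
      = expect p fun r => expect (f r.1) fun r' => g (r'.1, r.2 + r'.2) := by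
  unfold RunM.andThen
  rw [expect_bind]
  simp only [expect_map]

theorem expect_seq_of_randFree [DecidableEq V] {s₁ s₂ : Stmt V} (h : s₁.randFree = true) (s : State V)
    (g : State V × ℕ → ℝ≥0∞) : expect ((Stmt.seq s₁ s₂).run s) g
      = expect (s₂.run (s₁.exec s)) fun r => g (r.1, s₁.steps s + r.2) := by
  have : (Stmt.seq s₁ s₂).run s = RunM.andThen (s₁.run s) s₂.run := rfl
  rw [this, s₁.run_eq_pure h, expect_andThen, expect_pure]

theorem expect_of_randFree [DecidableEq V] {s₁ : Stmt V} (h : s₁.randFree = true) (s : State V)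
    (g : State V × ℕ → ℝ≥0∞) : expect (s₁.run s) g = g (s₁.exec s, s₁.steps s) := by
  rw [s₁.run_eq_pure h, expect_pure]

theorem expect_uniformRange {m : ℕ} (hm : 0 < m) (g : ℕ → ℝ≥0∞) :
    expect (PMF.uniformOfFinset (Finset.range (m - 1 + 1)) Finset.nonempty_range_add_one) g
      = (∑ j ∈ Finset.range m, g j) / m := by
  unfold expect
  simp only [PMF.uniformOfFinset_apply, Nat.sub_add_cancel hm, Finset.card_range]
  rw [tsum_eq_sum (s := Finset.range m)]
  · rw [ENNReal.div_eq_inv_mul, Finset.mul_sum]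
    exact Finset.sum_congr rfl fun j hj => by rw [if_pos hj]
  · intro j hj
    rw [if_neg hj, zero_mul]

theorem expect_seq_rand {v : Name} {e : IExpr} {st : Stmt Name} (s : State Name) {m : ℕ} (hm : 0 < m)
    (he : intVal s e = m) (g : State Name × ℕ → ℝ≥0∞) :
    expect ((Stmt.seq (.rand v e) st).run s) g
      = (∑ j ∈ Finset.range m, expect (st.run (s.setInt v j)) fun r => g (r.1, e.cost + 1 + r.2))
        / m := by
  have h1 : (Stmt.seq (.rand v e) st).run s = RunM.andThen ((Stmt.rand v e).run s) st.run := rfl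
  have h2 : (Stmt.rand v e).run s = (PMF.uniformOfFinset (Finset.range (m - 1 + 1))
        Finset.nonempty_range_add_one).map fun j : ℕ => (s.setInt v (j : ℤ), e.cost + 1) := by
    obtain rfl : m = (e.eval s : ℤ).toNat := by
      have : (e.eval s : ℤ) = m := he
      rw [this, Int.toNat_natCast]
    have h4 : (Stmt.rand v e).run s = ((PMF.uniformOfFinset
        (Finset.range ((e.eval s : ℤ).toNat - 1 + 1)) Finset.nonempty_range_add_one).bind
          fun a => PMF.pure (a : ℤ)).map fun j : ℤ => (s.setInt v j, e.cost + 1) := rfl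
    rw [h4, PMF.map_bind]
    simp only [PMF.pure_map]
    rfl
  rw [h1, expect_andThen, h2, expect_map, expect_uniformRange hm]

/-- If in each round the expectation of the potential `w` plus `lam` times the number of steps grows
by at most `c`, then these growths add up. -/
theorem expect_iterate_le {f : ℕ → State V → RunM V} {Inv : ℕ → State V → Prop}
    {w : ℕ → State V → ℝ≥0∞} {c : ℕ → ℝ≥0∞} {lam : ℝ≥0∞} {m : ℕ} {s : State V} (h0 : Inv 0 s)
    (hinv : ∀ t < m, ∀ s, Inv t s → ∀ r ∈ (f t s).support, Inv (t + 1) r.1)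
    (hstep : ∀ t < m, ∀ s, Inv t s →
      expect (f t s) (fun r => w (t + 1) r.1 + lam * r.2) ≤ w t s + c t) :
    (∀ r ∈ (RunM.iterate f m s).support, Inv m r.1) ∧
    expect (RunM.iterate f m s) (fun r => w m r.1 + lam * r.2)
      ≤ w 0 s + ∑ t ∈ Finset.range m, c t := by
  induction m with
  | zero =>
    refine ⟨fun r hr => ?_, ?_⟩
    · simp [RunM.iterate] at hr
      rw [hr]; exact h0
    · simp [RunM.iterate, expect_pure]
  | succ m ih =>
    obtain ⟨ih1, ih2⟩ := ih (fun t ht => hinv t (by omega)) (fun t ht => hstep t (by omega))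
    simp only [RunM.iterate]
    refine ⟨fun r hr => ?_, ?_⟩
    · unfold RunM.andThen at hr
      rw [PMF.mem_support_bind_iff] at hr
      obtain ⟨q, hq, hr⟩ := hr
      rw [PMF.mem_support_map_iff] at hr
      obtain ⟨q', hq', rfl⟩ := hr
      exact hinv m (by omega) _ (ih1 q hq) q' hq'
    · rw [expect_andThen, Finset.sum_range_succ, ← add_assoc]
      calc expect (RunM.iterate f m s) (fun r => expect (f m r.1) fun r' =>
              w (m + 1) r'.1 + lam * ((r.2 + r'.2 : ℕ) : ℝ≥0∞))
          ≤ expect (RunM.iterate f m s) (fun r => (w m r.1 + lam * r.2) + c m) := by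
            refine expect_mono _ fun r hr => ?_
            have h1 : ∀ r' : State V × ℕ, w (m + 1) r'.1 + lam * ((r.2 + r'.2 : ℕ) : ℝ≥0∞)
                = (w (m + 1) r'.1 + lam * r'.2) + lam * r.2 := fun r' => by
              push_cast; ring
            simp only [h1]
            rw [expect_add, expect_const]
            calc _ ≤ (w m r.1 + c m) + lam * r.2 := by
                  gcongr; exact hstep m (by omega) _ (ih1 r hr)
              _ = _ := by ring
        _ ≤ _ := by
            rw [expect_add, expect_const]
            gcongr

end Expectation

/-! ### The law of one round -/

section RoundLaw

open scoped ENNReal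

/-- The body of the outer loop. -/
def roundBody (m d a : ℕ) : Stmt Name :=
  .alpha ≔ 1 / (toR (.lit (2 ^ a)) * sqrtE (toR (int .pw))) ;;
  noiselessSparseFFTInner m d ;;
  .kt ≔ int .kt / 2 ;;
  .pw ≔ 2 * int .pw

/-- The memory just before the random choices of a round. -/
noncomputable def prepared (m d a : ℕ) (s : State Name) : State Name :=
  (powerOfTwoAbove .Q .logB (int .B)).exec ((Name.M ≔ int .n / int .B).exec ((chooseBins m d).exec
    ((Name.alpha ≔ 1 / (toR (.lit (2 ^ a)) * sqrtE (toR (int .pw)))).exec s)))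

/-- The memory just after the random choices of a round. -/
def drawn (s : State Name) (j b : ℕ) : State Name :=
  ((s.setInt .sigma j).setInt .sigma (2 * j + 1)).setInt .b b

/-- The memory after a round with the random choices `j` and `b`. -/
noncomputable def afterRound (m d a : ℕ) (s : State Name) (j b : ℕ) : State Name :=
  (Name.pw ≔ 2 * int .pw).exec ((Name.kt ≔ int .kt / 2).exec
    (recover.exec (drawn (prepared m d a s) j b)))

/-- A round draws `j` and `b` uniformly and is deterministic otherwise. -/
theorem expect_roundBody {m d a n B J : ℕ} {s : State Name} (hJ : 0 < J) (hn0 : 0 < n)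
    (hn : (prepared m d a s).intReg .n = n) (hJn : n / 2 = J)
    (hB : ((chooseBins m d).exec
      ((Name.alpha ≔ 1 / (toR (.lit (2 ^ a)) * sqrtE (toR (int .pw)))).exec s)).intReg .B = B) :
    ∃ c : ℕ, c ≤ 100 + 20 * B ∧ ∀ g : State Name × ℕ → ℝ≥0∞,
      expect ((roundBody m d a).run s) g = (∑ j ∈ Finset.range J, (∑ b ∈ Finset.range n,
        g (afterRound m d a s j b, c + recover.steps (drawn (prepared m d a s) j b))) / n) / J := by
  set s₁ := (Name.alpha ≔ 1 / (toR (.lit (2 ^ a)) * sqrtE (toR (int .pw)))).exec s with hs₁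
  set s₂ := (chooseBins m d).exec s₁ with hs₂
  set s₃ := (Name.M ≔ int .n / int .B).exec s₂ with hs₃
  have hB₃ : s₃.intReg .B = B := by simp [hs₃, hB]
  have hp : prepared m d a s = (powerOfTwoAbove .Q .logB (int .B)).exec s₃ := rfl
  have c1 : (Name.alpha ≔ 1 / (toR (.lit (2 ^ a)) * sqrtE (toR (int .pw)))).steps s ≤ 10 := by
    change 9 + 1 ≤ 10
    exact le_rfl
  have c2 : (chooseBins m d).steps s₁ ≤ 20 := Stmt.steps_le _ rfl (Nat.le_of_ble_eq_true rfl)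
  have c3 : (Name.M ≔ int .n / int .B).steps s₂ ≤ 5 := Stmt.steps_le _ rfl (by decide)
  have c4 := steps_powerOfTwoAbove_le (pow := .Q) (lg := .logB) (v := .B) (by decide) (by decide) s₃
    hB₃
  rw [hp] at hn ⊢
  set s₄ := (powerOfTwoAbove .Q .logB (int .B)).exec s₃ with hs₄
  have hn₄ : intVal s₄ (int .n / 2) = J := by
    rw [intVal_div, intVal_reg, hn, intVal_two, ← hJn]; simp
  refine ⟨(Name.alpha ≔ 1 / (toR (.lit (2 ^ a)) * sqrtE (toR (int .pw)))).steps s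
    + (chooseBins m d).steps s₁ + (Name.M ≔ int .n / int .B).steps s₂
    + (powerOfTwoAbove .Q .logB (int .B)).steps s₃ + 20, by omega, fun g => ?_⟩
  have h1 : (roundBody m d a).run s = (Stmt.seq
    (.alpha ≔ 1 / (toR (.lit (2 ^ a)) * sqrtE (toR (int .pw)))) (Stmt.seq
      (noiselessSparseFFTInner m d) (.kt ≔ int .kt / 2 ;; .pw ≔ 2 * int .pw))).run s := rfl
  have h2 : ∀ s, (Stmt.seq (noiselessSparseFFTInner m d)
      (.kt ≔ int .kt / 2 ;; .pw ≔ 2 * int .pw)).run s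
      = RunM.andThen ((noiselessSparseFFTInner m d).run s)
        (Stmt.run (.kt ≔ int .kt / 2 ;; .pw ≔ 2 * int .pw)) := fun _ => rfl
  rw [h1, expect_seq_of_randFree rfl, h2, expect_andThen, noiselessSparseFFTInner_eq,
    expect_seq_of_randFree rfl, expect_seq_of_randFree rfl, expect_seq_of_randFree rfl,
    ← hs₁, ← hs₂, ← hs₃, ← hs₄, expect_seq_rand s₄ hJ hn₄]
  congr 1
  refine Finset.sum_congr rfl fun j _ => ?_
  rw [expect_seq_of_randFree rfl]
  have h3 : (Name.sigma ≔ 2 * int .sigma + 1).exec (s₄.setInt .sigma j)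
      = (s₄.setInt .sigma j).setInt .sigma (2 * j + 1) := by simp
  have h4 : intVal ((s₄.setInt .sigma j).setInt .sigma (2 * (j : ℤ) + 1)) (int .n) = n := by
    simp [hn]
  rw [h3, expect_seq_rand _ hn0 h4]
  congr 1
  refine Finset.sum_congr rfl fun b _ => ?_
  rw [expect_of_randFree rfl, expect_of_randFree rfl]
  have h5 : (Name.sigma ≔ 2 * int .sigma + 1).steps (s₄.setInt .sigma j) = 6 := rfl
  have h6 : ∀ s, (Stmt.seq (.kt ≔ int .kt / 2) (.pw ≔ 2 * int .pw) : Stmt Name).steps s = 8 :=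
    fun _ => rfl
  have h7 : (int Name.n / 2 : IExpr).cost = 3 := rfl
  have h8 : (int Name.n).cost = 1 := rfl
  rw [h5, h6, h7, h8]
  have h9 : afterRound m d a s j b = (Stmt.seq (.kt ≔ int .kt / 2) (.pw ≔ 2 * int .pw)).exec
      (recover.exec (((s₄.setInt .sigma j).setInt .sigma (2 * (j : ℤ) + 1)).setInt .b b)) := by
    unfold afterRound
    rw [hp, exec_seq]
    rfl
  have h10 : drawn s₄ j b = ((s₄.setInt .sigma j).setInt .sigma (2 * (j : ℤ) + 1)).setInt .b b := rfl
  rw [h9, h10]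
  dsimp only
  generalize recover.steps _ = A₁
  generalize Stmt.steps (Name.alpha ≔ _) s = A₂
  generalize (chooseBins m d).steps s₁ = A₃
  generalize Stmt.steps (Name.M ≔ _) s₂ = A₄
  generalize (powerOfTwoAbove .Q .logB (int .B)).steps s₃ = A₅
  generalize Stmt.exec _ (recover.exec _) = s₅
  congr 2
  omega

end RoundLaw

/-! ### The invariant of the outer loop -/

section LoopInvariant

/-- What holds before round `t`, for a signal of length `2 ^ p` and for `K = 2 ^ κ`. -/
structure LoopInv (p κ m d : ℕ) (T : ℝ) (x : ZMod (2 ^ p) → ℂ) (t : ℕ) (s : State Name) :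
    Prop where
  n_eq : s.intReg .n = ((2 ^ p : ℕ) : ℤ)
  kt_eq : t ≤ κ → s.intReg .kt = ((2 ^ (κ - t) : ℕ) : ℤ)
  pw_eq : s.intReg .pw = ((2 ^ t : ℕ) : ℤ)
  T_eq : s.realReg .T = T
  x_eq : ∀ j : ℤ, 0 ≤ j → j < (2 ^ p : ℕ) → s.cpxArr .x j = x (j : ZMod (2 ^ p))
  what_eq : ∀ i, s.intArr .what i = 0
  stored : ∃ Z : ℕ, s.intReg .zcnt = Z ∧
    Stored (2 ^ p) Z (s.intArr .zlist) (s.intArr .zhat) (s.intArr .seen) ∧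
    (Z : ℤ) + 2 ^ (m + d + 1) * s.intReg .kt ≤ 2 ^ (m + d + 1) * 2 ^ κ

/-- The logarithm of the number of bins in round `t`. -/
def binExp (p κ m d t : ℕ) : ℕ := if p ≤ m + d + (κ - t) then p else m + (κ - t)

theorem binExp_le (p κ m d t : ℕ) : binExp p κ m d t ≤ p := by
  unfold binExp
  split_ifs <;> omega

theorem binExp_le' (p κ m d t : ℕ) : binExp p κ m d t ≤ m + d + (κ - t) := by
  unfold binExp
  split_ifs <;> omega

/-- The transition width in round `t`. -/
noncomputable def width (a t : ℕ) : ℝ := 1 / (2 ^ a * √(2 ^ t))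

theorem width_pos (a t : ℕ) : 0 < width a t := by unfold width; positivity

theorem width_lt_one {a : ℕ} (ha : 1 ≤ a) (t : ℕ) : width a t < 1 := by
  unfold width
  rw [div_lt_one (by positivity)]
  have h1 : (2 : ℝ) ^ 1 ≤ 2 ^ a := pow_le_pow_right₀ (by norm_num) ha
  have h2 : (1 : ℝ) ≤ √(2 ^ t) := Real.one_le_sqrt.2 (one_le_pow₀ (by norm_num))
  nlinarith

variable {p κ m d a t : ℕ} {T : ℝ} {x : ZMod (2 ^ p) → ℂ} {s : State Name}

theorem LoopInv.bins (h : LoopInv p κ m d T x t s) (ht : t ≤ κ) :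
    ((chooseBins m d).exec
      ((Name.alpha ≔ 1 / (toR (.lit (2 ^ a)) * sqrtE (toR (int .pw)))).exec s)).intReg .B
      = ((2 ^ binExp p κ m d t : ℕ) : ℤ) := by
  classical
  have h1 := h.kt_eq ht
  unfold chooseBins binExp
  rw [exec_ifElse]
  simp only [holds_leInt, exec_setReal, exec_setInt, intVal_reg, intVal_mul, intVal_lit,
    intReg_setReal, h.n_eq, h1]
  have h2 : (((2 ^ p : ℕ) : ℤ) ≤ 2 ^ (m + d) * ((2 ^ (κ - t) : ℕ) : ℤ)) ↔
      p ≤ m + d + (κ - t) := by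
    push_cast
    rw [← pow_add]
    exact pow_le_pow_iff_right₀ (by norm_num)
  simp only [h2]
  split_ifs
  · simp
  · simp; rw [pow_add]

theorem prepared_intReg (v : Name)
    (hv : v ∉ [Name.B, .M, .Q, .logB, .i]) : (prepared m d a s).intReg v = s.intReg v := by
  simp only [List.mem_cons, List.not_mem_nil, or_false, not_or] at hv
  obtain ⟨h1, h2, h3, h4, h5⟩ := hv
  unfold prepared
  rw [exec_intReg _ _ _ (by
      simp [Stmt.writesReg, powerOfTwoAbove, Ne.symm h3, Ne.symm h4, Ne.symm h5]),
    exec_intReg _ _ _ (by simp [Stmt.writesReg, Ne.symm h2]),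
    exec_intReg _ _ _ (by simp [Stmt.writesReg, chooseBins, Ne.symm h1])]
  simp

theorem prepared_intArr (v : Name) : (prepared m d a s).intArr v = s.intArr v := by
  unfold prepared
  rw [exec_intArr _ _ _ rfl, exec_intArr _ _ _ rfl, exec_intArr _ _ _ rfl, exec_intArr _ _ _ rfl]

theorem LoopInv.prepared_spec (h : LoopInv p κ m d T x t s) (ht : t ≤ κ) :
    (prepared m d a s).intReg .B = ((2 ^ binExp p κ m d t : ℕ) : ℤ) ∧
    (prepared m d a s).intReg .M = ((2 ^ (p - binExp p κ m d t) : ℕ) : ℤ) ∧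
    (prepared m d a s).intReg .logB = (binExp p κ m d t : ℕ) := by
  have hB := h.bins (a := a) ht
  unfold prepared
  set s₂ := (chooseBins m d).exec
      ((Name.alpha ≔ 1 / (toR (.lit (2 ^ a)) * sqrtE (toR (int .pw)))).exec s) with hs₂
  set s₃ := (Name.M ≔ int .n / int .B).exec s₂ with hs₃
  have hB₃ : s₃.intReg .B = ((2 ^ binExp p κ m d t : ℕ) : ℤ) := by simp [hs₃, hB]
  obtain ⟨l, -, h2, h3, h4⟩ := exec_powerOfTwoAbove (pow := .Q) (lg := .logB) (v := .B) (by decide)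
    (by decide) (by decide) (by decide) (by decide) (by decide) s₃ (by positivity) hB₃
  have hl : l = binExp p κ m d t := by
    have h5 := (Nat.pow_le_pow_iff_right (by norm_num)).1 h3
    rw [← pow_succ'] at h4
    have h6 := (Nat.pow_lt_pow_iff_right (by norm_num)).1 h4
    omega
  refine ⟨by rw [exec_intReg _ _ _ rfl, hB₃], ?_, by rw [h2, hl]⟩
  rw [exec_intReg _ _ _ rfl]
  have hn₂ : s₂.intReg .n = ((2 ^ p : ℕ) : ℤ) := by
    rw [hs₂, exec_intReg _ _ _ rfl, exec_intReg _ _ _ rfl, h.n_eq]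
  simp only [hs₃, exec_setInt, intReg_setInt, if_true, intVal_div, intVal_reg, hn₂, hB]
  rw [← Int.natCast_div, Nat.pow_div (binExp_le ..) (by norm_num)]

theorem LoopInv.roundEnv (h : LoopInv p κ m d T x t s) (ht : t ≤ κ) {Z : ℕ}
    (hZ : s.intReg .zcnt = Z)
    (hst : Stored (2 ^ p) Z (s.intArr .zlist) (s.intArr .zhat) (s.intArr .seen)) (j b : ℕ) :
    RoundEnv (2 ^ p) (2 ^ binExp p κ m d t) (2 ^ (p - binExp p κ m d t)) (binExp p κ m d t) Z
      (2 * j + 1) b (width a t) T x (drawn (prepared m d a s) j b) := by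
  obtain ⟨h1, h2, h3⟩ := h.prepared_spec (a := a) ht
  have r : ∀ v, (prepared m d a s).realReg v = ((Name.alpha ≔ 1 /
      (toR (.lit (2 ^ a)) * sqrtE (toR (int .pw)))).exec s).realReg v := fun v => by
    unfold prepared
    rw [exec_realReg _ _ _ (by simp [Stmt.writesReg, powerOfTwoAbove]), exec_realReg _ _ _
      (by simp [Stmt.writesReg]), exec_realReg _ _ _ (by simp [Stmt.writesReg, chooseBins])]
  have ca : ∀ v, (prepared m d a s).cpxArr v = s.cpxArr v := fun v => by
    unfold prepared
    rw [exec_cpxArr _ _ _ rfl, exec_cpxArr _ _ _ rfl, exec_cpxArr _ _ _ rfl, exec_cpxArr _ _ _ rfl]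
  have hn := prepared_intReg (m := m) (d := d) (a := a) (s := s) .n (by decide)
  have hz := prepared_intReg (m := m) (d := d) (a := a) (s := s) .zcnt (by decide)
  unfold drawn
  constructor
  all_goals simp only [intReg_setInt, realReg_setInt, intArr_setInt, cpxArr_setInt, reduceCtorEq,
    if_true, if_false, h1, h2, h3, hn, hz, h.n_eq, hZ, r, prepared_intArr, ca]
  · simp [width, h.pw_eq]
  · simp [h.T_eq]
  · exact h.x_eq
  · exact h.what_eq
  · exact hst

end LoopInvariant

/-! ### One round preserves the loop invariant -/

section RoundStep

variable {p κ m d a t : ℕ} {T : ℝ} {x : ZMod (2 ^ p) → ℂ} {s : State Name}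

/-- The indices at which the known part of the spectrum differs from `X`. -/
def residual {n : ℕ} [NeZero n] (X : ZMod n → ℤ) (s : State Name) : Finset (ZMod n) :=
  Finset.univ.filter fun f => X f - s.intArr .zhat f.val ≠ 0

/-- What the analysis needs to know about the accuracy `exp (-T)` and the spectrum `X` of `x`. -/
structure Accurate (p : ℕ) (T : ℝ) (x : ZMod (2 ^ p) → ℂ) (X : ZMod (2 ^ p) → ℤ) : Prop where
  one_le_p : 1 ≤ p
  one_le_T : 1 ≤ T
  p_le : (p : ℤ) ≤ round T
  spectrum_eq : ∀ f, spectrum x f = X f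
  error_le : (∑ f, |(X f : ℝ)|) * (4 * Real.exp (-T)) ≤ 1 / (64 * ((2 ^ p : ℕ) : ℝ) ^ 2)

theorem one_le_binExp (hp : 1 ≤ p) (hm : 1 ≤ m) : 1 ≤ binExp p κ m d t := by
  unfold binExp
  split_ifs <;> omega

/-- Every outcome of a round preserves the invariant, whether or not the round is successful. -/
theorem LoopInv.afterRound {X : ZMod (2 ^ p) → ℤ} (hX : Accurate p T x X) (hm : 1 ≤ m)
    (ha : 1 ≤ a) (h : LoopInv p κ m d T x t s) (ht : t ≤ κ) (j b : ℕ) :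
    LoopInv p κ m d T x (t + 1) (afterRound m d a s j b) ∧
    (residual X (SparseFFT.afterRound m d a s j b)).card ≤
      2 * (badSet (2 ^ binExp p κ m d t) (2 ^ (p - binExp p κ m d t)) (width a t) (2 * j + 1) b
        (residual X s)).card := by
  obtain ⟨Z, hZ, hst, hZB⟩ := h.stored
  have henv := h.roundEnv (a := a) ht hZ hst j b
  set s₁ := drawn (prepared m d a s) j b with hs₁
  have hzh : s₁.intArr .zhat = s.intArr .zhat := by
    rw [hs₁]; unfold drawn; simp [prepared_intArr]
  have hB2 : 2 ≤ 2 ^ binExp p κ m d t :=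
    le_self_pow₀ (by norm_num) (by have := one_le_binExp (p := p) (κ := κ) (m := m) (d := d) (t := t) hX.one_le_p hm; omega)
  have hnBM : 2 ^ p = 2 ^ binExp p κ m d t * 2 ^ (p - binExp p κ m d t) := by
    rw [← pow_add, Nat.add_sub_cancel' (binExp_le ..)]
  have hσ : (2 * (j : ℤ) + 1) % 2 = 1 := by omega
  obtain ⟨Z', hZ', hz', hw', hst', inv, hinv, hres⟩ := exec_recover rfl rfl hσ hX.one_le_T hX.p_le
    henv rfl
  have hwp := WindowParams.of_eq (B := 2 ^ binExp p κ m d t) hB2 (width_pos a t)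
    (width_lt_one ha t) hX.one_le_T
  have hreg : ∀ v, v ∈ [Name.n, .kt, .pw] → (recover.exec s₁).intReg v = s.intReg v := by
    intro v hv
    rw [exec_intReg _ _ _ (by fin_cases hv <;> rfl), hs₁]
    unfold drawn
    fin_cases hv <;> simp [prepared_intReg]
  have hreal : (recover.exec s₁).realReg .T = T := by
    rw [exec_realReg _ _ _ rfl, henv.T_eq]
  have hcpx : (recover.exec s₁).cpxArr .x = s₁.cpxArr .x := exec_cpxArr _ _ _ rfl
  have hafter : SparseFFT.afterRound m d a s j b = (Name.pw ≔ 2 * int .pw).exec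
      ((Name.kt ≔ int .kt / 2).exec (recover.exec s₁)) := by
    unfold SparseFFT.afterRound
    rw [← hs₁]
  generalize recover.exec s₁ = s₂ at *
  replace hafter : SparseFFT.afterRound m d a s j b = (s₂.setInt .kt
      (s.intReg .kt / 2)).setInt .pw (2 * s.intReg .pw) := by
    rw [hafter]
    simp [hreg]
  have hzhat : (SparseFFT.afterRound m d a s j b).intArr .zhat = s₂.intArr .zhat := by
    rw [hafter]; rfl
  clear_value s₁
  generalize SparseFFT.afterRound m d a s j b = s₃ at *
  constructor
  · rw [hafter]
    constructor
    · simp [hreg, h.n_eq]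
    · intro ht'
      simp only [intReg_setInt, reduceCtorEq, if_false, if_true]
      rw [h.kt_eq ht, show κ - t = (κ - (t + 1)) + 1 by omega, pow_succ]
      push_cast
      omega
    · simp only [intReg_setInt, if_true]
      rw [h.pw_eq, pow_succ]
      push_cast
      ring
    · simpa using hreal
    · simpa [hcpx] using henv.x_eq
    · simpa using hw'
    · refine ⟨Z', by simpa using hz', by simpa using hst', ?_⟩
      simp only [intReg_setInt, reduceCtorEq, if_false, if_true]
      have h1 : (2 ^ binExp p κ m d t : ℕ) ≤ 2 ^ (m + d) * 2 ^ (κ - t) := by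
        rw [← pow_add]
        exact Nat.pow_le_pow_right (by norm_num) (binExp_le' ..)
      have h2 := h.kt_eq ht
      have h3 : (Z' : ℤ) ≤ Z + 2 ^ (m + d) * s.intReg .kt := by
        rw [h2]
        have : Z' ≤ Z + 2 ^ (m + d) * 2 ^ (κ - t) := hZ'.trans (by omega)
        exact_mod_cast this
      have h4 : (2 : ℤ) ^ (m + d + 1) * (s.intReg .kt / 2) ≤ 2 ^ (m + d) * s.intReg .kt := by
        rw [pow_succ, mul_assoc]
        exact mul_le_mul_of_nonneg_left (by omega) (by positivity)
      have h5 : (2 : ℤ) ^ (m + d + 1) * s.intReg .kt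
        = 2 ^ (m + d) * s.intReg .kt + 2 ^ (m + d) * s.intReg .kt := by rw [pow_succ]; ring
      omega
  · have h2n : 2 ≤ 2 ^ p := le_self_pow₀ (by norm_num) (by have := hX.one_le_p; omega)
    refine card_residual_round_le (inv := inv)
      (C := (1 - width a t / 2) / (2 * (2 ^ binExp p κ m d t : ℕ)))
      (τ := 4 * (2 ^ binExp p κ m d t : ℕ) / width a t * √(2 * T)) (N := (8 * round T + 8).toNat)
      (U := fun a' j' => binValue (2 ^ binExp p κ m d t) (2 ^ (p - binExp p κ m d t))
        (8 * round T + 8).toNat Z (width a t) (4 * (2 ^ binExp p κ m d t : ℕ) / width a t * √(2 * T))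
        ((1 - width a t / 2) / (2 * (2 ^ binExp p κ m d t : ℕ))) x (s₁.intArr .zlist)
        (s₁.intArr .zhat) (round (8 * (2 ^ binExp p κ m d t : ℕ) / width a t * T) + 1)
        (2 * j + 1) a' b j')
      (r := fun f => X f - s.intArr .zhat f.val) (r' := fun f => X f - s₃.intArr .zhat f.val)
      h2n (by positivity) hX.error_le (fun a' j' h0 h1 => ?_) hinv (fun f => ?_)
    · rw [← hzh]
      exact norm_binValue_sub_le hX.spectrum_eq hwp hnBM henv.stored a' h0 h1
    · rw [hzhat, ← hzh]
      rcases hres f.val with ⟨j', h1, h2, h3, h4⟩ | ⟨h1, h2⟩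
      · exact Or.inl ⟨j', h1, h2, h3, by rw [h4]; ring⟩
      · exact Or.inr ⟨h1, by rw [h2]⟩

end RoundStep

/-! ### The probability that a round fails -/

section RoundBounds

open scoped ENNReal

/-- A bound on a real double sum, as a bound on the average in the form in which the law of a round
states it. -/
theorem average_le {J n : ℕ} (hJ : 0 < J) (hn : 0 < n) {F : ℕ → ℕ → ℝ} (hF : ∀ j b, 0 ≤ F j b)
    {c : ℝ} (h : ∑ j ∈ Finset.range J, ∑ b ∈ Finset.range n, F j b ≤ J * n * c) :
    (∑ j ∈ Finset.range J, (∑ b ∈ Finset.range n, ENNReal.ofReal (F j b)) / n) / J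
      ≤ ENNReal.ofReal c := by
  have hJ' : (0 : ℝ) < J := by exact_mod_cast hJ
  have hn' : (0 : ℝ) < n := by exact_mod_cast hn
  have h1 : ∀ j, (∑ b ∈ Finset.range n, ENNReal.ofReal (F j b)) / (n : ℝ≥0∞)
      = ENNReal.ofReal ((∑ b ∈ Finset.range n, F j b) / n) := fun j => by
    rw [ENNReal.ofReal_div_of_pos hn', ENNReal.ofReal_sum_of_nonneg fun b _ => hF j b,
      ENNReal.ofReal_natCast]
  simp only [h1]
  rw [← ENNReal.ofReal_sum_of_nonneg fun j _ =>
    div_nonneg (Finset.sum_nonneg fun b _ => hF j b) hn'.le, ← ENNReal.ofReal_natCast,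
    ← ENNReal.ofReal_div_of_pos hJ']
  refine ENNReal.ofReal_le_ofReal ?_
  rw [div_le_iff₀ hJ', ← Finset.sum_div, div_le_iff₀ hn']
  linarith

variable {p κ m d a t : ℕ} {T : ℝ} {x : ZMod (2 ^ p) → ℂ} {s : State Name}

/-- The law of a round whose memory satisfies the loop invariant. -/
theorem LoopInv.expect_roundBody {X : ZMod (2 ^ p) → ℤ} (hX : Accurate p T x X)
    (h : LoopInv p κ m d T x t s) (ht : t ≤ κ) :
    ∃ c : ℕ, c ≤ 100 + 20 * 2 ^ binExp p κ m d t ∧ ∀ g : State Name × ℕ → ℝ≥0∞,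
      expect ((roundBody m d a).run s) g = (∑ j ∈ Finset.range (2 ^ (p - 1)),
        (∑ b ∈ Finset.range (2 ^ p), g (SparseFFT.afterRound m d a s j b,
          c + recover.steps (drawn (prepared m d a s) j b))) / (2 ^ p : ℕ)) / (2 ^ (p - 1) : ℕ) := by
  refine SparseFFT.expect_roundBody (by positivity) (by positivity) ?_ ?_ (h.bins ht)
  · rw [prepared_intReg _ (by decide), h.n_eq]
  · have := hX.one_le_p
    rw [show p = (p - 1) + 1 by omega, pow_succ]
    simp

/-- Whether the residual is as small as it should be before round `t`. -/
def Good {n : ℕ} [NeZero n] (p κ m d : ℕ) (X : ZMod n → ℤ) (t : ℕ) (s : State Name) : Prop :=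
  (residual X s).card * 8 ^ t ≤ 2 ^ κ ∧ (p ≤ m + d + κ → t ≠ 0 → (residual X s).card = 0)

/-- The bound on the probability that round `t` does not shrink the residual enough. -/
noncomputable def failureBound (m d a t : ℕ) : ℝ :=
  16 * (4 / (2 ^ m * 4 ^ t) + width a t + 2 / (2 ^ d * 2 ^ t))

theorem failureBound_nonneg (m d a t : ℕ) : 0 ≤ failureBound m d a t := by
  have := width_pos a t
  unfold failureBound
  positivity

open scoped Classical in
/-- By Markov's inequality: if the round starts with a small residual and ends with a large one,
there are at least `2 ^ κ / (16 * 8 ^ t)` bad coefficients, and their average number is known. -/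
theorem LoopInv.failure_le {X : ZMod (2 ^ p) → ℤ} (hX : Accurate p T x X) (hm : 1 ≤ m)
    (ha : 1 ≤ a) (h : LoopInv p κ m d T x t s) (ht : t ≤ κ) :
    expect ((roundBody m d a).run s) (fun r => if Good p κ m d X (t + 1) r.1 then 0 else 1)
      ≤ (if Good p κ m d X t s then 0 else 1) + ENNReal.ofReal (failureBound m d a t) := by
  by_cases hG : Good p κ m d X t s
  swap
  · rw [if_neg hG]
    refine le_add_right ((expect_mono _ (g' := fun _ => 1) fun r _ => ?_).trans_eq
      (expect_const _ _))
    split_ifs <;> simp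
  rw [if_pos hG, zero_add]
  obtain ⟨c, -, hc⟩ := h.expect_roundBody (a := a) hX ht
  rw [hc]
  set e := binExp p κ m d t with he
  set F : ℕ → ℕ → ℝ := fun j b => 16 * 8 ^ t / 2 ^ κ *
    ((badSet (2 ^ e) (2 ^ (p - e)) (width a t) (2 * (j : ℤ) + 1) b (residual X s)).card : ℝ)
    with hF
  have hF0 : ∀ j b, 0 ≤ F j b := fun j b => by positivity
  by_cases hsmall : p ≤ m + d + κ
  · -- all coefficients are recovered at once, or there is nothing left to recover
    have hbad : ∀ j b : ℕ, (badSet (2 ^ e) (2 ^ (p - e)) (width a t) (2 * (j : ℤ) + 1) b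
        (residual X s)).card = 0 := by
      intro j b
      rw [Finset.card_eq_zero]
      rcases Nat.eq_zero_or_pos t with rfl | ht0
      · have he' : e = p := by rw [he]; unfold binExp; rw [if_pos (by omega)]
        rw [he', Nat.sub_self, pow_zero]
        exact badSet_eq_empty rfl (width_lt_one ha _).le (by omega) _
      · have h1 := Finset.card_eq_zero.1 (hG.2 hsmall ht0.ne')
        rw [h1]
        rfl
    refine le_of_eq_of_le ?_ zero_le
    have hz : ∀ j b, Good p κ m d X (t + 1) (SparseFFT.afterRound m d a s j b) := by
      intro j b
      have h1 := (h.afterRound hX hm ha ht j b).2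
      rw [← he, hbad j b] at h1
      have h2 : (residual X (SparseFFT.afterRound m d a s j b)).card = 0 := by omega
      exact ⟨by rw [h2]; simp, fun _ _ => h2⟩
    simp [hz]
  · have hind : ∀ j b, (if Good p κ m d X (t + 1) (SparseFFT.afterRound m d a s j b) then
        (0 : ℝ≥0∞) else 1) ≤ ENNReal.ofReal (F j b) := by
      intro j b
      split_ifs with hg
      · exact zero_le
      · rw [ENNReal.one_le_ofReal]
        have h1 := (h.afterRound hX hm ha ht j b).2
        rw [← he] at h1
        have h2 : ¬ (residual X (SparseFFT.afterRound m d a s j b)).card * 8 ^ (t + 1) ≤ 2 ^ κ :=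
          fun h3 => hg ⟨h3, fun h4 => absurd h4 hsmall⟩
        set w := (badSet (2 ^ e) (2 ^ (p - e)) (width a t) (2 * (j : ℤ) + 1) b (residual X s)).card
          with hw
        have h3 : 2 ^ κ ≤ 16 * 8 ^ t * w := by
          rw [not_le] at h2
          refine h2.le.trans ((Nat.mul_le_mul_right _ h1).trans_eq ?_)
          rw [pow_succ]; ring
        have h4 : (2 ^ κ : ℝ) ≤ 16 * 8 ^ t * w := by exact_mod_cast h3
        simp only [hF]
        rw [← hw, div_mul_eq_mul_div, le_div_iff₀ (by positivity), one_mul]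
        exact h4
    refine le_trans ?_ (average_le (J := 2 ^ (p - 1)) (n := 2 ^ p) (by positivity) (by positivity) hF0
      (c := failureBound m d a t) ?_)
    · exact ENNReal.div_le_div_right (Finset.sum_le_sum fun j _ =>
        ENNReal.div_le_div_right (Finset.sum_le_sum fun b _ => hind j b) _) _
    · simp only [hF, ← Finset.mul_sum]
      have hnBM : 2 ^ p = 2 ^ e * 2 ^ (p - e) := by
        rw [← pow_add, Nat.add_sub_cancel' (binExp_le ..)]
      have h1 := sum_card_badSet_le hX.one_le_p hnBM (width_pos a t).le (residual X s)
      refine (mul_le_mul_of_nonneg_left h1 (by positivity : (0 : ℝ) ≤ 16 * 8 ^ t / 2 ^ κ)).trans ?_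
      set S : ℝ := ((residual X s).card : ℝ) with hS
      have hS8 : S * 8 ^ t ≤ 2 ^ κ := by rw [hS]; exact_mod_cast hG.1
      have hS0 : 0 ≤ S := Nat.cast_nonneg _
      have he' : e = m + (κ - t) := by rw [he]; unfold binExp; rw [if_neg (by omega)]
      have hB : ((2 ^ e : ℕ) : ℝ) * 2 ^ t = 2 ^ m * 2 ^ κ := by
        push_cast
        rw [he', ← pow_add, ← pow_add]
        congr 1; omega
      have hB0 : (0 : ℝ) < ((2 ^ e : ℕ) : ℝ) := by positivity
      have h2 : 4 * S / ((2 ^ e : ℕ) : ℝ) ≤ 4 / (2 ^ m * 4 ^ t) := by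
        rw [div_le_div_iff₀ hB0 (by positivity)]
        have h3 : (8 : ℝ) ^ t = 4 ^ t * 2 ^ t := by rw [← mul_pow]; norm_num
        have h4 : S * 4 ^ t * 2 ^ m ≤ ((2 ^ e : ℕ) : ℝ) := by
          refine le_of_mul_le_mul_right ?_ (show (0 : ℝ) < 2 ^ t by positivity)
          rw [hB]
          calc S * 4 ^ t * 2 ^ m * 2 ^ t = 2 ^ m * (S * 8 ^ t) := by rw [h3]; ring
            _ ≤ 2 ^ m * 2 ^ κ := by gcongr
        nlinarith
      have h3 : 2 / ((2 ^ (p - e) : ℕ) : ℝ) ≤ 2 / (2 ^ d * 2 ^ t) := by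
        push_cast
        rw [← pow_add]
        gcongr
        · norm_num
        · rw [he']; omega
      have hw := width_pos a t
      set Y := 4 * S / ((2 ^ e : ℕ) : ℝ) + width a t + 2 / ((2 ^ (p - e) : ℕ) : ℝ) with hY
      have hY0 : 0 ≤ Y := by positivity
      have h4 : Y ≤ 4 / (2 ^ m * 4 ^ t) + width a t + 2 / (2 ^ d * 2 ^ t) := by
        rw [hY]; gcongr
      have h5 : S * 8 ^ t / 2 ^ κ ≤ 1 := (div_le_one (by positivity)).2 hS8
      have h6 : 0 ≤ S * 8 ^ t / 2 ^ κ := by positivity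
      calc (16 * 8 ^ t / 2 ^ κ) * (2 ^ (p - 1) * 2 ^ p * (S * Y))
          = (2 ^ (p - 1) * 2 ^ p) * (16 * ((S * 8 ^ t / 2 ^ κ) * Y)) := by ring
        _ ≤ (2 ^ (p - 1) * 2 ^ p) * (16 * (1 * (4 / (2 ^ m * 4 ^ t) + width a t
              + 2 / (2 ^ d * 2 ^ t)))) := by gcongr
        _ = _ := by unfold failureBound; push_cast; ring

end RoundBounds

/-! ### The expected cost of a round -/

section RoundCost

open scoped ENNReal

theorem inv_two_pow_le (t : ℕ) : 1 / (2 : ℝ) ^ t ≤ (3 / 4) ^ t := by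
  rw [← one_div_pow]
  exact pow_le_pow_left₀ (by norm_num) (by norm_num) t

theorem inv_sqrt_two_pow_le (t : ℕ) : 1 / √((2 : ℝ) ^ t) ≤ (3 / 4) ^ t := by
  rw [div_le_iff₀ (by positivity)]
  have h1 : ((3 / 4 : ℝ) ^ t) = √((9 / 16) ^ t) := by
    rw [show (9 / 16 : ℝ) ^ t = ((3 / 4) ^ t) ^ 2 by rw [← pow_mul, mul_comm, pow_mul]; norm_num,
      Real.sqrt_sq (by positivity)]
  rw [h1, ← Real.sqrt_mul (by positivity), ← mul_pow, Real.one_le_sqrt]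
  exact one_le_pow₀ (by norm_num)

theorem width_le (a t : ℕ) : width a t ≤ (3 / 4) ^ t := by
  refine le_trans ?_ (inv_sqrt_two_pow_le t)
  unfold width
  gcongr
  exact le_mul_of_one_le_left (by positivity) (one_le_pow₀ (by norm_num))

open scoped Classical in
/-- The average over `b` of the number of coefficients that cost a series evaluation. -/
theorem sum_inTransition_le {p e Z : ℕ} (he : e ≤ p) {α δ : ℝ} (hα : 0 ≤ α) (hα1 : α ≤ 1)
    (hδ : e < p → 2 / (2 : ℝ) ^ (p - e) ≤ δ) (hδ0 : 0 ≤ δ) (zl : ℤ → ℤ) (j : ℕ) :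
    ∑ b ∈ Finset.range (2 ^ p), ∑ l ∈ Finset.range Z,
      (if inTransition (2 ^ e) (2 ^ p) (2 ^ (p - e)) α
        ((2 * (j : ℤ) + 1) * (zl l - (b : ℕ)) % (2 ^ p : ℕ)) then (1 : ℝ) else 0)
      ≤ 2 ^ p * (Z * (α + δ)) := by
  rw [Finset.sum_comm]
  rcases he.eq_or_lt with rfl | hlt
  · simp only [Nat.sub_self, pow_zero]
    rw [Finset.sum_eq_zero]
    · positivity
    · intro l _
      exact Finset.sum_eq_zero fun b _ => if_neg (not_inTransition_of_width_one hα1 _)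
  · have hn : 2 ^ p = 2 ^ e * 2 ^ (p - e) := by rw [← pow_add, Nat.add_sub_cancel' he]
    have hcop : IsCoprime (((2 ^ p : ℕ) : ℤ)) (2 * (j : ℤ) + 1) := by
      push_cast
      exact IsCoprime.pow_left ⟨-j, 1, by ring⟩
    have h1 : ∀ l ∈ Finset.range Z, ∑ b ∈ Finset.range (2 ^ p),
        (if inTransition (2 ^ e) (2 ^ p) (2 ^ (p - e)) α
        ((2 * (j : ℤ) + 1) * (zl l - (b : ℕ)) % (2 ^ p : ℕ)) then (1 : ℝ) else 0)
        ≤ 2 ^ p * (α + δ) := by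
      intro l _
      rw [Finset.sum_boole]
      refine (card_inTransition_le (by positivity) (by positivity) hn hα hcop (zl l)).trans ?_
      have h2 := hδ hlt
      have hnR : (2 : ℝ) ^ p = 2 ^ e * 2 ^ (p - e) := by exact_mod_cast hn
      have h3 : 2 * (2 : ℝ) ^ e = 2 ^ p * (2 / 2 ^ (p - e)) := by rw [hnR]; field_simp
      push_cast
      rw [h3, mul_add, mul_comm α]
      gcongr
    refine (Finset.sum_le_card_nsmul _ _ _ h1).trans_eq ?_
    rw [Finset.card_range, nsmul_eq_mul]
    ring

variable {p κ m d a t : ℕ} {T : ℝ} {x : ZMod (2 ^ p) → ℂ} {s : State Name}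

/-- The coefficients of the bound on the expected cost of a round. -/
noncomputable def costDecay (m d a : ℕ) (A : ℝ) : ℝ :=
  380 * 2 ^ (m + d) + 6400 * 2 ^ (m + d) * 2 ^ a * A + 2400 * A * 2 ^ (m + d) * (1 + 2 ^ (m + 1))

/-- The bound on the expected cost of round `t`, if `T ≤ A * p`. -/
noncomputable def costBound (p κ m d a : ℕ) (A : ℝ) (t : ℕ) : ℝ :=
  costDecay m d a A * p * 2 ^ κ * (3 / 4) ^ t + (800 * 2 ^ (m + d) + 2540) * 2 ^ κ
    + (20 * A + 40) * p

theorem costBound_nonneg {A : ℝ} (hA : 0 ≤ A) : 0 ≤ costBound p κ m d a A t := by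
  unfold costBound costDecay
  positivity

/-- The number of samples that a call of `hashToBins` reads. -/
theorem round_radius_le {B D K q A w P : ℝ} (hq : B / w ≤ D * K * q) (hw : 0 < w) (hT0 : 0 ≤ T)
    (hT : T ≤ A * P) (hB : 0 ≤ B) :
    (((2 * (round (8 * B / w * T) + 1) + 1).toNat : ℕ) : ℝ) ≤ 16 * (D * K * q * (A * P)) + 5 := by
  have h1 := (abs_le.1 (abs_sub_round (8 * B / w * T))).1
  have h2 : 8 * B / w * T ≤ 8 * (D * K * q * (A * P)) := by
    rw [mul_div_assoc, mul_assoc]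
    have : 0 ≤ B / w := by positivity
    gcongr
    exact this.trans hq
  have h3 : 0 ≤ 8 * B / w * T := by positivity
  have h4 : 0 ≤ round (8 * B / w * T) := by
    rw [round_eq]; exact Int.floor_nonneg.2 (by linarith)
  have h5 : ((2 * (round (8 * B / w * T) + 1) + 1).toNat : ℤ) = 2 * (round (8 * B / w * T) + 1) + 1 :=
    Int.toNat_of_nonneg (by omega)
  have h6 : (((2 * (round (8 * B / w * T) + 1) + 1).toNat : ℕ) : ℝ)
      = 2 * (round (8 * B / w * T) + 1) + 1 := by exact_mod_cast h5
  rw [h6]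
  linarith

/-- The arithmetic behind `costBound`, with `P = p`, `K = 2 ^ κ`, `D = 2 ^ (m + d)`, `W = 2 ^ a`, `q
= (3 / 4) ^ t`, where `R` bounds the window length, `N` the length of the series, `Z` the number of
known coefficients, and `τ` the share of them in the transition region. -/
theorem base_cost_le {P K D W q A B R N RT e Z : ℝ} (hP : 1 ≤ P) (hK : 1 ≤ K)
    (hq0 : 0 < q) (hA : 1 ≤ A) (hD : 0 < D) (hB0 : 0 ≤ B)
    (hB : B ≤ D * K * q) (hR : R ≤ 16 * (D * W * K * q * (A * P)) + 5) (hRT : RT ≤ A * P + 1)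
    (heP : e ≤ P) (hZ0 : 0 ≤ Z) (hZ : Z ≤ 2 * D * K) (hN : N ≤ 20 * (A * P))
    {τ v : ℝ} (hτ0 : 0 ≤ τ) (hτ : τ ≤ (1 + v) * q) :
    501 + 20 * RT + 220 * B + 400 * R + e * (160 * B + 40) + Z * 400 + 60 * N * (Z * τ)
      ≤ (380 * D + 6400 * D * W * A + 2400 * A * D * (1 + v)) * P * K * q
        + (800 * D + 2540) * K + (20 * A + 40) * P := by
  have h1 : e * (160 * B + 40) ≤ P * (160 * (D * K * q) + 40) := by gcongr
  have h2 : B ≤ P * (D * K * q) := hB.trans (le_mul_of_one_le_left (by positivity) hP)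
  have h3 : 60 * N * (Z * τ) ≤ 60 * (20 * (A * P)) * (2 * D * K * ((1 + v) * q)) := by
    gcongr
  nlinarith

/-- The cost is averaged over the shift `b` alone, for each `σ`. -/
theorem LoopInv.cost_le {X : ZMod (2 ^ p) → ℤ} (hX : Accurate p T x X)
    (ha : 1 ≤ a) {A : ℝ} (hA : 1 ≤ A) (hTA : T ≤ A * p) (hκ : κ ≤ p)
    (h : LoopInv p κ m d T x t s) (ht : t ≤ κ) :
    expect ((roundBody m d a).run s) (fun r => ((1 + r.2 : ℕ) : ℝ≥0∞))
      ≤ ENNReal.ofReal (costBound p κ m d a A t) := by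
  classical
  obtain ⟨c, hcB, hc⟩ := h.expect_roundBody (a := a) hX ht
  obtain ⟨Z, hZ, hst, hZB⟩ := h.stored
  rw [hc]
  set e := binExp p κ m d t with he
  set N := (8 * round T + 8).toNat with hN
  have heP : e ≤ p := binExp_le ..
  have hT1 := hX.one_le_T
  -- the cost of a round with the random choices `j` and `b`
  set base : ℕ := 501 + 20 * (round T).toNat + 220 * 2 ^ e
      + 400 * (2 * (round (8 * ((2 ^ e : ℕ) : ℝ) / width a t * T) + 1) + 1).toNat
      + e * (160 * 2 ^ e + 40) + Z * 400 with hbase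
  set F : ℕ → ℕ → ℝ := fun j b => base + 60 * N * ∑ l ∈ Finset.range Z,
      (if inTransition (2 ^ e) (2 ^ p) (2 ^ (p - e)) (width a t)
        ((2 * (j : ℤ) + 1) * (s.intArr .zlist l - (b : ℕ)) % (2 ^ p : ℕ)) then (1 : ℝ) else 0)
    with hF
  have hF0 : ∀ j b, 0 ≤ F j b := fun j b => by
    have : (0 : ℝ) ≤ ∑ l ∈ Finset.range Z,
      (if inTransition (2 ^ e) (2 ^ p) (2 ^ (p - e)) (width a t)
        ((2 * (j : ℤ) + 1) * (s.intArr .zlist l - (b : ℕ)) % (2 ^ p : ℕ)) then (1 : ℝ) else 0) :=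
      Finset.sum_nonneg fun l _ => by split_ifs <;> simp
    simp only [hF]
    positivity
  have hsteps : ∀ j b, ((1 + (c + recover.steps (drawn (prepared m d a s) j b)) : ℕ) : ℝ≥0∞)
      ≤ ENNReal.ofReal (F j b) := by
    intro j b
    have henv := h.roundEnv (a := a) ht hZ hst j b
    have h1 := steps_recover_le hT1 henv
    have h2 : (drawn (prepared m d a s) j b).intArr .zlist = s.intArr .zlist := by
      unfold drawn; simp [prepared_intArr]
    rw [h2, Finset.sum_add_distrib, Finset.sum_const, Finset.card_range, smul_eq_mul, ← he, ← hN] at h1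
    have h3 : (1 + (c + recover.steps (drawn (prepared m d a s) j b)) : ℕ) ≤ base +
        ∑ l ∈ Finset.range Z, if inTransition (2 ^ e) (2 ^ p) (2 ^ (p - e)) (width a t)
          ((2 * (j : ℤ) + 1) * (s.intArr .zlist l - (b : ℕ)) % (2 ^ p : ℕ)) then 60 * N else 0 := by
      rw [hbase]; omega
    rw [← ENNReal.ofReal_natCast]
    refine ENNReal.ofReal_le_ofReal ((Nat.cast_le.2 h3).trans_eq ?_)
    simp only [hF]
    push_cast
    rw [Finset.mul_sum]
    congr 1
    refine Finset.sum_congr rfl fun l _ => ?_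
    split_ifs <;> simp
  refine le_trans (ENNReal.div_le_div_right (Finset.sum_le_sum fun j _ =>
        ENNReal.div_le_div_right (Finset.sum_le_sum fun b _ => hsteps j b) _) _)
    (average_le (J := 2 ^ (p - 1)) (n := 2 ^ p) (by positivity) (by positivity) hF0 ?_)
  have hδ : e < p → 2 / (2 : ℝ) ^ (p - e) ≤ 2 ^ (m + 1) / 2 ^ t := by
    intro hlt
    have he' : e = m + (κ - t) := by
      rw [he] at hlt ⊢
      unfold binExp at hlt ⊢
      split_ifs at hlt ⊢
      · omega
      · rfl
    rw [div_le_div_iff₀ (by positivity) (by positivity), ← pow_succ', ← pow_add]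
    exact pow_le_pow_right₀ (by norm_num) (by omega)
  have hsum : ∀ j ∈ Finset.range (2 ^ (p - 1)), ∑ b ∈ Finset.range (2 ^ p), F j b
      ≤ 2 ^ p * (base + 60 * N * (Z * (width a t + 2 ^ (m + 1) / 2 ^ t))) := by
    intro j _
    have h1 := sum_inTransition_le (Z := Z) heP (width_pos a t).le (width_lt_one ha t).le hδ
      (by positivity) (s.intArr .zlist) j
    simp only [hF]
    rw [Finset.sum_add_distrib, Finset.sum_const, Finset.card_range, nsmul_eq_mul, ← Finset.mul_sum]
    push_cast at h1 ⊢
    have h2 := mul_le_mul_of_nonneg_left h1 (show (0 : ℝ) ≤ 60 * N by positivity)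
    refine (add_le_add_right h2 _).trans_eq ?_
    ring
  refine (Finset.sum_le_card_nsmul _ _ _ hsum).trans ?_
  rw [Finset.card_range, nsmul_eq_mul]
  push_cast
  rw [← mul_assoc]
  refine mul_le_mul_of_nonneg_left ?_ (by positivity)
  -- the bounds on the parameters of the round
  have hp1 : (1 : ℝ) ≤ p := by exact_mod_cast hX.one_le_p
  have hq0 : (0 : ℝ) < (3 / 4) ^ t := by positivity
  have hround := abs_le.1 (abs_sub_round T)
  have hr0 : 0 ≤ round T := by
    have h1 : (0 : ℝ) < round T := by linarith [hround.2]
    exact_mod_cast h1.le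
  have hRT : (((round T).toNat : ℕ) : ℝ) = round T := by exact_mod_cast Int.toNat_of_nonneg hr0
  have hNr : (N : ℝ) = 8 * round T + 8 := by
    rw [hN]; exact_mod_cast Int.toNat_of_nonneg (show 0 ≤ 8 * round T + 8 by omega)
  have hpow : (2 : ℝ) ^ (κ - t) * 2 ^ t = 2 ^ κ := by rw [← pow_add, Nat.sub_add_cancel ht]
  have hBe : (2 : ℝ) ^ e ≤ 2 ^ (m + d) * 2 ^ κ * (1 / 2 ^ t) := by
    rw [mul_one_div, le_div_iff₀ (by positivity)]
    calc (2 : ℝ) ^ e * 2 ^ t ≤ 2 ^ (m + d + (κ - t)) * 2 ^ t :=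
          mul_le_mul_of_nonneg_right (pow_le_pow_right₀ (by norm_num) (binExp_le' ..))
            (by positivity)
      _ = 2 ^ (m + d) * 2 ^ κ := by rw [pow_add, mul_assoc, hpow]
  have hB : (2 : ℝ) ^ e ≤ 2 ^ (m + d) * 2 ^ κ * (3 / 4) ^ t :=
    hBe.trans (mul_le_mul_of_nonneg_left (inv_two_pow_le t) (by positivity))
  have hBw : ((2 ^ e : ℕ) : ℝ) / width a t ≤ 2 ^ (m + d) * 2 ^ a * 2 ^ κ * (3 / 4) ^ t := by
    unfold width
    push_cast
    rw [div_div_eq_mul_div, div_one]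
    have h1 : (2 : ℝ) ^ t = √(2 ^ t) * √(2 ^ t) := (Real.mul_self_sqrt (by positivity)).symm
    calc (2 : ℝ) ^ e * (2 ^ a * √(2 ^ t))
        ≤ (2 ^ (m + d) * 2 ^ κ * (1 / 2 ^ t)) * (2 ^ a * √(2 ^ t)) := by gcongr
      _ = 2 ^ (m + d) * 2 ^ a * 2 ^ κ * (√(2 ^ t) / 2 ^ t) := by ring
      _ = 2 ^ (m + d) * 2 ^ a * 2 ^ κ * (1 / √(2 ^ t)) := by
          congr 1
          rw [div_eq_div_iff (by positivity) (by positivity), one_mul, ← h1]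
      _ ≤ _ := by gcongr; exact inv_sqrt_two_pow_le t
  have hZr : (Z : ℝ) ≤ 2 * 2 ^ (m + d) * 2 ^ κ := by
    have h1 : 0 ≤ s.intReg .kt := by rw [h.kt_eq ht]; positivity
    have h2 : (Z : ℤ) ≤ 2 ^ (m + d + 1) * 2 ^ κ := by
      have : 0 ≤ (2 : ℤ) ^ (m + d + 1) * s.intReg .kt := by positivity
      omega
    have h3 : (Z : ℝ) ≤ 2 ^ (m + d + 1) * 2 ^ κ := by exact_mod_cast h2
    rwa [pow_succ, mul_comm ((2 : ℝ) ^ (m + d)) 2] at h3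
  have hτ : width a t + 2 ^ (m + 1) / 2 ^ t ≤ (1 + 2 ^ (m + 1)) * (3 / 4) ^ t := by
    have h1 := width_le a t
    have h2 := mul_le_mul_of_nonneg_left (inv_two_pow_le t)
      (show (0 : ℝ) ≤ 2 ^ (m + 1) by positivity)
    rw [mul_one_div] at h2
    linarith
  have hRad := round_radius_le hBw (width_pos a t) (by linarith) hTA (by positivity)
  push_cast at hRad
  have hAP : 1 ≤ A * p := by nlinarith
  have key := base_cost_le (P := p) (K := 2 ^ κ) (D := 2 ^ (m + d)) (W := 2 ^ a) (q := (3 / 4) ^ t)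
    (A := A) (B := 2 ^ e)
    (R := (((2 * (round (8 * (2 : ℝ) ^ e / width a t * T) + 1) + 1).toNat : ℕ) : ℝ))
    (N := N) (RT := (((round T).toNat : ℕ) : ℝ)) (e := e) (Z := Z)
    (τ := width a t + 2 ^ (m + 1) / 2 ^ t) (v := 2 ^ (m + 1))
    hp1 (one_le_pow₀ (by norm_num)) hq0 hA (by positivity)
    (by positivity) hB hRad (by rw [hRT]; linarith [hround.1])
    (by exact_mod_cast heP) (by positivity) hZr
    (by rw [hNr]; nlinarith [hround.1])
    (add_nonneg (width_pos a t).le (by positivity)) hτ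
  unfold costBound costDecay
  rw [hbase]
  push_cast
  exact key

end RoundCost

/-! ### The outer loop -/

section OuterLoop

open scoped ENNReal

theorem sum_three_quarters_pow_le (m : ℕ) : ∑ t ∈ Finset.range m, (3 / 4 : ℝ) ^ t ≤ 4 := by
  refine ((summable_geometric_of_lt_one (by norm_num) (by norm_num)).sum_le_tsum _
    fun _ _ => by positivity).trans_eq ?_
  rw [tsum_geometric_of_lt_one (by norm_num) (by norm_num)]
  norm_num

/-- `2048 = 2 ^ 11`, and `16 * (4 + 1 + 2) = 112`; all three parts decay at least like `2 ^ (-t /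
2)`, and `1 / √2 ≤ 3 / 4`. -/
theorem failureBound_le {m d a : ℕ} (hm : 11 ≤ m) (hd : 11 ≤ d) (ha : 11 ≤ a) (t : ℕ) :
    failureBound m d a t ≤ 112 / 2048 * (3 / 4) ^ t := by
  have hpow : ∀ i : ℕ, 11 ≤ i → 1 / (2 : ℝ) ^ i ≤ 1 / 2048 := fun i hi => by
    rw [show (2048 : ℝ) = 2 ^ 11 by norm_num]
    exact one_div_le_one_div_of_le (by positivity) (pow_le_pow_right₀ (by norm_num) hi)
  have h4 : 1 / (4 : ℝ) ^ t ≤ (3 / 4) ^ t := by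
    rw [← one_div_pow]
    exact pow_le_pow_left₀ (by norm_num) (by norm_num) t
  have hq : (0 : ℝ) ≤ (3 / 4) ^ t := by positivity
  have h1 : 4 / ((2 : ℝ) ^ m * 4 ^ t) ≤ 4 * (1 / 2048 * (3 / 4) ^ t) := by
    rw [show 4 / ((2 : ℝ) ^ m * 4 ^ t) = 4 * (1 / 2 ^ m * (1 / 4 ^ t)) by field_simp]
    have := hpow m hm
    gcongr
  have h2 : width a t ≤ 1 / 2048 * (3 / 4) ^ t := by
    unfold width
    rw [← one_div_mul_one_div]
    exact mul_le_mul (hpow a ha) (inv_sqrt_two_pow_le t) (by positivity) (by norm_num)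
  have h3 : 2 / ((2 : ℝ) ^ d * 2 ^ t) ≤ 2 * (1 / 2048 * (3 / 4) ^ t) := by
    rw [show 2 / ((2 : ℝ) ^ d * 2 ^ t) = 2 * (1 / 2 ^ d * (1 / 2 ^ t)) by field_simp]
    have := hpow d hd
    have := inv_two_pow_le t
    gcongr
  unfold failureBound
  linarith

theorem sum_failureBound_le {m d a : ℕ} (hm : 11 ≤ m) (hd : 11 ≤ d) (ha : 11 ≤ a) (l : ℕ) :
    ∑ t ∈ Finset.range l, failureBound m d a t ≤ 1 / 3 := by
  refine (Finset.sum_le_sum fun t _ => failureBound_le hm hd ha t).trans ?_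
  rw [← Finset.mul_sum]
  have := sum_three_quarters_pow_le l
  linarith

theorem sum_costBound_le {p κ m d a : ℕ} {A : ℝ} (hA : 0 ≤ A) (hp : 1 ≤ p) (hκ : κ ≤ p) :
    ∑ t ∈ Finset.range (κ + 1), costBound p κ m d a A t
      ≤ (4 * costDecay m d a A + 2 * (800 * 2 ^ (m + d) + 2540) + (20 * A + 40)) * (2 ^ κ * p) := by
  unfold costBound
  rw [Finset.sum_add_distrib, Finset.sum_add_distrib, ← Finset.mul_sum, Finset.sum_const,
    Finset.sum_const, Finset.card_range, nsmul_eq_mul, nsmul_eq_mul]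
  have hD : 0 ≤ costDecay m d a A := by unfold costDecay; positivity
  have h1 := mul_le_mul_of_nonneg_left (sum_three_quarters_pow_le (κ + 1))
    (show 0 ≤ costDecay m d a A * p * 2 ^ κ by positivity)
  have hp' : (1 : ℝ) ≤ p := by exact_mod_cast hp
  have hκ' : (κ : ℝ) ≤ p := by exact_mod_cast hκ
  have h2 : ((κ + 1 : ℕ) : ℝ) ≤ 2 * p := by push_cast; linarith
  have h3 : ((κ + 1 : ℕ) : ℝ) ≤ 2 ^ κ := by exact_mod_cast Nat.lt_two_pow_self
  have h4 : ((κ + 1 : ℕ) : ℝ) * ((800 * 2 ^ (m + d) + 2540) * 2 ^ κ)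
      ≤ 2 * p * ((800 * 2 ^ (m + d) + 2540) * 2 ^ κ) := by gcongr
  have h5 : ((κ + 1 : ℕ) : ℝ) * ((20 * A + 40) * p) ≤ 2 ^ κ * ((20 * A + 40) * p) := by gcongr
  linarith

variable {p κ m d a t : ℕ} {T : ℝ} {x : ZMod (2 ^ p) → ℂ} {s : State Name}

theorem LoopInv.setInt (h : LoopInv p κ m d T x t s) (z : ℤ) :
    LoopInv p κ m d T x t (s.setInt .t z) := by
  constructor
  · simpa using h.n_eq
  · simpa using h.kt_eq
  · simpa using h.pw_eq
  · simpa using h.T_eq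
  · simpa using h.x_eq
  · simpa using h.what_eq
  · simpa using h.stored

/-- One iteration of the outer loop. -/
noncomputable def roundRun (m d a : ℕ) (j : ℕ) (s : State Name) : RunM Name :=
  RunM.charge 1 ((roundBody m d a).run (s.setInt .t j))

theorem LoopInv.support_roundRun {X : ZMod (2 ^ p) → ℤ} (hX : Accurate p T x X) (hm : 1 ≤ m)
    (ha : 1 ≤ a) (h : LoopInv p κ m d T x t s) (ht : t ≤ κ) :
    ∀ r ∈ (roundRun m d a t s).support, LoopInv p κ m d T x (t + 1) r.1 := by
  classical
  refine forall_mem_support_of_expect ?_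
  obtain ⟨c, -, hc⟩ := (h.setInt t).expect_roundBody (a := a) hX ht
  unfold roundRun
  rw [expect_charge, hc]
  have := fun j b => ((h.setInt t).afterRound hX hm ha ht j b).1
  simp [this]

open scoped Classical in
/-- The algorithm fails with probability at most `1 / 3`, and its expected cost is the sum of the
expected costs of the rounds. -/
theorem expect_rounds {X : ZMod (2 ^ p) → ℤ} (hX : Accurate p T x X) (hm : 11 ≤ m) (hd : 11 ≤ d)
    (ha : 11 ≤ a) {A : ℝ} (hA : 1 ≤ A) (hTA : T ≤ A * p) (hκ : κ ≤ p)
    (h : LoopInv p κ m d T x 0 s) (hG : (residual X s).card ≤ 2 ^ κ) :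
    (∀ r ∈ (RunM.iterate (roundRun m d a) (κ + 1) s).support,
      LoopInv p κ m d T x (κ + 1) r.1) ∧
    expect (RunM.iterate (roundRun m d a) (κ + 1) s)
      (fun r => if Good p κ m d X (κ + 1) r.1 then 0 else 1) ≤ ENNReal.ofReal (1 / 3) ∧
    expect (RunM.iterate (roundRun m d a) (κ + 1) s) (fun r => (r.2 : ℝ≥0∞))
      ≤ ENNReal.ofReal (∑ t ∈ Finset.range (κ + 1), costBound p κ m d a A t) := by
  have hsupp : ∀ t < κ + 1, ∀ s, LoopInv p κ m d T x t s →
      ∀ r ∈ (roundRun m d a t s).support, LoopInv p κ m d T x (t + 1) r.1 :=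
    fun t ht s hs => hs.support_roundRun hX (by omega) (by omega) (by omega)
  refine ⟨?_, ?_, ?_⟩
  · exact (expect_iterate_le (w := fun _ _ => 0) (c := fun _ => 0) (lam := 0) h hsupp
      (fun t _ s _ => by simp [expect_const])).1
  · have h1 := (expect_iterate_le (w := fun t s => if Good p κ m d X t s then 0 else 1)
      (c := fun t => ENNReal.ofReal (failureBound m d a t)) (lam := 0) h hsupp
      (fun t ht s hs => by
        have h2 := (hs.setInt t).failure_le hX (by omega) (by omega) (a := a)
          (show t ≤ κ by omega)
        unfold roundRun
        rw [expect_charge]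
        simp only [zero_mul, add_zero]
        exact h2)).2
    have h3 : Good p κ m d X 0 s := ⟨by simpa using hG, fun _ h4 => absurd rfl h4⟩
    rw [if_pos h3, zero_add, ← ENNReal.ofReal_sum_of_nonneg
      fun t _ => failureBound_nonneg m d a t] at h1
    simp only [zero_mul, add_zero] at h1
    exact h1.trans (ENNReal.ofReal_le_ofReal (sum_failureBound_le hm hd ha _))
  · have h1 := (expect_iterate_le (w := fun _ _ => 0)
      (c := fun t => ENNReal.ofReal (costBound p κ m d a A t)) (lam := 1) h hsupp
      (fun t ht s hs => by
        have h2 := (hs.setInt t).cost_le hX (by omega) hA hTA hκ (a := a)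
          (show t ≤ κ by omega)
        unfold roundRun
        rw [expect_charge]
        simp only [zero_add, one_mul]
        exact h2)).2
    simp only [zero_add, one_mul] at h1
    rwa [ENNReal.ofReal_sum_of_nonneg fun t _ => costBound_nonneg (by linarith)]

/-- If nothing is left of the residual, the vector returned is the spectrum. -/
theorem LoopInv.returned_eq {X : ZMod (2 ^ p) → ℤ} (hX : ∀ f, spectrum x f = X f)
    (h : LoopInv p κ m d T x t s) (h0 : (residual X s).card = 0) : returned s = spectrum x := by
  classical
  obtain ⟨Z, hZ, hst, -⟩ := h.stored
  funext i
  have h1 : X i = s.intArr .zhat i.val := by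
    have := Finset.filter_eq_empty_iff.1 (Finset.card_eq_zero.1 h0) (Finset.mem_univ i)
    push Not at this
    linarith
  rw [hX, h1]
  unfold returned
  split_ifs with hl
  · rfl
  · rw [hst.eq_zero, Int.cast_zero]
    rintro ⟨l, hl1, hl2⟩
    refine hl ⟨l, by omega, ?_, hl2⟩
    change (l : ℤ) < s.intReg .zcnt
    rw [hZ]
    exact_mod_cast hl1

end OuterLoop

/-! ### From the initial memory to the outer loop -/

section Prelude

open scoped ENNReal

/-- The part of the program that precedes the outer loop. -/
def prelude : Stmt Name :=
  powerOfTwoAbove .K .logK (int .k) ;;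
  .delta ≔ 1 / toR (4 * (int .n * int .n) * int .L) ;;
  .T ≔ .un .log (64 * toR (int .n) / real .delta) ;;
  .kt ≔ int .K ;;
  .pw ≔ (1 : IExpr)

/-- The accuracy parameter `log (64 n / δ)` for `δ = 1 / (4 n² L)`. -/
noncomputable def accuracy (n L : ℕ) : ℝ := Real.log (64 * n / (1 / (4 * (n * n) * L)))

theorem accuracy_eq {p L : ℕ} (hL : 1 ≤ L) :
    accuracy (2 ^ p) L = 8 * Real.log 2 + 3 * (p * Real.log 2) + Real.log L := by
  unfold accuracy
  have hL' : (0 : ℝ) < L := by exact_mod_cast hL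
  have h1 : (64 : ℝ) * (2 ^ p : ℕ) / (1 / (4 * ((2 ^ p : ℕ) * (2 ^ p : ℕ)) * L))
      = 2 ^ 8 * (2 ^ p) ^ 3 * L := by
    push_cast
    rw [div_div_eq_mul_div, div_one]
    ring
  rw [h1, Real.log_mul (by positivity) hL'.ne', Real.log_mul (by positivity) (by positivity),
    Real.log_pow, Real.log_pow, Real.log_pow]
  push_cast
  ring

theorem exp_neg_accuracy {n L : ℕ} (hn : 1 ≤ n) (hL : 1 ≤ L) :
    Real.exp (-accuracy n L) = 1 / (256 * n ^ 3 * L) := by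
  have hn' : (0 : ℝ) < n := by exact_mod_cast hn
  have hL' : (0 : ℝ) < L := by exact_mod_cast hL
  unfold accuracy
  rw [Real.exp_neg, Real.exp_log (by positivity)]
  field_simp
  norm_num

theorem accurate {p L : ℕ} (hp : 1 ≤ p) (hL : 1 ≤ L) {x : ZMod (2 ^ p) → ℂ} {X : ZMod (2 ^ p) → ℤ}
    (hX : ∀ f, spectrum x f = X f) (hXL : ∀ f, |X f| ≤ L) :
    Accurate p (accuracy (2 ^ p) L) x X := by
  have hp' : (1 : ℝ) ≤ p := by exact_mod_cast hp
  have hL' : (1 : ℝ) ≤ L := by exact_mod_cast hL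
  have hlogL := Real.log_nonneg hL'
  have hlog2 := Real.log_two_gt_d9
  have hplog : (p : ℝ) * (2 / 3) ≤ p * Real.log 2 := by gcongr; linarith
  have hT := accuracy_eq (p := p) hL
  refine ⟨hp, by linarith, ?_, hX, ?_⟩
  · have h1 := (abs_le.1 (abs_sub_round (accuracy (2 ^ p) L))).2
    have h2 : (p : ℝ) ≤ round (accuracy (2 ^ p) L) := by linarith
    exact_mod_cast h2
  · have h1 : ∑ f, |(X f : ℝ)| ≤ (2 ^ p : ℕ) * (L : ℝ) := by
      refine (Finset.sum_le_card_nsmul _ _ (L : ℝ) fun f _ => ?_).trans_eq ?_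
      · exact_mod_cast hXL f
      · rw [Finset.card_univ, ZMod.card, nsmul_eq_mul]
    have hn : (0 : ℝ) < ((2 ^ p : ℕ) : ℝ) := by positivity
    rw [exp_neg_accuracy Nat.one_le_two_pow hL]
    calc (∑ f, |(X f : ℝ)|) * (4 * (1 / (256 * ((2 ^ p : ℕ) : ℝ) ^ 3 * L)))
        ≤ ((2 ^ p : ℕ) * (L : ℝ)) * (4 * (1 / (256 * ((2 ^ p : ℕ) : ℝ) ^ 3 * L))) := by gcongr
      _ = 1 / (64 * ((2 ^ p : ℕ) : ℝ) ^ 2) := by field_simp; norm_num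

theorem accuracy_le {p L : ℕ} {c : ℝ} (hp : 1 ≤ p) (hL : 1 ≤ L)
    (hLc : (L : ℝ) ≤ ((2 ^ p : ℕ) : ℝ) ^ c) : accuracy (2 ^ p) L ≤ (11 + |c|) * p := by
  have hp' : (1 : ℝ) ≤ p := by exact_mod_cast hp
  have hL' : (0 : ℝ) < L := by exact_mod_cast hL
  have hlog2 : Real.log 2 ≤ 1 := by linarith [Real.log_two_lt_d9]
  have hlog0 : 0 ≤ Real.log 2 := Real.log_nonneg (by norm_num)
  have h1 : Real.log L ≤ |c| * p := by
    refine (Real.log_le_log hL' hLc).trans ?_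
    rw [Real.log_rpow (by positivity)]
    push_cast
    rw [Real.log_pow]
    calc c * (p * Real.log 2) ≤ |c| * (p * 1) := by
          gcongr
          exact le_abs_self c
      _ = |c| * p := by ring
  have h2 : (p : ℝ) * Real.log 2 ≤ p * 1 := by gcongr
  rw [accuracy_eq hL]
  linarith

/-- The algorithm is its outer loop, after a start that takes `O(k)` steps. -/
theorem expect_noiselessSparseFFT (m d a : ℕ) {n k L : ℕ} {x : ZMod n → ℂ} :
    ∃ c : ℕ, c ≤ 100 + 20 * k ∧ ∀ g : State Name × ℕ → ℝ≥0∞,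
      expect ((noiselessSparseFFT m d a).run (initialState n k L x)) g
        = expect (RunM.iterate (roundRun m d a)
          (((prelude.exec (initialState n k L x)).intReg .logK + 1).toNat)
          (prelude.exec (initialState n k L x))) fun r => g (r.1, c + r.2) := by
  set s₀ := initialState n k L x with hs₀
  have hk : s₀.intReg .k = k := rfl
  have c1 := steps_powerOfTwoAbove_le (pow := .K) (lg := .logK) (v := .k) (by decide) (by decide) s₀
    hk
  set s₁ := (powerOfTwoAbove .K .logK (int .k)).exec s₀ with hs₁
  set s₂ := (Name.delta ≔ 1 / toR (4 * (int .n * int .n) * int .L)).exec s₁ with hs₂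
  set s₃ := (Name.T ≔ .un .log (64 * toR (int .n) / real .delta)).exec s₂ with hs₃
  set s₄ := (Name.kt ≔ int .K).exec s₃ with hs₄
  set s₅ := (Name.pw ≔ (1 : IExpr)).exec s₄ with hs₅
  have hpre : prelude.exec s₀ = s₅ := rfl
  have c2 : (Name.delta ≔ 1 / toR (4 * (int .n * int .n) * int .L)).steps s₁ ≤ 20 :=
    Stmt.steps_le _ rfl (by decide)
  have c3 : (Name.T ≔ .un .log (64 * toR (int .n) / real .delta)).steps s₂ ≤ 20 :=
    Stmt.steps_le _ rfl (by decide)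
  have c4 : (Name.kt ≔ int .K).steps s₃ ≤ 20 := Stmt.steps_le _ rfl (by decide)
  have c5 : (Name.pw ≔ (1 : IExpr)).steps s₄ ≤ 20 := Stmt.steps_le _ rfl (by decide)
  have hprog : (noiselessSparseFFT m d a) = (powerOfTwoAbove .K .logK (int .k) ;;
    .delta ≔ 1 / toR (4 * (int .n * int .n) * int .L) ;;
    .T ≔ .un .log (64 * toR (int .n) / real .delta) ;;
    .kt ≔ int .K ;;
    .pw ≔ (1 : IExpr) ;;
    .loop .t (int .logK + 1) (roundBody m d a)) := rfl
  have hloop : ∀ s, (Stmt.loop .t (int .logK + 1) (roundBody m d a)).run s = RunM.charge 4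
    (RunM.iterate (roundRun m d a) (s.intReg .logK + 1).toNat s) := fun _ => rfl
  refine ⟨(powerOfTwoAbove .K .logK (int .k)).steps s₀
    + (Name.delta ≔ 1 / toR (4 * (int .n * int .n) * int .L)).steps s₁
    + (Name.T ≔ .un .log (64 * toR (int .n) / real .delta)).steps s₂
    + (Name.kt ≔ int .K).steps s₃ + (Name.pw ≔ (1 : IExpr)).steps s₄ + 4, by omega, fun g => ?_⟩
  rw [hprog, expect_seq_of_randFree rfl, expect_seq_of_randFree rfl, expect_seq_of_randFree rfl,
    expect_seq_of_randFree rfl, expect_seq_of_randFree rfl, ← hs₁, ← hs₂, ← hs₃, ← hs₄, ← hs₅,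
    hloop, expect_charge, hpre]
  congr 1
  funext r
  dsimp only
  generalize (powerOfTwoAbove .K .logK (int .k)).steps s₀ = A₁
  generalize Stmt.steps _ s₁ = A₂
  generalize Stmt.steps _ s₂ = A₃
  generalize Stmt.steps _ s₃ = A₄
  generalize Stmt.steps _ s₄ = A₅
  congr 2
  omega

theorem prelude_spec {p k L : ℕ} (m d : ℕ) (hk : 1 ≤ k) (x : ZMod (2 ^ p) → ℂ) :
    ∃ κ : ℕ, k ≤ 2 ^ κ ∧ 2 ^ κ < 2 * k ∧
      (prelude.exec (initialState (2 ^ p) k L x)).intReg .logK = κ ∧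
      LoopInv p κ m d (accuracy (2 ^ p) L) x 0 (prelude.exec (initialState (2 ^ p) k L x)) ∧
      ∀ i, (prelude.exec (initialState (2 ^ p) k L x)).intArr .zhat i = 0 := by
  set s₀ := initialState (2 ^ p) k L x with hs₀
  obtain ⟨κ, h1, h2, h3, h4⟩ := exec_powerOfTwoAbove (pow := .K) (lg := .logK) (v := .k) (by decide)
    (by decide) (by decide) (by decide) (by decide) (by decide) s₀ hk (show s₀.intReg .k = k from rfl)
  have hr : ∀ v, v ∉ [Name.K, .logK, .i] →
      ((powerOfTwoAbove .K .logK (int .k)).exec s₀).intReg v = s₀.intReg v := by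
    intro v hv
    simp only [List.mem_cons, List.not_mem_nil, or_false, not_or] at hv
    obtain ⟨h1, h2, h3⟩ := hv
    exact exec_intReg _ _ _ (by
      simp [Stmt.writesReg, powerOfTwoAbove, Ne.symm h1, Ne.symm h2, Ne.symm h3])
  have hn : ((powerOfTwoAbove .K .logK (int .k)).exec s₀).intReg .n = ((2 ^ p : ℕ) : ℤ) :=
    hr _ (by decide)
  have hL : ((powerOfTwoAbove .K .logK (int .k)).exec s₀).intReg .L = L := hr _ (by decide)
  have hz : ((powerOfTwoAbove .K .logK (int .k)).exec s₀).intReg .zcnt = 0 := hr _ (by decide)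
  have hia : ∀ v i, ((powerOfTwoAbove .K .logK (int .k)).exec s₀).intArr v i = 0 := fun v i => by
    rw [exec_intArr _ _ _ rfl]; rfl
  have hx : ∀ j : ℤ, 0 ≤ j → j < (2 ^ p : ℕ) →
      ((powerOfTwoAbove .K .logK (int .k)).exec s₀).cpxArr .x j = x (j : ZMod (2 ^ p)) := by
    intro j hj0 hj
    rw [exec_cpxArr _ _ _ rfl]
    exact if_pos ⟨hj0, hj⟩
  refine ⟨κ, h3, h4, ?_⟩
  unfold prelude
  simp only [exec_seq]
  generalize (powerOfTwoAbove .K .logK (int .k)).exec s₀ = s₁ at *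
  refine ⟨by simp [h2], ?_, by simp [hia]⟩
  constructor
  · simp [hn]
  · intro _
    simp [h1]
  · simp
  · simp [accuracy, hn, hL]
  · simpa using hx
  · simp [hia]
  · refine ⟨0, by simp [hz], ⟨fun l hl => by omega, fun l hl => by omega, fun i => ?_, fun i hi => ?_⟩,
      by simp [h1]⟩
    · simp [hia]
    · simp [hia] at hi

end Prelude

/-! ### Success probability and expected cost of the whole program -/

section Main

open scoped ENNReal

theorem expectedSteps_eq_expect {V : Type} (p : RunM V) :
    expectedSteps p = expect p fun r => (r.2 : ℝ≥0∞) := rfl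

open scoped Classical in
theorem probability_eq_expect {V : Type} (p : RunM V) (Q : State V → Prop) :
    probability p Q = expect p fun r => if Q r.1 then 1 else 0 := by
  unfold probability expect
  rw [PMF.toOuterMeasure_apply]
  refine tsum_congr fun r => ?_
  simp only [Set.indicator_apply, Set.mem_ofPred_eq]
  split_ifs <;> simp

open scoped Classical in
/-- If `G` implies `Q` on the support and fails with probability at most `1 / 3`, then `Q` holds
with probability at least `2 / 3`. -/
theorem two_thirds_le {V : Type} {p : RunM V} {Q G : State V → Prop}
    (h : ∀ r ∈ p.support, G r.1 → Q r.1)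
    (hG : expect p (fun r => if G r.1 then 0 else 1) ≤ ENNReal.ofReal (1 / 3)) :
    2 / 3 ≤ expect p fun r => if Q r.1 then 1 else 0 := by
  have h1 : (1 : ℝ≥0∞) ≤ (expect p fun r => if Q r.1 then 1 else 0)
      + expect p (fun r => if G r.1 then 0 else 1) := by
    rw [← expect_add]
    refine (expect_const p 1).symm.trans_le ?_
    refine expect_mono p fun r hr => ?_
    by_cases hg : G r.1
    · simp [h r hr hg]
    · simp [hg]
  have h2 : (2 / 3 : ℝ≥0∞) + 1 / 3 = 1 := by
    rw [ENNReal.div_add_div_same, show (2 + 1 : ℝ≥0∞) = 3 by norm_num]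
    exact ENNReal.div_self (by norm_num) (by norm_num)
  have h3 : ENNReal.ofReal (1 / 3) = 1 / 3 := by
    rw [ENNReal.ofReal_div_of_pos (by norm_num)]; simp
  rw [h3] at hG
  have h4 : (2 / 3 : ℝ≥0∞) + 1 / 3 ≤ (expect p fun r => if Q r.1 then 1 else 0) + 1 / 3 := by
    rw [h2]; exact h1.trans (by gcongr)
  exact (ENNReal.add_le_add_iff_right (by simp)).1 h4

/-- The constant in the bound on the expected running time. -/
noncomputable def costConstant (m d a : ℕ) (A : ℝ) : ℝ :=
  4 * (120 + (4 * costDecay m d a A + 2 * (800 * 2 ^ (m + d) + 2540) + (20 * A + 40)))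

end Main
end SparseFFT

theorem mainTheorem1 :
    -- for all sufficiently large tuning constants, that is, all sufficiently small `β`, `alpha_0`
    ∃ m₀ d₀ a₀ : ℕ, ∀ m d a : ℕ, m₀ ≤ m → d₀ ≤ d → a₀ ≤ a →
      -- `c` is the exponent in `L = n ^ O(1)`
      ∀ c : ℝ, ∃ C : ℝ, 0 < C ∧
        ∀ p : ℕ, 1 ≤ p → ∀ k : ℕ, 1 ≤ k → k ≤ 2 ^ p →
        ∀ L : ℕ, 1 ≤ L → (L : ℝ) ≤ ((2 ^ p : ℕ) : ℝ) ^ c →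
        ∀ x : ZMod (2 ^ p) → ℂ,
          (∀ i, ∃ v : ℤ, |v| ≤ (L : ℤ) ∧ SparseFFT.spectrum x i = (v : ℂ)) →
          {i | SparseFFT.spectrum x i ≠ 0}.ncard ≤ k →
          2 / 3 ≤ SparseFFT.probability
              ((SparseFFT.noiselessSparseFFT m d a).run (SparseFFT.initialState (2 ^ p) k L x))
              (fun s => SparseFFT.returned s = SparseFFT.spectrum x) ∧
          SparseFFT.expectedSteps
              ((SparseFFT.noiselessSparseFFT m d a).run (SparseFFT.initialState (2 ^ p) k L x))
            ≤ ENNReal.ofReal (C * (k : ℝ) * Real.log ((2 ^ p : ℕ) : ℝ)) := by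
  classical
  refine ⟨11, 11, 11, fun m d a hm hd ha c => ⟨SparseFFT.costConstant m d a (11 + |c|), ?_, ?_⟩⟩
  · unfold SparseFFT.costConstant SparseFFT.costDecay
    positivity
  intro p hp k hk hkn L hL hLc x hint hsparse
  choose X hXL hX using hint
  obtain ⟨κ, hk1, hk2, hlog, hinv, hzero⟩ := SparseFFT.prelude_spec (L := L) m d hk x
  obtain ⟨c₀, hc₀, hrun⟩ := SparseFFT.expect_noiselessSparseFFT m d a (k := k) (L := L) (x := x)
  set s := SparseFFT.prelude.exec (SparseFFT.initialState (2 ^ p) k L x) with hs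
  have hacc := SparseFFT.accurate hp hL hX hXL
  have hA : (1 : ℝ) ≤ 11 + |c| := by have := abs_nonneg c; linarith
  have hκ : κ ≤ p := by
    have h1 : 2 ^ κ < 2 ^ (p + 1) := by rw [pow_succ]; omega
    have := (Nat.pow_lt_pow_iff_right (by norm_num)).1 h1
    omega
  have hres : (SparseFFT.residual X s).card ≤ 2 ^ κ := by
    refine le_trans (le_of_eq ?_) (hsparse.trans hk1)
    rw [← Set.ncard_coe_finset]
    congr 1
    ext f
    simp [SparseFFT.residual, hzero, hX]
  obtain ⟨hsupp, hfail, hcost⟩ := SparseFFT.expect_rounds hacc hm hd ha hA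
    (SparseFFT.accuracy_le hp hL hLc) hκ hinv hres
  have hlog' : ((s.intReg .logK + 1).toNat) = κ + 1 := by rw [hlog]; omega
  rw [hlog'] at hrun
  constructor
  · rw [SparseFFT.probability_eq_expect, hrun]
    refine SparseFFT.two_thirds_le (Q := fun s => SparseFFT.returned s = SparseFFT.spectrum x)
      (G := SparseFFT.Good p κ m d X (κ + 1)) (fun r hr hG => (hsupp r hr).returned_eq hX ?_) hfail
    -- the residual has at most `2 ^ κ / 8 ^ (κ + 1) < 1` elements
    by_contra h0
    have h1 : 1 * 8 ^ (κ + 1) ≤ 2 ^ κ :=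
      (Nat.mul_le_mul_right _ (Nat.one_le_iff_ne_zero.2 h0)).trans hG.1
    have h2 : 2 ^ κ < 8 ^ (κ + 1) :=
      (Nat.pow_lt_pow_right (by norm_num) (by omega)).trans_le
        (Nat.pow_le_pow_left (by norm_num) (κ + 1))
    omega
  · rw [SparseFFT.expectedSteps_eq_expect, hrun]
    have h1 : ∀ r : SparseFFT.State SparseFFT.Name × ℕ,
        ((c₀ + r.2 : ℕ) : ENNReal) = c₀ + (r.2 : ENNReal) := fun r => by push_cast; rfl
    simp only [h1]
    rw [SparseFFT.expect_add, SparseFFT.expect_const, ← ENNReal.ofReal_natCast]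
    refine (add_le_add_right hcost _).trans ?_
    have hp' : (1 : ℝ) ≤ p := by exact_mod_cast hp
    have hsum0 : 0 ≤ ∑ t ∈ Finset.range (κ + 1), SparseFFT.costBound p κ m d a (11 + |c|) t :=
      Finset.sum_nonneg fun t _ => SparseFFT.costBound_nonneg (by linarith)
    rw [← ENNReal.ofReal_add (Nat.cast_nonneg _) hsum0]
    refine ENNReal.ofReal_le_ofReal ?_
    have h2 := SparseFFT.sum_costBound_le (m := m) (d := d) (a := a)
      (show (0 : ℝ) ≤ 11 + |c| by linarith) hp hκ
    unfold SparseFFT.costConstant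
    set Y : ℝ := 4 * SparseFFT.costDecay m d a (11 + |c|) + 2 * (800 * 2 ^ (m + d) + 2540)
      + (20 * (11 + |c|) + 40) with hY
    have hY0 : 0 ≤ Y := by
      rw [hY]; unfold SparseFFT.costDecay; positivity
    have hk1' : (1 : ℝ) ≤ k := by exact_mod_cast hk
    have hK1 : (1 : ℝ) ≤ 2 ^ κ := one_le_pow₀ (by norm_num)
    have hK2 : (2 : ℝ) ^ κ ≤ 2 * k := by exact_mod_cast hk2.le
    have hkK : (k : ℝ) ≤ 2 ^ κ := by exact_mod_cast hk1
    have hc : (c₀ : ℝ) ≤ 100 + 20 * k := by exact_mod_cast hc₀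
    have hKp : (1 : ℝ) * 1 ≤ 2 ^ κ * p := by gcongr
    have hkKp : (k : ℝ) * 1 ≤ 2 ^ κ * p := by gcongr
    have hlog2 : (p : ℝ) ≤ 2 * Real.log ((2 ^ p : ℕ) : ℝ) := by
      push_cast
      rw [Real.log_pow]
      nlinarith [Real.log_two_gt_d9]
    calc (c₀ : ℝ) + ∑ t ∈ Finset.range (κ + 1), SparseFFT.costBound p κ m d a (11 + |c|) t
        ≤ (120 + Y) * (2 ^ κ * p) := by linarith
      _ ≤ (120 + Y) * ((2 * k) * (2 * Real.log ((2 ^ p : ℕ) : ℝ))) := by gcongr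
      _ = 4 * (120 + Y) * k * Real.log ((2 ^ p : ℕ) : ℝ) := by ring
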